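/- Let $(W,S)$ be an arbitrary Coxeter system with length function $\ell$ and set of reflections $T=\{wsw^{-1}\}$. The Bruhat graph of $W$ has an edge $x\xrightarrow{t}y$ whenever $yx^{-1}=t\in T$ and $\ell(x)<\ell(y)$; let $P_h(u,v)$ be the set of its paths of length $h$ from $u$ to $v$. On the set $X$ of middle vertices of paths in $P_2(u,v)$ there is a unique fixed-point free involution $f$ such that $\ell(f(x_1))<\ell(f(x_2))$ whenever $\ell(x_1)<\ell(x_2)$ and $x_2\ne f(x_1)$. The flip of $u\to x\to v$ is $u\to f(x)\to v$, and the $i$-th flip $f_i$ of a path $x_0\to\cdots\to x_h$ ($1\le i\le h-1$) flips its subpath $x_{i-1}\to x_i\to x_{i+1}$. An $h$-flipclass $F$ is a minimal nonempty subset of some $P_h(u,v)$ closed under all flips. Let $E(F)$ and $T(F)$ be the sets of vertices and of labels occurring in paths of $F$, and let $W(F)=\langle T(F)\rangle$, regarded as a Coxeter group with its canonical generators $\chi(W(F))$, where, for a reflection subgroup $W'$, $\chi(W')=\{t\in T:\{r\in T\cap W':\ell(rt)<\ell(t)\}=\{t\}\}$. The rank of $W(F)$ is $|\chi(W(F))|$.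 The flipclass $F$ is of finite type if $W(F)$ is finite, of Weyl type if $W(F)$ is a Weyl group (a finite crystallographic Coxeter group), and of symmetric type if $W(F)$ is (as a Coxeter group) a finite product of Weyl groups of type $A$. It is irreducible if $T(F)$ is not a disjoint union of two nonempty sets that commute elementwise. A Coxeter system is irreducible if its set of generators has no such partition. A reflection ordering is a total order $\preceq$ on $T$ such that, for each reflection subgroup $W'$ with $\chi(W')=\{a,b\}$, $a\neq b$, its reflections are ordered either as $a\preceq aba\preceq ababa\preceq\cdots\preceq bab\preceq b$ or in the reverse way. A path is increasing if its labels increase weakly with respect to $\preceq$; $c(F)$ denotes the number of increasing paths of $F$ when this is the same for all reflection orderings. Two $h$-flipclasses $F$ and $F'$, of possibly different Coxeter groups, are isomorphic if there are bijections $\varepsilon:E(F)\to E(F')$ and $\tau:T(F)\to T(F')$ such that a labelled path with vertices in $E(F)$ and labels in $T(F)$ lies in $F$ if and only if its image under $(\varepsilon,\tau)$ lies in $F'$, the induced bijection $F\to F'$ commutes with all flips $f_i$, and $\tau$ is order preserving for some reflection ordering of each of the two groups. Theorem. Let $h\ge 0$ and let $F$ be an $h$-flipclass of finite, Weyl or symmetric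 type of an arbitrary Coxeter group. Then $(W(F),\chi(W(F)))$ is a finite Coxeter system and $F$ is isomorphic to an $h$-flipclass $\bar F$ of it; $c(F)$ and $c(\bar F)$ are well defined and $c(F)=c(\bar F)$. Moreover, $W(F)$ is a Weyl group if $F$ is of Weyl type, a product of Weyl groups of type $A$ if $F$ is of symmetric type, has rank at most $h$, and is irreducible if $F$ is irreducible. Furthermore, for each $h\ge 0$ there are only finitely many isomorphism classes of $h$-flipclasses of finite type (over all Coxeter groups). -/

import Mathlib

universe u v

/-! ### Coxeter groups presented by a set of generators -/

section Generators

variable {G : Type*} [Group G]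

/-- `X` is the disjoint union of two nonempty subsets that commute elementwise. -/
def HasCommutingPartition (X : Set G) : Prop :=
  ∃ X₁ X₂ : Set G, X₁.Nonempty ∧ X₂.Nonempty ∧ Disjoint X₁ X₂ ∧ X₁ ∪ X₂ = X ∧
    ∀ a ∈ X₁, ∀ b ∈ X₂, a * b = b * a

/-- The group `G` with the set `S` of Coxeter generators is a Weyl group: a finite Coxeter group
that is crystallographic, i.e. the order `m(a, b)` of `a * b` belongs to `{2, 3, 4, 6}` for all
distinct generators `a`, `b`. -/
def IsWeylGroup (S : Set G) : Prop :=
  Finite G ∧ ∀ a ∈ S, ∀ b ∈ S, a ≠ b → orderOf (a * b) ∈ ({2, 3, 4, 6} : Set ℕ)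

/-- The group `G` with the set `S` of Coxeter generators is a (finite) product of Weyl groups of
type `A`: the Weyl group of type `A_n` is the symmetric group on `n + 1` letters, generated by the
`n` adjacent transpositions. -/
def IsProductOfTypeA (S : Set G) : Prop :=
  ∃ (k : ℕ) (n : Fin k → ℕ) (φ : G ≃* ((i : Fin k) → Equiv.Perm (Fin (n i + 1)))),
    φ '' S = {g | ∃ (i : Fin k) (j : Fin (n i)),
      g = Pi.mulSingle i (Equiv.swap j.castSucc j.succ)}

end Generators

namespace CoxeterSystem

section Basic

variable {B : Type u} {W : Type v} [Group W] {M : CoxeterMatrix B} (cs : CoxeterSystem M W)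

/-! ### Reflection subgroups and reflection orderings -/

/-- A reflection subgroup is a subgroup generated by the reflections that it contains. -/
def IsReflectionSubgroup (H : Subgroup W) : Prop :=
  Subgroup.closure {t | t ∈ H ∧ cs.IsReflection t} = H

/-- The canonical set `χ(H)` of Coxeter generators of a reflection subgroup `H`, as a subset of the
group `H`: the reflections `t` such that `t` is the only reflection `r` in `H` with
`ℓ (r * t) < ℓ t`. -/
def canonicalGenerators (H : Subgroup W) : Set H :=
  {t | cs.IsReflection (t : W) ∧
    {r : W | cs.IsReflection r ∧ r ∈ H ∧ cs.length (r * (t : W)) < cs.length (t : W)} = {(t : W)}}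

/-- The chain `a ⪯ aba ⪯ ababa ⪯ ⋯ ⪯ babab ⪯ bab ⪯ b` of all reflections of the dihedral group with
canonical generators `a` and `b`. With `m` the order of `a * b` (`m = 0` if it is infinite), the
reflections are `(ab)^i a` and `(ba)^i b`; if `m` is finite, then `(ba)^j b = (ab)^(m - 1 - j) a`. -/
def IsDihedralChain (r : W → W → Prop) (a b : W) : Prop :=
  (∀ i j : ℕ, i < j → (orderOf (a * b) = 0 ∨ j < orderOf (a * b)) →
    r ((a * b) ^ i * a) ((a * b) ^ j * a)) ∧
  (∀ i j : ℕ, i < j → (orderOf (a * b) = 0 ∨ j < orderOf (a * b)) →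
    r ((b * a) ^ j * b) ((b * a) ^ i * b)) ∧
  (∀ i j : ℕ, (orderOf (a * b) = 0 ∨ i + j + 1 < orderOf (a * b)) →
    r ((a * b) ^ i * a) ((b * a) ^ j * b))

/-- `r` (read `⪯`) is a reflection ordering: a total order on the set of reflections such that the
reflections of every dihedral reflection subgroup (one with exactly two canonical generators) are
ordered as `a ⪯ aba ⪯ ⋯ ⪯ bab ⪯ b` or as `b ⪯ bab ⪯ ⋯ ⪯ aba ⪯ a`. The values of `r` on elements that
are not reflections play no role. -/
structure IsReflectionOrdering (r : W → W → Prop) : Prop where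
  refl : ∀ a, cs.IsReflection a → r a a
  antisymm : ∀ a b, cs.IsReflection a → cs.IsReflection b → r a b → r b a → a = b
  trans : ∀ a b c, cs.IsReflection a → cs.IsReflection b → cs.IsReflection c →
    r a b → r b c → r a c
  total : ∀ a b, cs.IsReflection a → cs.IsReflection b → r a b ∨ r b a
  dihedral : ∀ H : Subgroup W, cs.IsReflectionSubgroup H →
    ∀ a b : H, a ≠ b → cs.canonicalGenerators H = {a, b} →
      IsDihedralChain r (a : W) (b : W) ∨ IsDihedralChain r (b : W) (a : W)

/-! ### Paths in the Bruhat graph, flips and flipclasses -/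

/-- There is an edge `x ⟶ y` in the Bruhat graph (its label is the reflection `y * x⁻¹`). -/
def BruhatEdge (x y : W) : Prop :=
  cs.length x < cs.length y ∧ cs.IsReflection (y * x⁻¹)

/-- The set `P_h(u, v)` of paths `u = x 0 ⟶ x 1 ⟶ ⋯ ⟶ x h = v` of the Bruhat graph. -/
def bruhatPaths (h : ℕ) (u v : W) : Set (Fin (h + 1) → W) :=
  {x | x 0 = u ∧ x (Fin.last h) = v ∧ ∀ i : Fin h, cs.BruhatEdge (x i.castSucc) (x i.succ)}

/-- The label of the edge between time `i` and time `i + 1`. -/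
def pathLabel {h : ℕ} (x : Fin (h + 1) → W) (i : Fin h) : W :=
  x i.succ * (x i.castSucc)⁻¹

/-- The set of middle vertices of the paths of length two from `u` to `v`. -/
def middles (u v : W) : Set W :=
  {x | cs.BruhatEdge u x ∧ cs.BruhatEdge x v}

/-- `f` restricts to a fixed-point free involution of the set `X` of middle vertices of the paths of
length two from `u` to `v` such that, for `x₁, x₂ ∈ X` with `ℓ x₁ < ℓ x₂` and `x₂ ≠ f x₁`, one has
`ℓ (f x₁) < ℓ (f x₂)`. There is exactly one such involution of `X`. -/
structure IsFlipInvolution (u v : W) (f : W → W) : Prop where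
  mapsTo : ∀ x ∈ cs.middles u v, f x ∈ cs.middles u v
  invol : ∀ x ∈ cs.middles u v, f (f x) = x
  fixedPointFree : ∀ x ∈ cs.middles u v, f x ≠ x
  length_lt : ∀ x₁ ∈ cs.middles u v, ∀ x₂ ∈ cs.middles u v,
    cs.length x₁ < cs.length x₂ → x₂ ≠ f x₁ → cs.length (f x₁) < cs.length (f x₂)

open Classical in
/-- The middle vertex `f x` of the flip of `u ⟶ x ⟶ v`, where `f` is the involution above. -/
noncomputable def flipMiddle (u v x : W) : W :=
  if hf : ∃ f : W → W, cs.IsFlipInvolution u v f then hf.choose x else x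

/-- The flip of the path `x` at its `(i + 1)`-st vertex, `1 ≤ i + 1 ≤ h - 1`. -/
noncomputable def flip {h : ℕ} (i : ℕ) (hi : i + 1 < h) (x : Fin (h + 1) → W) :
    Fin (h + 1) → W :=
  Function.update x ⟨i + 1, by omega⟩
    (cs.flipMiddle (x ⟨i, by omega⟩) (x ⟨i + 2, by omega⟩) (x ⟨i + 1, by omega⟩))

/-- `F` is an `h`-flipclass: for some `u` and `v`, a minimal nonempty subset of `P_h(u, v)` closed
under all flips. -/
def IsFlipclass {h : ℕ} (F : Set (Fin (h + 1) → W)) : Prop :=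
  ∃ u v : W, Minimal (fun G : Set (Fin (h + 1) → W) =>
    G.Nonempty ∧ G ⊆ cs.bruhatPaths h u v ∧
      ∀ x ∈ G, ∀ (i : ℕ) (hi : i + 1 < h), cs.flip i hi x ∈ G) F

/-! ### Vertices, labels and the reflection subgroup of a flipclass -/

/-- The set `E(F)` of the elements lying on a path of `F`. -/
def vertexSet {h : ℕ} (F : Set (Fin (h + 1) → W)) : Set W :=
  {w | ∃ x ∈ F, ∃ i, x i = w}

/-- The set `T(F)` of the reflections labelling an edge of a path of `F`. -/
def labelSet {h : ℕ} (F : Set (Fin (h + 1) → W)) : Set W :=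
  {t | ∃ x ∈ F, ∃ i, pathLabel x i = t}

/-- The reflection subgroup `W(F)` generated by `T(F)`. -/
def labelSubgroup {h : ℕ} (F : Set (Fin (h + 1) → W)) : Subgroup W :=
  Subgroup.closure (labelSet F)

/-- `F` is irreducible: `T(F)` has no nontrivial partition into two commuting parts. -/
def IsIrreducibleFlipclass {h : ℕ} (F : Set (Fin (h + 1) → W)) : Prop :=
  ¬ HasCommutingPartition (labelSet F)

/-- `F` is of finite type: `W(F)` is finite. -/
def IsFiniteType {h : ℕ} (F : Set (Fin (h + 1) → W)) : Prop :=
  Finite (labelSubgroup F)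

/-- `F` is of Weyl type: `W(F)`, with its canonical generators, is a Weyl group. -/
def IsWeylType {h : ℕ} (F : Set (Fin (h + 1) → W)) : Prop :=
  IsWeylGroup (cs.canonicalGenerators (labelSubgroup F))

/-- `F` is of symmetric type: `W(F)`, with its canonical generators, is a product of Weyl groups of
type `A`. -/
def IsSymmetricType {h : ℕ} (F : Set (Fin (h + 1) → W)) : Prop :=
  IsProductOfTypeA (cs.canonicalGenerators (labelSubgroup F))

/-- The path `x` is increasing with respect to `r`. -/
def IsIncreasing {h : ℕ} (r : W → W → Prop) (x : Fin (h + 1) → W) : Prop :=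
  ∀ i j : Fin h, i < j → r (pathLabel x i) (pathLabel x j)

/-- `c(F)` is well defined and equal to `c`: reflection orderings exist, and `F` has exactly `c`
increasing paths with respect to each of them. -/
def HasIncreasingCount {h : ℕ} (F : Set (Fin (h + 1) → W)) (c : ℕ) : Prop :=
  (∃ r, cs.IsReflectionOrdering r) ∧
    ∀ r, cs.IsReflectionOrdering r → {x | x ∈ F ∧ IsIncreasing r x}.encard = c

end Basic

/-! ### Isomorphism of flipclasses -/

/-- The flipclasses `F` and `F'` (of two possibly different Coxeter groups) are isomorphic: there
are bijections `ε : E(F) → E(F')` and `τ : T(F) → T(F')` which match the labelled paths of `F` with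
those of `F'` and the flips of `F` with those of `F'`, and such that `τ` is order preserving with
respect to some reflection ordering of each of the two groups. -/
def FlipclassIso {B W B' W' : Type*} [Group W] [Group W'] {M : CoxeterMatrix B}
    {M' : CoxeterMatrix B'} (cs : CoxeterSystem M W) (cs' : CoxeterSystem M' W') {h : ℕ}
    (F : Set (Fin (h + 1) → W)) (F' : Set (Fin (h + 1) → W')) : Prop :=
  ∃ (ε : W → W') (τ : W → W'),
    Set.BijOn ε (vertexSet F) (vertexSet F') ∧
    Set.BijOn τ (labelSet F) (labelSet F') ∧
    (∀ (x : Fin (h + 1) → W) (t : Fin h → W), (∀ i, x i ∈ vertexSet F) → (∀ i, t i ∈ labelSet F) →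
      ((x ∈ F ∧ pathLabel x = t) ↔ (ε ∘ x ∈ F' ∧ pathLabel (ε ∘ x) = τ ∘ t))) ∧
    (∀ x ∈ F, ∀ (i : ℕ) (hi : i + 1 < h), ε ∘ cs.flip i hi x = cs'.flip i hi (ε ∘ x)) ∧
    ∃ (r : W → W → Prop) (r' : W' → W' → Prop),
      cs.IsReflectionOrdering r ∧ cs'.IsReflectionOrdering r' ∧
      ∀ s ∈ labelSet F, ∀ t ∈ labelSet F, (r s t ↔ r' (τ s) (τ t))

end CoxeterSystem

/-- An `h`-flipclass together with its Coxeter system. -/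
structure Flipclass (h : ℕ) : Type (max (u + 1) (v + 1)) where
  B : Type u
  W : Type v
  [group : Group W]
  M : CoxeterMatrix B
  cs : CoxeterSystem M W
  F : Set (Fin (h + 1) → W)
  isFlipclass : cs.IsFlipclass F

namespace Flipclass

attribute [instance] Flipclass.group

/-- The flipclass is of finite type. -/
def IsFiniteType {h : ℕ} (X : Flipclass.{u, v} h) : Prop :=
  CoxeterSystem.IsFiniteType X.F

/-- The isomorphism class of a flipclass: all flipclasses (of all Coxeter groups) isomorphic to
it. -/
def isoClass {h : ℕ} (X : Flipclass.{u, v} h) : Set (Flipclass.{u, v} h) :=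
  {Y | CoxeterSystem.FlipclassIso X.cs Y.cs X.F Y.F}

end Flipclass

/-! Everything is read off from roots. A Coxeter group acts faithfully on a real vector space with a
symmetric form, each reflection t has one positive root β_t, and ℓ(tw) < ℓ(w) holds exactly when
w⁻¹β_t is negative (`RootBasis.length_reflection_mul_lt_iff`). A `RootBasis` asks only that the
simple roots span a salient cone, not that they be linearly independent, so the notion passes to the
canonical roots of a reflection subgroup H, which may be dependent (`RootBasis.restrict`). This
makes H a Coxeter group on χ(H) (`RootBasis.subsystem`), and right translation by the shortest
element of a coset identifies the Bruhat graph of H with the one induced on that coset, labels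
included (`RootBasis.subsystem_bruhatEdge_iff`).

A flip takes place in a coset of a maximal dihedral reflection subgroup. Such a coset is arranged in
levels of at most two elements, and a flip exchanges the two middle vertices of one level. Hence
f(x) is the only other middle vertex that is not joined to x by a path of length two
(`RootBasis.flipMiddle_eq_iff`), a description in terms of edges alone. So flips commute with the
translation, and F becomes a flipclass of W(F) (`RootBasis.exists_flipclass_subsystem`). A flip also
preserves the plane of two consecutive label roots; thus all roots of W(F) lie in the span of the h
label roots of a single path, which bounds the rank. If the generators split into commuting parts,
the roots split into orthogonal parts, and with them the labels.

For c(F), a reflection ordering of the finite group W(F) is the inversion sequence of a reduced word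
of the longest element (`RootBasis.exists_leftInvSeq_eq`), and a path is increasing when its label
list is a sublist of it. Reduced words of one element are related by braid moves. A braid move
reverses the block of reflections of one dihedral subgroup, and flipping all inner vertices of the
part of a path inside this block turns increasing into decreasing, injectively
(`RootBasis.IsDihedral.encard_sublist_le`). Reflection orderings of W restrict to W(F), so the count
is also well defined when W is infinite.

For finiteness it is enough to bound the number of vertices when W(F) is the whole group, finite and
of rank at most h. An entry m(i,j) ≥ 6 isolates the pair {i,j}, because otherwise an affine diagram
of type G₂ or a larger one would appear. The remaining components have entries below 6, hence
bounded order. In a dihedral component of unbounded order flips create no new lengths, so at most h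
+ 1 lengths occur, with at most two elements each. Boundedly many vertices leave finitely many codes
for paths, flips and label orders. -/

open scoped NNReal

/-! ### Coefficients of the roots of a dihedral group -/

/-- The coefficients of the roots of a dihedral group with respect to its two simple roots `α`, `β`
with `(α, α) = (β, β) = 2` and `(α, β) = -x`: the roots are the vectors `p (j + 1) α + p j β` and
`p j α + p (j + 1) β`, up to sign. If `x = 2 cos θ`, then `p j = sin (j θ) / sin θ`. -/
noncomputable def dihedralCoeff (x : ℝ) : ℕ → ℝ
  | 0 => 0
  | 1 => 1
  | n + 2 => x * dihedralCoeff x (n + 1) - dihedralCoeff x n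

section dihedralCoeff

variable (x : ℝ)

@[simp] theorem dihedralCoeff_zero : dihedralCoeff x 0 = 0 := rfl

@[simp] theorem dihedralCoeff_one : dihedralCoeff x 1 = 1 := rfl

theorem dihedralCoeff_add_two (n : ℕ) :
    dihedralCoeff x (n + 2) = x * dihedralCoeff x (n + 1) - dihedralCoeff x n := rfl

/-- The recursion preserves this determinant when i grows, and i = 0 gives the value. It is the
determinant of two roots counted from the same end of a dihedral chain, so the sign of p k orients
them. -/
theorem dihedralCoeff_mul_sub_mul (i k : ℕ) :
    dihedralCoeff x (i + 1) * dihedralCoeff x (i + k)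
      - dihedralCoeff x i * dihedralCoeff x (i + k + 1) = dihedralCoeff x k := by
  induction i with
  | zero => simp
  | succ i ih =>
    have h1 : dihedralCoeff x (i + 1 + k + 1) =
        x * dihedralCoeff x (i + k + 1) - dihedralCoeff x (i + k) := by
      rw [show i + 1 + k + 1 = (i + k) + 2 by ring, dihedralCoeff_add_two]
    rw [h1, dihedralCoeff_add_two, show i + 1 + k = i + k + 1 by ring]
    linear_combination ih

/-- Shifting one unit from i to j reduces to i = 0. This is the determinant of two roots counted
from opposite ends of a dihedral chain. -/
theorem dihedralCoeff_mul_sub_mul' (i j : ℕ) :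
    dihedralCoeff x (i + 1) * dihedralCoeff x (j + 1) - dihedralCoeff x i * dihedralCoeff x j
      = dihedralCoeff x (i + j + 1) := by
  induction i generalizing j with
  | zero => simp
  | succ i ih =>
    have h := ih (j + 1)
    rw [show i + (j + 1) + 1 = i + 1 + j + 1 by ring, dihedralCoeff_add_two] at h
    rw [dihedralCoeff_add_two]
    linear_combination h

/-- If p k vanished, the determinant identity would read -p (k - 1) * p (k + 1) = 1, although both
factors are nonnegative. -/
theorem dihedralCoeff_pos {m : ℕ} (h : ∀ k, (m = 0 ∨ k ≤ m) → 0 ≤ dihedralCoeff x k) {k : ℕ}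
    (hk : 0 < k) (hkm : m = 0 ∨ k < m) : 0 < dihedralCoeff x k := by
  refine lt_of_le_of_ne (h k (by omega)) fun h0 => ?_
  obtain ⟨k, rfl⟩ : ∃ k', k = k' + 1 := ⟨k - 1, by omega⟩
  have h1 := dihedralCoeff_mul_sub_mul x k 1
  have h2 := mul_nonneg (h k (by omega)) (h (k + 2) (by omega))
  rw [← h0, show k + 1 + 1 = k + 2 by ring, dihedralCoeff_one] at h1
  linarith

end dihedralCoeff

/-! ### Reflections with respect to a bilinear form -/

section IsReflectionAlong

variable {E : Type*} [AddCommGroup E] [Module ℝ E] (form : E →ₗ[ℝ] E →ₗ[ℝ] ℝ)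

/-- `g` is the orthogonal reflection in the vector `β`, which has norm `2`. -/
def IsReflectionAlong (β : E) (g : E ≃ₗ[ℝ] E) : Prop :=
  form β β = 2 ∧ ∀ y, g y = y - form β y • β

variable {form}

theorem IsReflectionAlong.apply_self {β : E} {g : E ≃ₗ[ℝ] E} (h : IsReflectionAlong form β g) :
    g β = -β := by
  rw [h.2, h.1, two_smul]; abel

theorem IsReflectionAlong.ne_zero {β : E} {g : E ≃ₗ[ℝ] E} (h : IsReflectionAlong form β g) :
    β ≠ 0 := by
  rintro rfl
  simpa using h.1

theorem IsReflectionAlong.eq {β : E} {g g' : E ≃ₗ[ℝ] E} (h : IsReflectionAlong form β g)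
    (h' : IsReflectionAlong form β g') : g = g' := by
  ext y; rw [h.2, h'.2]

theorem IsReflectionAlong.neg {β : E} {g : E ≃ₗ[ℝ] E} (h : IsReflectionAlong form β g) :
    IsReflectionAlong form (-β) g := by
  refine ⟨by simpa using h.1, fun y => by simpa using h.2 y⟩

theorem IsReflectionAlong.mul_self {β : E} {g : E ≃ₗ[ℝ] E} (h : IsReflectionAlong form β g) :
    g * g = 1 := by
  ext y
  simp only [LinearEquiv.mul_apply, LinearEquiv.coe_one, id_eq]
  rw [h.2 y, map_sub, map_smul, h.apply_self, h.2 y]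
  module

theorem IsReflectionAlong.eq_or_eq_neg {β β' : E} {g : E ≃ₗ[ℝ] E}
    (h : IsReflectionAlong form β g) (h' : IsReflectionAlong form β' g) : β' = β ∨ β' = -β := by
  have h1 : β' = ((1 / 2) * form β β') • β := by
    have := h.2 β'
    rw [h'.apply_self] at this
    have h2 : (2 : ℝ) • β' = form β β' • β := by
      rw [two_smul]
      nth_rewrite 1 [← neg_neg β']
      rw [this]; abel
    rw [mul_smul, ← h2, smul_smul]
    norm_num
  have hc : ((1 / 2) * form β β') ^ 2 = 1 := by
    have := h'.1
    rw [h1] at this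
    simp only [map_smul, LinearMap.smul_apply, smul_eq_mul, h.1] at this
    linarith
  rcases sq_eq_one_iff.mp hc with hc | hc
  · left; rw [h1, hc, one_smul]
  · right; rw [h1, hc, neg_one_smul]

variable (hsymm : ∀ y z, form y z = form z y)
include hsymm

theorem IsReflectionAlong.form_apply_apply {β : E} {g : E ≃ₗ[ℝ] E}
    (h : IsReflectionAlong form β g) (y z : E) : form (g y) (g z) = form y z := by
  simp only [h.2, map_sub, map_smul, LinearMap.sub_apply, LinearMap.smul_apply, smul_eq_mul, h.1,
    hsymm y β]
  ring

omit hsymm in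
theorem IsReflectionAlong.conj {β : E} {f g : E ≃ₗ[ℝ] E} (h : IsReflectionAlong form β g)
    (hf : ∀ y z, form (f y) (f z) = form y z) : IsReflectionAlong form (f β) (f * g * f⁻¹) := by
  refine ⟨by rw [hf, h.1], fun y => ?_⟩
  have h1 : f (f⁻¹ y) = y := LinearEquiv.apply_symm_apply f y
  simp only [LinearEquiv.mul_apply]
  rw [h.2, map_sub, map_smul, h1]
  rw [← hf, h1]

variable {α β : E} {a b : E ≃ₗ[ℝ] E} (ha : IsReflectionAlong form α a)
  (hb : IsReflectionAlong form β b)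
include ha hb

/-- Conjugating by `a` and by `b` alternately adds a letter at each end of the word, and its effect
on the coefficients of the root is the recursion for p. -/
theorem IsReflectionAlong.chain (j : ℕ) :
    IsReflectionAlong form (dihedralCoeff (-form α β) (j + 1) • α + dihedralCoeff (-form α β) j • β)
      ((a * b) ^ j * a) ∧
    IsReflectionAlong form (dihedralCoeff (-form α β) j • α + dihedralCoeff (-form α β) (j + 1) • β)
      ((b * a) ^ j * b) := by
  have key : ∀ {α β : E} {a b : E ≃ₗ[ℝ] E} (_ : IsReflectionAlong form α a) (j : ℕ),
      IsReflectionAlong form (dihedralCoeff (-form α β) j • α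
        + dihedralCoeff (-form α β) (j + 1) • β) ((b * a) ^ j * b) →
      IsReflectionAlong form (dihedralCoeff (-form α β) (j + 2) • α
        + dihedralCoeff (-form α β) (j + 1) • β) ((a * b) ^ (j + 1) * a) := by
    intro α β a b ha j h
    have h1 := h.conj (f := a) (ha.form_apply_apply hsymm)
    convert h1 using 1
    · rw [map_add, map_smul, map_smul, ha.apply_self, ha.2 β, dihedralCoeff_add_two]
      module
    · rw [(inv_eq_of_mul_eq_one_left ha.mul_self : a⁻¹ = a)]
      have h2 : a * (b * a) ^ j = (a * b) ^ j * a :=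
        ((show SemiconjBy a (b * a) (a * b) by simp [SemiconjBy, mul_assoc]).pow_right j).eq
      rw [pow_succ, ← mul_assoc a, h2]
      simp only [mul_assoc]
  induction j with
  | zero => simpa using ⟨ha, hb⟩
  | succ j ih =>
    refine ⟨key ha j ih.2, ?_⟩
    have := key (α := β) (β := α) (a := b) (b := a) hb j
      (by rw [hsymm β α, add_comm]; exact ih.1)
    rw [hsymm β α, add_comm] at this
    exact this

end IsReflectionAlong

/-! ### Root bases -/

/-- Vectors `root i` of norm `2` in a real vector space with a symmetric bilinear form, such that
the reflections in them satisfy the relations of the Coxeter matrix `M`, they generate a salient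
cone, and the form is nondegenerate on their span. -/
structure RootBasis {B : Type*} (M : CoxeterMatrix B) (E : Type*) [AddCommGroup E]
    [Module ℝ E] where
  form : E →ₗ[ℝ] E →ₗ[ℝ] ℝ
  form_comm : ∀ y z, form y z = form z y
  root : B → E
  form_root_self : ∀ i, form (root i) (root i) = 2
  coeff_nonneg : ∀ i j, i ≠ j → ∀ k, (M i j = 0 ∨ k ≤ M i j) →
    0 ≤ dihedralCoeff (-form (root i) (root j)) k
  coeff_eq_zero : ∀ i j, i ≠ j → dihedralCoeff (-form (root i) (root j)) (M i j) = 0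
  salient : ∀ y, y ∈ Submodule.span ℝ≥0 (Set.range root) →
    -y ∈ Submodule.span ℝ≥0 (Set.range root) → y = 0
  nondeg : ∀ y ∈ Submodule.span ℝ (Set.range root), (∀ z, form y z = 0) → y = 0

theorem smul_mem_nnreal_span {E : Type*} [AddCommGroup E] [Module ℝ E] {s : Set E} {c : ℝ}
    (hc : 0 ≤ c) {y : E} (hy : y ∈ Submodule.span ℝ≥0 s) : c • y ∈ Submodule.span ℝ≥0 s :=
  (Submodule.span ℝ≥0 s).smul_mem ⟨c, hc⟩ hy

theorem nnreal_span_subset_span {E : Type*} [AddCommGroup E] [Module ℝ E] {s : Set E} {y : E}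
    (hy : y ∈ Submodule.span ℝ≥0 s) : y ∈ Submodule.span ℝ s :=
  Submodule.span_le_restrictScalars ℝ≥0 ℝ s hy

namespace RootBasis

variable {B : Type*} {M : CoxeterMatrix B} {E : Type*} [AddCommGroup E] [Module ℝ E]
  (D : RootBasis M E)

/-- The cone of the nonnegative linear combinations of the simple roots. -/
def cone : Submodule ℝ≥0 E := Submodule.span ℝ≥0 (Set.range D.root)

theorem root_mem_cone (i : B) : D.root i ∈ D.cone := Submodule.subset_span ⟨i, rfl⟩

theorem smul_mem_cone {c : ℝ} (hc : 0 ≤ c) {y : E} (hy : y ∈ D.cone) : c • y ∈ D.cone :=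
  smul_mem_nnreal_span hc hy

theorem eq_zero_of_mem_cone {y : E} (hy : y ∈ D.cone) (hy' : -y ∈ D.cone) : y = 0 :=
  D.salient y hy hy'

theorem mem_span_of_mem_cone {y : E} (hy : y ∈ D.cone) :
    y ∈ Submodule.span ℝ (Set.range D.root) := nnreal_span_subset_span hy

/-- The reflection in a simple root. -/
noncomputable def simpleReflection (i : B) : E ≃ₗ[ℝ] E :=
  Module.reflection (x := D.root i) (f := D.form (D.root i)) (D.form_root_self i)

theorem isReflectionAlong_simpleReflection (i : B) :
    IsReflectionAlong D.form (D.root i) (D.simpleReflection i) :=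
  ⟨D.form_root_self i, fun _ => Module.reflection_apply _ _⟩

/-- With m = M i j, the element (ab)^m a is the reflection along p (m + 1) α, since p m = 0. The
norm forces p (m + 1) = ±1, so (ab)^m a = a. -/
theorem isLiftable_simpleReflection : M.IsLiftable D.simpleReflection := by
  intro i j
  by_cases hij : i = j
  · subst hij
    simp [(D.isReflectionAlong_simpleReflection i).mul_self]
  · have hi := D.isReflectionAlong_simpleReflection i
    have hj := D.isReflectionAlong_simpleReflection j
    have h := (hi.chain D.form_comm hj (M i j)).1
    rw [D.coeff_eq_zero i j hij, zero_smul, add_zero] at h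
    have h2 : IsReflectionAlong D.form (D.root i)
        ((D.simpleReflection i * D.simpleReflection j) ^ M i j * D.simpleReflection i) := by
      have hc := h.1
      simp only [map_smul, LinearMap.smul_apply, smul_eq_mul, D.form_root_self] at hc
      rcases sq_eq_one_iff.mp
        (by linarith : dihedralCoeff (-D.form (D.root i) (D.root j)) (M i j + 1) ^ 2 = 1)
        with hc | hc
      · simpa [hc] using h
      · simpa [hc] using h.neg
    simpa using h2.eq hi

variable {W : Type*} [Group W] (cs : CoxeterSystem M W)

/-- The action of the Coxeter group. -/
noncomputable def action : W →* (E ≃ₗ[ℝ] E) :=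
  cs.lift ⟨D.simpleReflection, D.isLiftable_simpleReflection⟩

theorem action_simple (i : B) : D.action cs (cs.simple i) = D.simpleReflection i :=
  cs.lift_apply_simple _ i

theorem action_simple_apply (i : B) (y : E) :
    D.action cs (cs.simple i) y = y - D.form (D.root i) y • D.root i := by
  rw [action_simple]; exact (D.isReflectionAlong_simpleReflection i).2 y

theorem action_simple_root (i : B) : D.action cs (cs.simple i) (D.root i) = -D.root i := by
  rw [action_simple]; exact (D.isReflectionAlong_simpleReflection i).apply_self

theorem action_mul_apply (w w' : W) (y : E) :
    D.action cs (w * w') y = D.action cs w (D.action cs w' y) := by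
  rw [map_mul]; rfl

@[simp] theorem action_one_apply (y : E) : D.action cs 1 y = y := by
  rw [map_one]; rfl

@[simp] theorem action_inv_action (w : W) (y : E) : D.action cs w⁻¹ (D.action cs w y) = y := by
  rw [← action_mul_apply]; simp

@[simp] theorem action_action_inv (w : W) (y : E) : D.action cs w (D.action cs w⁻¹ y) = y := by
  rw [← action_mul_apply]; simp

theorem form_action_action (w : W) (y z : E) :
    D.form (D.action cs w y) (D.action cs w z) = D.form y z := by
  induction w using cs.simple_induction_left generalizing y z with
  | one => simp
  | mul_simple_left w i ih =>
    rw [action_mul_apply, action_mul_apply, action_simple,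
      (D.isReflectionAlong_simpleReflection i).form_apply_apply D.form_comm, ih]

theorem form_root_root_nonpos {i j : B} (hij : i ≠ j) : D.form (D.root i) (D.root j) ≤ 0 := by
  have h := D.coeff_nonneg i j hij 2 (by have := M.off_diagonal i j hij; omega)
  rw [dihedralCoeff_add_two] at h
  simpa using h

end RootBasis

/-! ### The sign theorem -/

namespace CoxeterSystem

variable {B : Type*} {M : CoxeterMatrix B} {W : Type*} [Group W] (cs : CoxeterSystem M W)

/-- The factorization of w along the rank two parabolic subgroup of i and j, with additive lengths:
right descents i and j are removed as long as there are any. -/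
theorem exists_eq_mul_alternatingWord {i j : B} (w : W) :
    ∃ (v : W) (k : ℕ), ¬ cs.IsRightDescent v i ∧ ¬ cs.IsRightDescent v j ∧
      (w = v * cs.wordProd (alternatingWord i j k) ∨ w = v * cs.wordProd (alternatingWord j i k)) ∧
      cs.length w = cs.length v + k := by
  induction hn : cs.length w using Nat.strong_induction_on generalizing w i j with
  | _ n ih =>
    subst hn
    wlog hj : cs.IsRightDescent w j generalizing i j
    · by_cases hi : cs.IsRightDescent w i
      · obtain ⟨v, k, h1, h2, h3, h4⟩ := this (i := j) (j := i) hi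
        exact ⟨v, k, h2, h1, h3.symm, h4⟩
      · exact ⟨w, 0, hi, hj, by simp [alternatingWord], by simp⟩
    have hlen := cs.isRightDescent_iff.mp hj
    obtain ⟨v, k, h1, h2, h3, h4⟩ := ih _ hj (i := i) (j := j) (w * cs.simple j) rfl
    have main : w * cs.simple j = v * cs.wordProd (alternatingWord j i k) →
        w = v * cs.wordProd (alternatingWord i j (k + 1)) := by
      intro h
      rw [alternatingWord_succ, wordProd_concat, ← mul_assoc, ← h, simple_mul_simple_cancel_right]
    rcases h3 with h3 | h3
    · cases k with
      | zero => exact ⟨v, 1, h1, h2, Or.inl (main (by simpa [alternatingWord] using h3)), by omega⟩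
      | succ k =>
        exfalso
        rw [alternatingWord_succ, wordProd_concat, ← mul_assoc] at h3
        have h5 : w = v * cs.wordProd (alternatingWord j i k) := mul_right_cancel h3
        have h6 := cs.length_mul_le v (cs.wordProd (alternatingWord j i k))
        have h7 := cs.length_wordProd_le (alternatingWord j i k)
        rw [length_alternatingWord] at h7
        rw [← h5] at h6
        omega
    · exact ⟨v, k + 1, h1, h2, Or.inl (main h3), by omega⟩

end CoxeterSystem

namespace RootBasis

variable {B : Type*} {M : CoxeterMatrix B} {E : Type*} [AddCommGroup E] [Module ℝ E]
  (D : RootBasis M E) {W : Type*} [Group W] (cs : CoxeterSystem M W)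

open CoxeterSystem

theorem action_alternatingWord_root (i j : B) (k : ℕ) :
    D.action cs (cs.wordProd (alternatingWord i j k)) (D.root i) =
      if Even k then dihedralCoeff (-D.form (D.root i) (D.root j)) (k + 1) • D.root i +
        dihedralCoeff (-D.form (D.root i) (D.root j)) k • D.root j
      else dihedralCoeff (-D.form (D.root i) (D.root j)) k • D.root i +
        dihedralCoeff (-D.form (D.root i) (D.root j)) (k + 1) • D.root j := by
  induction k with
  | zero => simp [alternatingWord]
  | succ k ih =>
    rw [alternatingWord_succ', wordProd_cons, action_mul_apply, ih]
    by_cases hk : Even k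
    · have hk' : ¬ Even (k + 1) := by simpa [Nat.even_add_one] using hk
      simp only [hk, hk', if_true, if_false]
      rw [action_simple_apply, map_add, map_smul, map_smul, D.form_root_self, dihedralCoeff_add_two,
        D.form_comm (D.root j) (D.root i)]
      simp only [smul_eq_mul]
      module
    · have hk' : Even (k + 1) := by simpa [Nat.even_add_one] using hk
      simp only [hk, hk', if_true, if_false]
      rw [action_simple_apply, map_add, map_smul, map_smul, D.form_root_self, dihedralCoeff_add_two]
      simp only [smul_eq_mul]
      module

theorem action_root_mem_cone_of_decomposition {v w : W} {i j : B} (hij : i ≠ j) {k : ℕ}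
    (hvi : D.action cs v (D.root i) ∈ D.cone) (hvj : D.action cs v (D.root j) ∈ D.cone)
    (hw : w = v * cs.wordProd (alternatingWord i j k)) (hk : M i j = 0 ∨ k < M i j) :
    D.action cs w (D.root i) ∈ D.cone := by
  rw [hw, action_mul_apply, action_alternatingWord_root]
  have h1 := D.coeff_nonneg i j hij k (by omega)
  have h2 := D.coeff_nonneg i j hij (k + 1) (by omega)
  split_ifs
  all_goals
    rw [map_add, map_smul, map_smul]
    exact add_mem (D.smul_mem_cone (by assumption) hvi) (D.smul_mem_cone (by assumption) hvj)

/-- The sign theorem. For a right descent j of w, factor w = v x with x alternating in i and j. Then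
v is shorter and keeps both simple roots positive by induction. The word x ends in j and has fewer
than M i j letters, since otherwise i would be a descent, so x sends the root of i to a nonnegative
combination of the two. -/
theorem action_root_mem_cone {w : W} {i : B} (h : ¬ cs.IsRightDescent w i) :
    D.action cs w (D.root i) ∈ D.cone := by
  induction hn : cs.length w using Nat.strong_induction_on generalizing w i with
  | _ n ih =>
    subst hn
    by_cases hw1 : w = 1
    · rw [hw1, action_one_apply]; exact D.root_mem_cone i
    obtain ⟨j, hj⟩ := cs.exists_rightDescent_of_ne_one hw1
    have hij : i ≠ j := fun hij => h (hij ▸ hj)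
    obtain ⟨v, k, h1, h2, h3, h4⟩ := cs.exists_eq_mul_alternatingWord (i := i) (j := j) w
    have hk : k ≠ 0 := by
      rintro rfl
      rcases h3 with h3 | h3 <;>
      · simp only [alternatingWord, wordProd_nil, mul_one] at h3
        exact h2 (h3 ▸ hj)
    -- `alternatingWord j i k` ends in i, so such a factorization with additive lengths would make i
    -- a right descent of w.
    have hend : ∀ v', w ≠ v' * cs.wordProd (alternatingWord j i k) ∨ cs.length w ≠ cs.length v' + k := by
      intro v'
      by_contra! hc
      obtain ⟨k, rfl⟩ : ∃ k', k = k' + 1 := ⟨k - 1, by omega⟩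
      apply h
      rw [alternatingWord_succ, wordProd_concat] at hc
      have h6 := cs.length_mul_le v' (cs.wordProd (alternatingWord i j k))
      have h7 := cs.length_wordProd_le (alternatingWord i j k)
      rw [length_alternatingWord] at h7
      unfold IsRightDescent
      rw [show w * cs.simple i = v' * cs.wordProd (alternatingWord i j k) by
        rw [hc.1, mul_assoc, mul_assoc, simple_mul_simple_self, mul_one]]
      omega
    have h3' : w = v * cs.wordProd (alternatingWord i j k) := by
      rcases h3 with h3 | h3
      · exact h3
      · rcases hend v with h5 | h5
        · exact absurd h3 h5
        · exact absurd h4 h5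
    refine D.action_root_mem_cone_of_decomposition cs hij (ih _ (by omega) h1 rfl)
      (ih _ (by omega) h2 rfl) h3' ?_
    by_contra! hc
    rcases hc.2.lt_or_eq with hlt | heq
    · apply cs.not_isReduced_alternatingWord i j hc.1 hlt
      have h6 := cs.length_mul_le v (cs.wordProd (alternatingWord i j k))
      have h7 := cs.length_wordProd_le (alternatingWord i j k)
      rw [length_alternatingWord] at h7
      unfold CoxeterSystem.IsReduced
      rw [length_alternatingWord]
      rw [← h3'] at h6
      omega
    · have h5 := cs.wordProd_braidWord_eq i j
      rw [braidWord, braidWord, M.symmetric j i, heq] at h5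
      rcases hend v with h6 | h6
      · exact h6 (h3'.trans (by rw [h5]))
      · exact h6 h4

theorem neg_action_root_mem_cone {w : W} {i : B} (h : cs.IsRightDescent w i) :
    -D.action cs w (D.root i) ∈ D.cone := by
  have h1 : ¬ cs.IsRightDescent (w * cs.simple i) i :=
    (cs.isRightDescent_iff_not_isRightDescent_mul).mp h
  have h2 := D.action_root_mem_cone cs h1
  rwa [action_mul_apply, action_simple_root, map_neg] at h2

theorem root_ne_zero (i : B) : D.root i ≠ 0 := by
  intro h
  simpa [h] using D.form_root_self i

theorem action_ne_zero (w : W) {y : E} (hy : y ≠ 0) : D.action cs w y ≠ 0 := by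
  simpa using hy

theorem isRightDescent_iff {w : W} {i : B} :
    cs.IsRightDescent w i ↔ -D.action cs w (D.root i) ∈ D.cone := by
  refine ⟨D.neg_action_root_mem_cone cs, fun h => ?_⟩
  by_contra hc
  exact D.action_ne_zero cs w (D.root_ne_zero i)
    (D.eq_zero_of_mem_cone (D.action_root_mem_cone cs hc) h)

theorem eq_one_of_forall_action_root {w : W} (h : ∀ i, D.action cs w (D.root i) = D.root i) :
    w = 1 := by
  by_contra hw
  obtain ⟨i, hi⟩ := cs.exists_rightDescent_of_ne_one hw
  have h1 := D.neg_action_root_mem_cone cs hi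
  rw [h i] at h1
  exact D.root_ne_zero i (D.eq_zero_of_mem_cone (D.root_mem_cone i) h1)

theorem action_injective : Function.Injective (D.action cs) := by
  rw [injective_iff_map_eq_one]
  intro w hw
  exact D.eq_one_of_forall_action_root cs fun i => by rw [hw]; rfl

/-! ### The root of a reflection -/

theorem exists_rootOf {t : W} (ht : cs.IsReflection t) :
    ∃ β ∈ D.cone, IsReflectionAlong D.form β (D.action cs t) ∧
      ∃ (w : W) (i : B), β = D.action cs w (D.root i) ∧ t = w * cs.simple i * w⁻¹ := by
  obtain ⟨w, i, rfl⟩ := ht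
  have key : ∀ w : W, IsReflectionAlong D.form (D.action cs w (D.root i))
      (D.action cs (w * cs.simple i * w⁻¹)) := by
    intro w
    have h1 := (D.isReflectionAlong_simpleReflection i).conj (D.form_action_action cs w)
    rwa [← action_simple D cs i, ← map_inv, ← map_mul, ← map_mul] at h1
  by_cases h : cs.IsRightDescent w i
  · refine ⟨-D.action cs w (D.root i), D.neg_action_root_mem_cone cs h, (key w).neg,
      w * cs.simple i, i, ?_, ?_⟩
    · rw [action_mul_apply, action_simple_root, map_neg]
    · simp [mul_assoc]
  · exact ⟨_, D.action_root_mem_cone cs h, key w, w, i, rfl, rfl⟩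

open Classical in
/-- The positive root of a reflection (and `0` for all other elements). -/
noncomputable def rootOf (t : W) : E :=
  if ht : cs.IsReflection t then (D.exists_rootOf cs ht).choose else 0

variable {cs}

theorem rootOf_mem_cone {t : W} (ht : cs.IsReflection t) : D.rootOf cs t ∈ D.cone := by
  rw [rootOf, dif_pos ht]; exact (D.exists_rootOf cs ht).choose_spec.1

theorem isReflectionAlong_rootOf {t : W} (ht : cs.IsReflection t) :
    IsReflectionAlong D.form (D.rootOf cs t) (D.action cs t) := by
  rw [rootOf, dif_pos ht]; exact (D.exists_rootOf cs ht).choose_spec.2.1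

theorem rootOf_ne_zero {t : W} (ht : cs.IsReflection t) : D.rootOf cs t ≠ 0 :=
  (D.isReflectionAlong_rootOf ht).ne_zero

theorem form_rootOf_self {t : W} (ht : cs.IsReflection t) :
    D.form (D.rootOf cs t) (D.rootOf cs t) = 2 := (D.isReflectionAlong_rootOf ht).1

theorem action_reflection_apply {t : W} (ht : cs.IsReflection t) (y : E) :
    D.action cs t y = y - D.form (D.rootOf cs t) y • D.rootOf cs t :=
  (D.isReflectionAlong_rootOf ht).2 y

theorem action_rootOf_self {t : W} (ht : cs.IsReflection t) :
    D.action cs t (D.rootOf cs t) = -D.rootOf cs t := (D.isReflectionAlong_rootOf ht).apply_self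

theorem rootOf_eq {t : W} (ht : cs.IsReflection t) {β : E} (hβ : β ∈ D.cone)
    (h : IsReflectionAlong D.form β (D.action cs t)) : D.rootOf cs t = β := by
  rcases h.eq_or_eq_neg (D.isReflectionAlong_rootOf ht) with h1 | h1
  · exact h1
  · refine absurd (D.eq_zero_of_mem_cone (D.rootOf_mem_cone ht) ?_) (D.rootOf_ne_zero ht)
    rwa [h1, neg_neg]

theorem rootOf_simple (i : B) : D.rootOf cs (cs.simple i) = D.root i := by
  refine D.rootOf_eq (cs.isReflection_simple i) (D.root_mem_cone i) ?_
  rw [action_simple]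
  exact D.isReflectionAlong_simpleReflection i

theorem rootOf_injective {t t' : W} (ht : cs.IsReflection t) (ht' : cs.IsReflection t')
    (h : D.rootOf cs t = D.rootOf cs t') : t = t' := by
  apply D.action_injective cs
  have h1 := D.isReflectionAlong_rootOf ht
  rw [h] at h1
  exact h1.eq (D.isReflectionAlong_rootOf ht')

theorem eq_of_smul_rootOf {t t' : W} (ht : cs.IsReflection t) (ht' : cs.IsReflection t') {c : ℝ}
    (hc : 0 ≤ c) (h : D.rootOf cs t = c • D.rootOf cs t') : t = t' := by
  refine D.rootOf_injective ht ht' ?_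
  have h1 := D.form_rootOf_self ht
  rw [h] at h1
  simp only [map_smul, LinearMap.smul_apply, smul_eq_mul, D.form_rootOf_self ht'] at h1
  have : c = 1 := by nlinarith
  rw [h, this, one_smul]

theorem isReflectionAlong_conj (w : W) {t : W} (ht : cs.IsReflection t) :
    IsReflectionAlong D.form (D.action cs w (D.rootOf cs t)) (D.action cs (w * t * w⁻¹)) := by
  have h1 := (D.isReflectionAlong_rootOf ht).conj (D.form_action_action cs w)
  rwa [← map_inv, ← map_mul, ← map_mul] at h1

theorem action_rootOf_eq_or (w : W) {t : W} (ht : cs.IsReflection t) :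
    D.action cs w (D.rootOf cs t) = D.rootOf cs (w * t * w⁻¹) ∨
      D.action cs w (D.rootOf cs t) = -D.rootOf cs (w * t * w⁻¹) :=
  (D.isReflectionAlong_rootOf (ht.conj w)).eq_or_eq_neg (D.isReflectionAlong_conj w ht)

theorem action_rootOf_of_mem_cone {w : W} {t : W} (ht : cs.IsReflection t)
    (h : D.action cs w (D.rootOf cs t) ∈ D.cone) :
    D.action cs w (D.rootOf cs t) = D.rootOf cs (w * t * w⁻¹) :=
  (D.rootOf_eq (ht.conj w) h (D.isReflectionAlong_conj w ht)).symm

theorem action_rootOf_mem_cone_or (w : W) {t : W} (ht : cs.IsReflection t) :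
    D.action cs w (D.rootOf cs t) ∈ D.cone ∨ -D.action cs w (D.rootOf cs t) ∈ D.cone := by
  rcases D.action_rootOf_eq_or w ht with h | h
  · left; rw [h]; exact D.rootOf_mem_cone (ht.conj w)
  · right; rw [h, neg_neg]; exact D.rootOf_mem_cone (ht.conj w)

theorem not_mem_cone_and_neg (w : W) {t : W} (ht : cs.IsReflection t)
    (h : D.action cs w (D.rootOf cs t) ∈ D.cone)
    (h' : -D.action cs w (D.rootOf cs t) ∈ D.cone) : False :=
  D.action_ne_zero cs w (D.rootOf_ne_zero ht) (D.eq_zero_of_mem_cone h h')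

/-! ### Inversions -/

/-- A simple root spans an extremal ray of the cone. This replaces linear independence of the simple
roots: the other simple roots pair nonpositively with the root of i, and salience does the rest. -/
theorem eq_smul_root_of_add_eq {i : B} {y z : E} (hy : y ∈ D.cone) (hz : z ∈ D.cone) {c : ℝ}
    (h : y + z = c • D.root i) : ∃ a : ℝ, 0 ≤ a ∧ y = a • D.root i := by
  have hins : Set.range D.root = insert (D.root i) (D.root '' {j | j ≠ i}) := by
    ext y
    constructor
    · rintro ⟨j, rfl⟩
      by_cases hj : j = i
      · left; rw [hj]
      · right; exact ⟨j, hj, rfl⟩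
    · rintro (rfl | ⟨j, -, rfl⟩) <;> exact ⟨_, rfl⟩
  have hle : Submodule.span ℝ≥0 (D.root '' {j | j ≠ i}) ≤ D.cone :=
    Submodule.span_mono (by rintro _ ⟨j, -, rfl⟩; exact ⟨j, rfl⟩)
  have hneg : ∀ y ∈ Submodule.span ℝ≥0 (D.root '' {j | j ≠ i}), D.form (D.root i) y ≤ 0 := by
    intro y hy
    induction hy using Submodule.span_induction with
    | mem y hy =>
      obtain ⟨j, hj, rfl⟩ := hy
      exact D.form_root_root_nonpos (Ne.symm hj)
    | zero => simp
    | add y z _ _ hy hz => rw [map_add]; linarith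
    | smul a y _ hy =>
      rw [NNReal.smul_def, map_smul, smul_eq_mul]
      exact mul_nonpos_of_nonneg_of_nonpos a.2 hy
  rw [cone, hins, Submodule.mem_span_insert] at hy hz
  obtain ⟨a, y', hy', rfl⟩ := hy
  obtain ⟨b, z', hz', rfl⟩ := hz
  rw [NNReal.smul_def, NNReal.smul_def] at h
  have h1 : y' + z' = (c - a - b) • D.root i := by
    rw [sub_smul, sub_smul, ← h]; abel
  have h2 := hneg _ (add_mem hy' hz')
  rw [h1, map_smul, D.form_root_self, smul_eq_mul] at h2
  have h3 : -y' = z' + (a + b - c : ℝ) • D.root i := by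
    have : y' = (c - a - b) • D.root i - z' := by rw [← h1]; abel
    rw [this]; module
  have h4 : y' = 0 := D.eq_zero_of_mem_cone (hle hy') (h3 ▸ add_mem (hle hz')
    (D.smul_mem_cone (by linarith) (D.root_mem_cone i)))
  exact ⟨a, a.2, by rw [h4, add_zero, NNReal.smul_def]⟩

/-- The root β of t and its image under the simple reflection differ by a multiple of the simple
root; a change of sign would put β on the extremal ray of that root. -/
theorem action_simple_rootOf_mem_cone {i : B} {t : W} (ht : cs.IsReflection t)
    (hti : t ≠ cs.simple i) : D.action cs (cs.simple i) (D.rootOf cs t) ∈ D.cone := by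
  rcases D.action_rootOf_mem_cone_or (cs.simple i) ht with h | h
  · exact h
  · exfalso
    obtain ⟨a, ha, h1⟩ := D.eq_smul_root_of_add_eq (D.rootOf_mem_cone ht) h (i := i)
      (c := D.form (D.root i) (D.rootOf cs t)) (by rw [action_simple_apply]; abel)
    rw [← rootOf_simple D (cs := cs)] at h1
    exact hti (D.eq_of_smul_rootOf ht (cs.isReflection_simple i) ha h1)

/-- Write w = s w' with a left descent s. If w' already makes the root negative, use induction.
Otherwise s changes the sign of a positive root, so w' t w'⁻¹ = s and w t = w'. -/
theorem length_mul_lt_of_neg_mem_cone {w t : W} (ht : cs.IsReflection t)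
    (h : -D.action cs w (D.rootOf cs t) ∈ D.cone) : cs.length (w * t) < cs.length w := by
  induction hn : cs.length w using Nat.strong_induction_on generalizing w with
  | _ n ih =>
    subst hn
    by_cases hw1 : w = 1
    · subst hw1
      rw [action_one_apply] at h
      exact absurd (D.eq_zero_of_mem_cone (D.rootOf_mem_cone ht) h) (D.rootOf_ne_zero ht)
    obtain ⟨i, hi⟩ := cs.exists_leftDescent_of_ne_one hw1
    obtain ⟨w', rfl⟩ : ∃ w', w = cs.simple i * w' := ⟨cs.simple i * w, by simp⟩
    have hlen := cs.isLeftDescent_iff.mp hi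
    rw [simple_mul_simple_cancel_left] at hlen
    rcases D.action_rootOf_mem_cone_or w' ht with h1 | h1
    · rw [action_mul_apply, D.action_rootOf_of_mem_cone ht h1] at h
      have h2 : w' * t * w'⁻¹ = cs.simple i := by
        by_contra hc
        exact D.not_mem_cone_and_neg _ (ht.conj w')
          (D.action_simple_rootOf_mem_cone (ht.conj w') hc) h
      have h3 : cs.simple i * w' * t = w' := by
        calc cs.simple i * w' * t = cs.simple i * (w' * t * w'⁻¹) * w' := by group
          _ = w' := by rw [h2, simple_mul_simple_self, one_mul]
      rw [h3]; omega
    · have h2 := ih _ (by omega) h1 rfl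
      have h3 := cs.length_mul_le (cs.simple i) (w' * t)
      rw [length_simple, ← mul_assoc] at h3
      omega

theorem length_mul_lt_iff {w t : W} (ht : cs.IsReflection t) :
    cs.length (w * t) < cs.length w ↔ -D.action cs w (D.rootOf cs t) ∈ D.cone := by
  refine ⟨fun h => ?_, D.length_mul_lt_of_neg_mem_cone ht⟩
  rcases D.action_rootOf_mem_cone_or w ht with h1 | h1
  · exfalso
    have h2 : -D.action cs (w * t) (D.rootOf cs t) ∈ D.cone := by
      rwa [action_mul_apply, D.action_rootOf_self ht, map_neg, neg_neg]
    have h3 := D.length_mul_lt_of_neg_mem_cone ht h2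
    rw [mul_assoc, ht.mul_self, mul_one] at h3
    omega
  · exact h1

theorem length_reflection_mul_lt_iff {w t : W} (ht : cs.IsReflection t) :
    cs.length (t * w) < cs.length w ↔ -D.action cs w⁻¹ (D.rootOf cs t) ∈ D.cone := by
  rw [← D.length_mul_lt_iff ht, ← cs.length_inv (t * w), mul_inv_rev, ht.inv, cs.length_inv w]

theorem length_lt_reflection_mul_iff {w t : W} (ht : cs.IsReflection t) :
    cs.length w < cs.length (t * w) ↔ D.action cs w⁻¹ (D.rootOf cs t) ∈ D.cone := by
  have h1 := D.length_reflection_mul_lt_iff ht (w := w)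
  have h2 := ht.length_mul_right_ne w
  rcases D.action_rootOf_mem_cone_or w⁻¹ ht with h3 | h3
  · refine iff_of_true ?_ h3
    have h4 : ¬ cs.length (t * w) < cs.length w := fun h5 =>
      D.not_mem_cone_and_neg _ ht h3 (h1.mp h5)
    omega
  · refine iff_of_false ?_ fun h5 => D.not_mem_cone_and_neg _ ht h5 h3
    have := h1.mpr h3
    omega

end RootBasis

/-! ### Canonical generators of reflection subgroups -/

namespace CoxeterSystem

variable {B : Type*} {M : CoxeterMatrix B} {W : Type*} [Group W] {cs : CoxeterSystem M W}

theorem IsReflection.ne_one {t : W} (ht : cs.IsReflection t) : t ≠ 1 := by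
  rintro rfl
  simpa using ht.odd_length

theorem IsReflection.conj' {t w : W} (ht : cs.IsReflection t) (hw : cs.IsReflection w) :
    cs.IsReflection (w * t * w) := by
  have := ht.conj w
  rwa [hw.inv] at this

theorem IsReflection.chain {a b : W} (ha : cs.IsReflection a) (hb : cs.IsReflection b) (j : ℕ) :
    cs.IsReflection ((a * b) ^ j * a) ∧ cs.IsReflection ((b * a) ^ j * b) := by
  have key : ∀ {a b : W} (_ : cs.IsReflection a) (j : ℕ), cs.IsReflection ((b * a) ^ j * b) →
      cs.IsReflection ((a * b) ^ (j + 1) * a) := by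
    intro a b ha j h
    have h2 : a * (b * a) ^ j = (a * b) ^ j * a :=
      ((show SemiconjBy a (b * a) (a * b) by simp [SemiconjBy, mul_assoc]).pow_right j).eq
    convert h.conj' ha using 1
    rw [pow_succ, ← mul_assoc a, h2]
    simp only [mul_assoc]
  induction j with
  | zero => simpa using ⟨ha, hb⟩
  | succ j ih => exact ⟨key ha j ih.2, key hb j ih.1⟩

end CoxeterSystem

namespace RootBasis

open CoxeterSystem

variable {B : Type*} {M : CoxeterMatrix B} {E : Type*} [AddCommGroup E] [Module ℝ E]
  (D : RootBasis M E) {W : Type*} [Group W] {cs : CoxeterSystem M W}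

theorem smul_rootOf_add_smul_rootOf {a b : W} (ha : cs.IsReflection a) (hb : cs.IsReflection b)
    (hab : a ≠ b) {p q : ℝ} (h : p • D.rootOf cs a + q • D.rootOf cs b = 0) : p = 0 ∧ q = 0 := by
  have hp : p = 0 := by
    by_contra hp
    have h1 : D.rootOf cs a = (-q / p) • D.rootOf cs b := by
      have h2 : p • D.rootOf cs a = (-q) • D.rootOf cs b := by
        rw [neg_smul]; exact eq_neg_of_add_eq_zero_left h
      rw [div_eq_inv_mul, mul_smul, ← h2, smul_smul, inv_mul_cancel₀ hp, one_smul]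
    rcases le_total 0 (-q / p) with h3 | h3
    · exact hab (D.eq_of_smul_rootOf ha hb h3 h1)
    · refine D.rootOf_ne_zero ha (D.eq_zero_of_mem_cone (D.rootOf_mem_cone ha) ?_)
      rw [h1, ← neg_smul]
      exact D.smul_mem_cone (by linarith) (D.rootOf_mem_cone hb)
  refine ⟨hp, ?_⟩
  rw [hp, zero_smul, zero_add, smul_eq_zero] at h
  exact h.resolve_right (D.rootOf_ne_zero hb)

theorem rootOf_coeff_unique {a b : W} (ha : cs.IsReflection a) (hb : cs.IsReflection b)
    (hab : a ≠ b) {p q p' q' : ℝ} (h : p • D.rootOf cs a + q • D.rootOf cs b =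
      p' • D.rootOf cs a + q' • D.rootOf cs b) : p = p' ∧ q = q' := by
  have h1 : (p - p') • D.rootOf cs a + (q - q') • D.rootOf cs b = 0 := by
    rw [sub_smul, sub_smul, sub_add_sub_comm, h, sub_self]
  have h2 := D.smul_rootOf_add_smul_rootOf ha hb hab h1
  exact ⟨by linarith [h2.1], by linarith [h2.2]⟩

/-- `t` is a canonical generator of the reflection subgroup `H`: it is a reflection in `H` that
keeps all other positive roots of `H` positive. -/
def IsCanonical (cs : CoxeterSystem M W) (H : Subgroup W) (t : W) : Prop :=
  cs.IsReflection t ∧ t ∈ H ∧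
    ∀ r, cs.IsReflection r → r ∈ H → r ≠ t → D.action cs t (D.rootOf cs r) ∈ D.cone

theorem isCanonical_iff {H : Subgroup W} {t : H} :
    D.IsCanonical cs H (t : W) ↔ t ∈ cs.canonicalGenerators H := by
  constructor
  · rintro ⟨h1, h2, h3⟩
    refine ⟨h1, Set.eq_singleton_iff_unique_mem.mpr ⟨⟨h1, h2, ?_⟩, ?_⟩⟩
    · rw [D.length_reflection_mul_lt_iff h1, h1.inv, D.action_rootOf_self h1, neg_neg]
      exact D.rootOf_mem_cone h1
    · rintro r ⟨hr, hrH, hlt⟩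
      by_contra hne
      rw [D.length_reflection_mul_lt_iff hr, h1.inv] at hlt
      exact D.not_mem_cone_and_neg _ hr (h3 r hr hrH hne) hlt
  · rintro ⟨h1, h2⟩
    refine ⟨h1, t.2, fun r hr hrH hne => ?_⟩
    rcases D.action_rootOf_mem_cone_or (t : W) hr with h | h
    · exact h
    · exfalso
      have : r ∈ ({(t : W)} : Set W) := by
        rw [← h2]
        exact ⟨hr, hrH, by rwa [D.length_reflection_mul_lt_iff hr, h1.inv]⟩
      exact hne this

theorem isCanonical_simple {H : Subgroup W} {i : B} (h : cs.simple i ∈ H) :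
    D.IsCanonical cs H (cs.simple i) :=
  ⟨cs.isReflection_simple i, h, fun _ hr _ hne => D.action_simple_rootOf_mem_cone hr hne⟩

theorem IsCanonical.mono {H H' : Subgroup W} (hle : H' ≤ H) {t : W} (h : D.IsCanonical cs H t)
    (ht : t ∈ H') : D.IsCanonical cs H' t :=
  ⟨h.1, ht, fun r hr hrH hne => h.2.2 r hr (hle hrH) hne⟩

variable {D} in
-- Take a left descent i of t. As t sends the root of i to a negative root, the pairing is positive;
-- and s_i t is shortened by a further s_i on the right because t s_i t is not s_i.
theorem exists_simple_conj_lt {t : W} (ht : cs.IsReflection t) (hts : ∀ i, t ≠ cs.simple i) :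
    ∃ i, cs.length (cs.simple i * t * (cs.simple i)⁻¹) < cs.length t ∧
      0 < D.form (D.root i) (D.rootOf cs t) := by
  obtain ⟨i, hi⟩ := cs.exists_leftDescent_of_ne_one ht.ne_one
  have hs := cs.isReflection_simple i
  have h1 : -D.action cs t (D.root i) ∈ D.cone := by
    have h := (D.length_reflection_mul_lt_iff hs (w := t)).mp hi
    rwa [ht.inv, rootOf_simple] at h
  have hpos : 0 < D.form (D.root i) (D.rootOf cs t) := by
    by_contra! hc
    have h2 : D.action cs t (D.root i) ∈ D.cone := by
      rw [D.action_reflection_apply ht, sub_eq_add_neg, ← neg_smul]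
      refine add_mem (D.root_mem_cone i) (D.smul_mem_cone ?_ (D.rootOf_mem_cone ht))
      rw [D.form_comm]; linarith
    exact D.action_ne_zero cs t (D.root_ne_zero i) (D.eq_zero_of_mem_cone h2 h1)
  refine ⟨i, ?_, hpos⟩
  have h3 : D.action cs t (D.root i) = -D.rootOf cs (t * cs.simple i * t⁻¹) := by
    have h := D.action_rootOf_eq_or t hs
    rw [rootOf_simple] at h
    rcases h with h | h
    · rw [h] at h1
      exact absurd (D.eq_zero_of_mem_cone (D.rootOf_mem_cone (hs.conj t)) h1)
        (D.rootOf_ne_zero (hs.conj t))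
    · exact h
  have hne : t * cs.simple i * t⁻¹ ≠ cs.simple i := by
    intro hc
    rw [hc, rootOf_simple, D.action_reflection_apply ht] at h3
    have h4 : D.root i = ((1 / 2) * D.form (D.rootOf cs t) (D.root i)) • D.rootOf cs t := by
      have h5 : (2 : ℝ) • D.root i = D.form (D.rootOf cs t) (D.root i) • D.rootOf cs t := by
        rw [two_smul]
        nth_rewrite 1 [← neg_neg (D.root i)]
        rw [← h3]; abel
      rw [mul_smul, ← h5, smul_smul]; norm_num
    rw [← D.rootOf_simple (cs := cs)] at h4
    refine hts i (D.eq_of_smul_rootOf hs ht ?_ h4).symm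
    rw [rootOf_simple, D.form_comm]; linarith
  have h6 : -D.action cs (cs.simple i * t) (D.rootOf cs (cs.simple i)) ∈ D.cone := by
    rw [rootOf_simple, action_mul_apply, h3, map_neg, neg_neg]
    exact D.action_simple_rootOf_mem_cone (hs.conj t) hne
  have h7 := D.length_mul_lt_of_neg_mem_cone hs h6
  rw [hs.inv]
  exact h7.trans hi

/-- The cone generated by the canonical roots of `H`. -/
def canonicalCone (cs : CoxeterSystem M W) (H : Subgroup W) : Submodule ℝ≥0 E :=
  Submodule.span ℝ≥0 (D.rootOf cs '' {a | D.IsCanonical cs H a})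

theorem rootOf_conj_simple {H : Subgroup W} {i : B} (hi : cs.simple i ∉ H) {r : W}
    (hr : cs.IsReflection r) (hrH : cs.simple i * r * (cs.simple i)⁻¹ ∈ H) :
    D.action cs (cs.simple i) (D.rootOf cs r) =
      D.rootOf cs (cs.simple i * r * (cs.simple i)⁻¹) := by
  refine D.action_rootOf_of_mem_cone hr (D.action_simple_rootOf_mem_cone hr ?_)
  rintro rfl
  simp at hrH
  exact hi hrH

theorem IsCanonical.conj_simple {H : Subgroup W} {i : B} (hi : cs.simple i ∉ H) {a : W}
    (ha : D.IsCanonical cs (H.comap (MulAut.conj (cs.simple i)).toMonoidHom) a) :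
    D.IsCanonical cs H (cs.simple i * a * (cs.simple i)⁻¹) := by
  obtain ⟨h1, h2, h3⟩ := ha
  have hs := cs.isReflection_simple i
  refine ⟨h1.conj _, h2, fun r hr hrH hne => ?_⟩
  set r' := cs.simple i * r * (cs.simple i)⁻¹ with hr'
  have hr'r : cs.simple i * r' * (cs.simple i)⁻¹ = r := by
    rw [hr', hs.inv]; simp [mul_assoc]
  have hrr : cs.IsReflection r' := hr.conj _
  have hr'H : r' ∈ H.comap (MulAut.conj (cs.simple i)).toMonoidHom := by
    change cs.simple i * r' * (cs.simple i)⁻¹ ∈ H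
    rwa [hr'r]
  have hne' : r' ≠ a := fun h => hne (by rw [← hr'r, h])
  have h4 := h3 r' hrr hr'H hne'
  have h5 := D.rootOf_conj_simple hi hrr hr'H
  rw [hr'r] at h5
  rw [← h5, action_mul_apply, action_mul_apply, action_inv_action,
    D.action_rootOf_of_mem_cone hrr h4]
  have h6 : a * r' * a⁻¹ ∈ H.comap (MulAut.conj (cs.simple i)).toMonoidHom :=
    mul_mem (mul_mem h2 hr'H) (inv_mem h2)
  rw [D.rootOf_conj_simple hi (hrr.conj a) h6]
  exact D.rootOf_mem_cone ((hrr.conj a).conj _)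

/-- Every reflection of `H` is conjugate to a canonical generator under the group generated by the
canonical generators, and its positive root lies in the cone of the canonical roots. -/
theorem canonical_generation (H : Subgroup W) {t : W} (ht : cs.IsReflection t) (htH : t ∈ H) :
    (∃ h ∈ Subgroup.closure {a | D.IsCanonical cs H a}, ∃ a, D.IsCanonical cs H a ∧
      t = h * a * h⁻¹) ∧ D.rootOf cs t ∈ D.canonicalCone cs H := by
  induction hn : cs.length t using Nat.strong_induction_on generalizing H t with
  | _ n ih =>
    subst hn
    by_cases hts : ∃ i, t = cs.simple i
    · obtain ⟨i, rfl⟩ := hts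
      have h := D.isCanonical_simple htH
      exact ⟨⟨1, one_mem _, _, h, by simp⟩, Submodule.subset_span ⟨_, h, rfl⟩⟩
    push Not at hts
    obtain ⟨i, hlt, hpos⟩ := exists_simple_conj_lt (D := D) ht hts
    have hs := cs.isReflection_simple i
    set t' := cs.simple i * t * (cs.simple i)⁻¹ with ht'
    have htt' : cs.simple i * t' * (cs.simple i)⁻¹ = t := by
      rw [ht', hs.inv]; simp [mul_assoc]
    have hrefl : cs.IsReflection t' := ht.conj _
    have hroot : D.action cs (cs.simple i) (D.rootOf cs t) = D.rootOf cs t' :=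
      D.action_rootOf_of_mem_cone ht (D.action_simple_rootOf_mem_cone ht (hts i))
    -- If s_i lies in H it is canonical and H is kept. Otherwise s_i carries the positive roots and
    -- the canonical generators of s_i H s_i to those of H, and the induction is applied to the
    -- conjugate subgroup.
    by_cases hi : cs.simple i ∈ H
    · obtain ⟨⟨h, hh, a, ha, hta⟩, hc⟩ := ih _ hlt H hrefl
        (mul_mem (mul_mem hi htH) (inv_mem hi)) rfl
      have hcan := D.isCanonical_simple hi
      refine ⟨⟨cs.simple i * h, mul_mem (Subgroup.subset_closure hcan) hh, a, ha, ?_⟩, ?_⟩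
      · rw [← htt', hta]; group
      · have h1 : D.rootOf cs t = D.rootOf cs t' +
            D.form (D.root i) (D.rootOf cs t) • D.rootOf cs (cs.simple i) := by
          rw [← hroot, action_simple_apply, rootOf_simple]; abel
        rw [h1]
        exact add_mem hc (smul_mem_nnreal_span hpos.le (Submodule.subset_span ⟨_, hcan, rfl⟩))
    · have ht'H : t' ∈ H.comap (MulAut.conj (cs.simple i)).toMonoidHom := by
        change cs.simple i * t' * (cs.simple i)⁻¹ ∈ H
        rwa [htt']
      obtain ⟨⟨h, hh, a, ha, hta⟩, hc⟩ := ih _ hlt _ hrefl ht'H rfl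
      refine ⟨⟨cs.simple i * h * (cs.simple i)⁻¹, ?_, _, ha.conj_simple D hi, ?_⟩, ?_⟩
      · clear hta
        induction hh using Subgroup.closure_induction with
        | mem x hx => exact Subgroup.subset_closure (hx.conj_simple D hi)
        | one => simp
        | mul x y _ _ hx hy =>
          have := mul_mem hx hy
          convert this using 1; group
        | inv x _ hx =>
          have := inv_mem hx
          convert this using 1; group
      · rw [← htt', hta]; group
      · have h1 : D.rootOf cs t = D.action cs (cs.simple i) (D.rootOf cs t') := by
          rw [← hroot, ← action_mul_apply, simple_mul_simple_self, action_one_apply]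
        rw [h1]
        clear h1 hroot
        generalize D.rootOf cs t' = y at hc
        induction hc using Submodule.span_induction with
        | mem y hy =>
          obtain ⟨b, hb, rfl⟩ := hy
          refine Submodule.subset_span ⟨_, hb.conj_simple D hi, ?_⟩
          exact (D.rootOf_conj_simple hi hb.1 hb.2.1).symm
        | zero => rw [map_zero]; exact zero_mem _
        | add y z _ _ hy hz => rw [map_add]; exact add_mem hy hz
        | smul c y _ hy =>
          rw [NNReal.smul_def, map_smul]
          exact smul_mem_nnreal_span c.2 hy

theorem closure_isCanonical {H : Subgroup W} (hH : cs.IsReflectionSubgroup H) :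
    Subgroup.closure {a | D.IsCanonical cs H a} = H := by
  apply le_antisymm
  · rw [Subgroup.closure_le]
    exact fun a ha => ha.2.1
  · conv_lhs => rw [← hH]
    rw [Subgroup.closure_le]
    rintro t ⟨htH, ht⟩
    obtain ⟨⟨h, hh, a, ha, rfl⟩, -⟩ := D.canonical_generation H ht htH
    exact mul_mem (mul_mem hh (Subgroup.subset_closure ha)) (inv_mem hh)

/-! ### Extremality of the canonical roots -/

/-- Apply `a` to the equation: the left side becomes negative, while the right side stays positive
unless r or r' is a. -/
theorem IsCanonical.eq_or_eq {H : Subgroup W} {a r r' : W} (ha : D.IsCanonical cs H a)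
    (hr : cs.IsReflection r) (hrH : r ∈ H) (hr' : cs.IsReflection r') (hrH' : r' ∈ H)
    {p q : ℝ} (hp : 0 ≤ p) (hq : 0 ≤ q)
    (h : D.rootOf cs a = p • D.rootOf cs r + q • D.rootOf cs r') : r = a ∨ r' = a := by
  by_contra! hc
  have h1 := congrArg (D.action cs a) h
  rw [D.action_rootOf_self ha.1, map_add, map_smul, map_smul] at h1
  refine D.rootOf_ne_zero ha.1 (D.eq_zero_of_mem_cone (D.rootOf_mem_cone ha.1) ?_)
  rw [h1]
  exact add_mem (D.smul_mem_cone hp (ha.2.2 r hr hrH hc.1))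
    (D.smul_mem_cone hq (ha.2.2 r' hr' hrH' hc.2))

/-- Two nonnegative coefficients contradict extremality of a. For opposite signs, solve for the root
with positive coefficient and contradict its extremality. Two nonpositive coefficients contradict
salience. -/
theorem IsCanonical.rootOf_ne_smul_add_smul {H : Subgroup W} {a b c : W}
    (ha : D.IsCanonical cs H a) (hb : D.IsCanonical cs H b) (hc : D.IsCanonical cs H c)
    (hab : a ≠ b) (hac : a ≠ c) (hbc : b ≠ c) (p q : ℝ) :
    D.rootOf cs a ≠ p • D.rootOf cs b + q • D.rootOf cs c := by
  have key : ∀ {b c : W} (_ : D.IsCanonical cs H b) (_ : D.IsCanonical cs H c) (_ : a ≠ b)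
      (_ : b ≠ c) {p q : ℝ} (_ : 0 ≤ p) (_ : q ≤ 0),
      D.rootOf cs a ≠ p • D.rootOf cs b + q • D.rootOf cs c := by
    intro b c hb hc hab hbc p q hp hq h
    have h1 : p • D.rootOf cs b = D.rootOf cs a + (-q) • D.rootOf cs c := by
      rw [h, neg_smul]; abel
    have hp' : p ≠ 0 := by
      rintro rfl
      rw [zero_smul, zero_add] at h
      refine D.rootOf_ne_zero ha.1 (D.eq_zero_of_mem_cone (D.rootOf_mem_cone ha.1) ?_)
      rw [h, ← neg_smul]
      exact D.smul_mem_cone (by linarith) (D.rootOf_mem_cone hc.1)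
    have h2 : D.rootOf cs b = p⁻¹ • D.rootOf cs a + (p⁻¹ * -q) • D.rootOf cs c := by
      rw [mul_smul, ← smul_add, ← h1, smul_smul, inv_mul_cancel₀ hp', one_smul]
    rcases hb.eq_or_eq D ha.1 ha.2.1 hc.1 hc.2.1 (by positivity)
      (mul_nonneg (by positivity) (by linarith)) h2 with h3 | h3
    · exact hab h3
    · exact hbc h3.symm
  intro h
  rcases le_total 0 p with hp | hp <;> rcases le_total 0 q with hq | hq
  · rcases ha.eq_or_eq D hb.1 hb.2.1 hc.1 hc.2.1 hp hq h with h1 | h1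
    · exact hab h1.symm
    · exact hac h1.symm
  · exact key hb hc hab hbc hp hq h
  · exact key hc hb hac (Ne.symm hbc) hq hp (by rw [h, add_comm])
  · refine D.rootOf_ne_zero ha.1 (D.eq_zero_of_mem_cone (D.rootOf_mem_cone ha.1) ?_)
    rw [h, neg_add, ← neg_smul, ← neg_smul]
    exact add_mem (D.smul_mem_cone (by linarith) (D.rootOf_mem_cone hb.1))
      (D.smul_mem_cone (by linarith) (D.rootOf_mem_cone hc.1))

/-- In a plane two nonproportional roots form a basis, so by Cramer's rule a third canonical root
would be a combination of the first two. -/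
theorem IsCanonical.eq_or_eq_of_mem_span_pair {H : Subgroup W} {y z : E}
    (hH : ∀ t ∈ H, cs.IsReflection t → D.rootOf cs t ∈ Submodule.span ℝ {y, z}) {a b c : W}
    (ha : D.IsCanonical cs H a) (hb : D.IsCanonical cs H b) (hc : D.IsCanonical cs H c)
    (hab : a ≠ b) : c = a ∨ c = b := by
  by_contra! hne
  obtain ⟨a1, a2, h1⟩ := Submodule.mem_span_pair.mp (hH a ha.2.1 ha.1)
  obtain ⟨b1, b2, h2⟩ := Submodule.mem_span_pair.mp (hH b hb.2.1 hb.1)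
  obtain ⟨c1, c2, h3⟩ := Submodule.mem_span_pair.mp (hH c hc.2.1 hc.1)
  by_cases hδ : a1 * b2 - a2 * b1 = 0
  · have h4 : b2 • D.rootOf cs a + (-a2) • D.rootOf cs b = 0 := by
      have : b2 • D.rootOf cs a + (-a2) • D.rootOf cs b = (a1 * b2 - a2 * b1) • y := by
        rw [← h1, ← h2]; module
      rw [this, hδ, zero_smul]
    have h5 : b1 • D.rootOf cs a + (-a1) • D.rootOf cs b = 0 := by
      have : b1 • D.rootOf cs a + (-a1) • D.rootOf cs b = (-(a1 * b2 - a2 * b1)) • z := by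
        rw [← h1, ← h2]; module
      rw [this, hδ, neg_zero, zero_smul]
    have h6 := (D.smul_rootOf_add_smul_rootOf ha.1 hb.1 hab h4).1
    have h7 := (D.smul_rootOf_add_smul_rootOf ha.1 hb.1 hab h5).1
    rw [h6, h7, zero_smul, zero_smul, add_zero] at h2
    exact D.rootOf_ne_zero hb.1 h2.symm
  · have h4 : (a1 * b2 - a2 * b1) • D.rootOf cs c =
        (c1 * b2 - c2 * b1) • D.rootOf cs a + (a1 * c2 - a2 * c1) • D.rootOf cs b := by
      rw [← h1, ← h2, ← h3]; module
    refine hc.rootOf_ne_smul_add_smul D ha hb hne.1 hne.2 hab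
      ((a1 * b2 - a2 * b1)⁻¹ * (c1 * b2 - c2 * b1)) ((a1 * b2 - a2 * b1)⁻¹ * (a1 * c2 - a2 * c1)) ?_
    rw [mul_smul, mul_smul, ← smul_add, ← h4, smul_smul, inv_mul_cancel₀ hδ, one_smul]

theorem action_sub_mem_of_mem_closure {S : Set W} {P : Submodule ℝ E}
    (hS : ∀ s ∈ S, cs.IsReflection s ∧ D.rootOf cs s ∈ P) {g : W} (hg : g ∈ Subgroup.closure S)
    (y : E) : D.action cs g y - y ∈ P := by
  induction hg using Subgroup.closure_induction generalizing y with
  | mem s hs =>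
    rw [D.action_reflection_apply (hS s hs).1, sub_sub_cancel_left]
    exact neg_mem (P.smul_mem _ (hS s hs).2)
  | one => simp
  | mul g g' _ _ hg hg' =>
    rw [action_mul_apply]
    have := add_mem (hg (D.action cs g' y)) (hg' y)
    rwa [sub_add_sub_cancel] at this
  | inv g _ hg =>
    have := neg_mem (hg (D.action cs g⁻¹ y))
    rwa [action_action_inv, neg_sub] at this

/-- A product of elements of S moves every vector by an element of P, and t moves its own root β by
-2β. -/
theorem rootOf_mem_of_mem_closure {S : Set W} {P : Submodule ℝ E}
    (hS : ∀ s ∈ S, cs.IsReflection s ∧ D.rootOf cs s ∈ P) {t : W} (ht : cs.IsReflection t)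
    (htS : t ∈ Subgroup.closure S) : D.rootOf cs t ∈ P := by
  have h1 := D.action_sub_mem_of_mem_closure hS htS (D.rootOf cs t)
  rw [D.action_rootOf_self ht] at h1
  have h2 : D.rootOf cs t = (-(1 / 2) : ℝ) • (-D.rootOf cs t - D.rootOf cs t) := by
    module
  rw [h2]
  exact P.smul_mem _ h1

theorem exists_coeff_of_isCanonical_pair {H : Subgroup W} {a b : W}
    (h : ∀ c, D.IsCanonical cs H c → c = a ∨ c = b) {t : W} (ht : cs.IsReflection t)
    (htH : t ∈ H) : ∃ p q : ℝ, 0 ≤ p ∧ 0 ≤ q ∧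
      D.rootOf cs t = p • D.rootOf cs a + q • D.rootOf cs b := by
  have h1 := (D.canonical_generation H ht htH).2
  have h2 : D.canonicalCone cs H ≤ Submodule.span ℝ≥0 {D.rootOf cs a, D.rootOf cs b} := by
    refine Submodule.span_mono ?_
    rintro _ ⟨c, hc, rfl⟩
    rcases h c hc with rfl | rfl <;> simp
  obtain ⟨p, q, h3⟩ := Submodule.mem_span_pair.mp (h2 h1)
  exact ⟨p, q, p.2, q.2, h3.symm⟩

/-! ### Pairs of canonical generators -/

theorem isReflectionAlong_chain {a b : W} (ha : cs.IsReflection a) (hb : cs.IsReflection b)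
    (j : ℕ) :
    IsReflectionAlong D.form
      (dihedralCoeff (-D.form (D.rootOf cs a) (D.rootOf cs b)) (j + 1) • D.rootOf cs a +
        dihedralCoeff (-D.form (D.rootOf cs a) (D.rootOf cs b)) j • D.rootOf cs b)
      (D.action cs ((a * b) ^ j * a)) ∧
    IsReflectionAlong D.form
      (dihedralCoeff (-D.form (D.rootOf cs a) (D.rootOf cs b)) j • D.rootOf cs a +
        dihedralCoeff (-D.form (D.rootOf cs a) (D.rootOf cs b)) (j + 1) • D.rootOf cs b)
      (D.action cs ((b * a) ^ j * b)) := by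
  have h := (D.isReflectionAlong_rootOf ha).chain D.form_comm (D.isReflectionAlong_rootOf hb) j
  simpa only [map_mul, map_pow] using h

theorem isCanonical_closure_pair {H : Subgroup W} {a b : W} (ha : D.IsCanonical cs H a)
    (hb : D.IsCanonical cs H b) (hab : a ≠ b) :
    D.IsCanonical cs (Subgroup.closure {a, b}) a ∧ D.IsCanonical cs (Subgroup.closure {a, b}) b ∧
      ∀ c, D.IsCanonical cs (Subgroup.closure {a, b}) c → c = a ∨ c = b := by
  have hle : Subgroup.closure {a, b} ≤ H := by
    rw [Subgroup.closure_le]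
    rintro _ (rfl | rfl)
    exacts [ha.2.1, hb.2.1]
  have ha' := ha.mono D hle (Subgroup.subset_closure (by simp))
  have hb' := hb.mono D hle (Subgroup.subset_closure (by simp))
  refine ⟨ha', hb', fun c hc => ?_⟩
  refine IsCanonical.eq_or_eq_of_mem_span_pair D (y := D.rootOf cs a) (z := D.rootOf cs b)
    (fun t ht htr => ?_) ha' hb' hc hab
  refine D.rootOf_mem_of_mem_closure ?_ htr ht
  rintro _ (rfl | rfl)
  · exact ⟨ha.1, Submodule.subset_span (by simp)⟩
  · exact ⟨hb.1, Submodule.subset_span (by simp)⟩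

theorem chain_mem_closure (a b : W) (j : ℕ) :
    (a * b) ^ j * a ∈ Subgroup.closure {a, b} ∧ (b * a) ^ j * b ∈ Subgroup.closure {a, b} := by
  have ha : a ∈ Subgroup.closure {a, b} := Subgroup.subset_closure (by simp)
  have hb : b ∈ Subgroup.closure {a, b} := Subgroup.subset_closure (by simp)
  exact ⟨mul_mem (pow_mem (mul_mem ha hb) j) ha, mul_mem (pow_mem (mul_mem hb ha) j) hb⟩

/-- The root of (ab)^j a has coefficients p (j + 1) and p j up to a common sign, and it is a
nonnegative combination of the two canonical roots; so neighbouring coefficients never have opposite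
signs. The first nonpositive p n with n > 0 is therefore 0. Then p (n - 1) = 1 and p (n + 1) = -1,
hence (ab)^n = 1, and n is the order of ab. -/
theorem dihedralCoeff_of_isCanonical {H : Subgroup W} {a b : W} (ha : D.IsCanonical cs H a)
    (hb : D.IsCanonical cs H b) (hab : a ≠ b) :
    (∀ k, (orderOf (a * b) = 0 ∨ k ≤ orderOf (a * b)) →
      0 ≤ dihedralCoeff (-D.form (D.rootOf cs a) (D.rootOf cs b)) k) ∧
    dihedralCoeff (-D.form (D.rootOf cs a) (D.rootOf cs b)) (orderOf (a * b)) = 0 := by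
  obtain ⟨-, -, hcan⟩ := D.isCanonical_closure_pair ha hb hab
  set p := dihedralCoeff (-D.form (D.rootOf cs a) (D.rootOf cs b)) with hp
  have hmul : ∀ j, 0 ≤ p (j + 1) * p j := by
    intro j
    have hr := (ha.1.chain hb.1 j).1
    obtain ⟨u, v, hu, hv, huv⟩ := D.exists_coeff_of_isCanonical_pair hcan hr
      (chain_mem_closure a b j).1
    rcases (D.isReflectionAlong_rootOf hr).eq_or_eq_neg (D.isReflectionAlong_chain ha.1 hb.1 j).1
      with h | h
    · rw [huv] at h
      obtain ⟨h1, h2⟩ := D.rootOf_coeff_unique ha.1 hb.1 hab h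
      rw [← hp] at h1 h2
      rw [h1, h2]; exact mul_nonneg hu hv
    · rw [huv, neg_add, ← neg_smul, ← neg_smul] at h
      obtain ⟨h1, h2⟩ := D.rootOf_coeff_unique ha.1 hb.1 hab h
      rw [← hp] at h1 h2
      rw [h1, h2]; nlinarith
  have hone : ∀ j, (a * b) ^ j = 1 → p j = 0 := by
    intro j hj
    have h := (D.isReflectionAlong_chain ha.1 hb.1 j).1
    rw [hj, one_mul] at h
    rcases (D.isReflectionAlong_rootOf ha.1).eq_or_eq_neg h with h1 | h1
    · have h2 : p (j + 1) • D.rootOf cs a + p j • D.rootOf cs b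
        = (1 : ℝ) • D.rootOf cs a + (0 : ℝ) • D.rootOf cs b := by simpa using h1
      exact (D.rootOf_coeff_unique ha.1 hb.1 hab h2).2
    · have h2 : p (j + 1) • D.rootOf cs a + p j • D.rootOf cs b
        = (-1 : ℝ) • D.rootOf cs a + (0 : ℝ) • D.rootOf cs b := by simpa using h1
      exact (D.rootOf_coeff_unique ha.1 hb.1 hab h2).2
  by_cases hex : ∃ n, 0 < n ∧ p n ≤ 0
  · classical
    obtain ⟨n, ⟨hn, hpn⟩, hmin⟩ : ∃ n, (0 < n ∧ p n ≤ 0) ∧ ∀ k < n, ¬ (0 < k ∧ p k ≤ 0) :=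
      ⟨Nat.find hex, Nat.find_spec hex, fun k hk => Nat.find_min hex hk⟩
    have hpos : ∀ k, 0 < k → k < n → 0 < p k := by
      intro k hk hkn
      by_contra! hc
      exact hmin k hkn ⟨hk, hc⟩
    obtain ⟨n, rfl⟩ : ∃ n', n = n' + 1 := ⟨n - 1, by omega⟩
    have hn0 : n ≠ 0 := by
      rintro rfl
      rw [hp, zero_add, dihedralCoeff_one] at hpn
      linarith
    have h1 := hpos n (by omega) (by omega)
    have h2 : p (n + 1) = 0 := by
      have := hmul n
      by_contra h3
      have h4 : p (n + 1) < 0 := lt_of_le_of_ne hpn h3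
      nlinarith
    have h3 : p (n + 2) = -p n := by
      rw [hp, dihedralCoeff_add_two, ← hp, h2]; ring
    have h4 : p n = 1 := by
      have h5 := dihedralCoeff_mul_sub_mul (-D.form (D.rootOf cs a) (D.rootOf cs b)) n 1
      rw [← hp, h3, h2, show p 1 = 1 from rfl] at h5
      nlinarith
    have hord : orderOf (a * b) = n + 1 := by
      rw [orderOf_eq_iff (by omega)]
      refine ⟨?_, fun k hk hk0 hc => ?_⟩
      · have h5 := (D.isReflectionAlong_chain ha.1 hb.1 (n + 1)).1
        rw [← hp, show n + 1 + 1 = n + 2 by ring, h3, h2, h4, zero_smul, add_zero, neg_smul,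
          one_smul] at h5
        have h6 := h5.neg
        rw [neg_neg] at h6
        have h7 := D.action_injective cs (h6.eq (D.isReflectionAlong_rootOf ha.1))
        simpa using h7
      · exact (hpos k hk0 hk).ne' (hone k hc)
    rw [hord]
    refine ⟨fun k hk => ?_, h2⟩
    rcases Nat.eq_zero_or_pos k with rfl | hk0
    · simp [hp]
    · rcases (show k < n + 1 ∨ k = n + 1 by omega) with h5 | rfl
      · exact (hpos k hk0 h5).le
      · exact h2.ge
  · push Not at hex
    have hord : orderOf (a * b) = 0 := by
      rw [orderOf_eq_zero_iff']
      exact fun n hn hc => (hex n hn).ne' (hone n hc)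
    rw [hord]
    refine ⟨fun k _ => ?_, rfl⟩
    rcases Nat.eq_zero_or_pos k with rfl | hk0
    · simp [hp]
    · exact (hex k hk0).le

end RootBasis

/-! ### The Coxeter system of a reflection subgroup -/

/-- The Coxeter matrix of a reflection subgroup with its canonical generators. -/
noncomputable def CoxeterSystem.canonicalMatrix {B : Type*} {M : CoxeterMatrix B} {W : Type*}
    [Group W] (cs : CoxeterSystem M W) (H : Subgroup W) :
    CoxeterMatrix (cs.canonicalGenerators H) where
  M := Matrix.of fun a b => orderOf ((a : H) * (b : H) : W)
  isSymm := by
    ext a b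
    have ha := a.2.1
    have hb := b.2.1
    rw [Matrix.transpose_apply, Matrix.of_apply, Matrix.of_apply, ← orderOf_inv, mul_inv_rev,
      ha.inv, hb.inv]
  diagonal a := by rw [Matrix.of_apply, a.2.1.mul_self, orderOf_one]
  off_diagonal a b hab h := by
    rw [Matrix.of_apply, orderOf_eq_one_iff] at h
    apply hab
    ext
    rw [eq_inv_of_mul_eq_one_left h, b.2.1.inv]

namespace RootBasis

open CoxeterSystem

variable {B : Type*} {M : CoxeterMatrix B} {E : Type*} [AddCommGroup E] [Module ℝ E]
  (D : RootBasis M E) {W : Type*} [Group W] {cs : CoxeterSystem M W} {H : Subgroup W}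

variable (cs H) in
/-- The canonical roots of a reflection subgroup form a root basis. -/
noncomputable def restrict : RootBasis (cs.canonicalMatrix H) E where
  form := D.form
  form_comm := D.form_comm
  root a := D.rootOf cs (a : H)
  form_root_self a := D.form_rootOf_self a.2.1
  coeff_nonneg a b hab := (D.dihedralCoeff_of_isCanonical (D.isCanonical_iff.mpr a.2)
    (D.isCanonical_iff.mpr b.2) (fun h => hab (Subtype.ext (Subtype.ext h)))).1
  coeff_eq_zero a b hab := (D.dihedralCoeff_of_isCanonical (D.isCanonical_iff.mpr a.2)
    (D.isCanonical_iff.mpr b.2) (fun h => hab (Subtype.ext (Subtype.ext h)))).2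
  salient y hy hy' := by
    have hle : Submodule.span ℝ≥0 (Set.range fun a : cs.canonicalGenerators H =>
        D.rootOf cs (a : H)) ≤ D.cone := by
      rw [Submodule.span_le]
      rintro _ ⟨a, rfl⟩
      exact D.rootOf_mem_cone a.2.1
    exact D.eq_zero_of_mem_cone (hle hy) (hle hy')
  nondeg y hy := by
    refine D.nondeg y ?_
    have hle : Submodule.span ℝ (Set.range fun a : cs.canonicalGenerators H =>
        D.rootOf cs (a : H)) ≤ Submodule.span ℝ (Set.range D.root) := by
      rw [Submodule.span_le]
      rintro _ ⟨a, rfl⟩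
      exact D.mem_span_of_mem_cone (D.rootOf_mem_cone a.2.1)
    exact hle hy

theorem restrict_cone_le : (D.restrict cs H).cone ≤ D.cone := by
  rw [cone, Submodule.span_le]
  rintro _ ⟨a, rfl⟩
  exact D.rootOf_mem_cone a.2.1

variable (cs H) in
/-- The homomorphism from the Coxeter group of the canonical matrix onto a reflection subgroup. -/
noncomputable def subsystemHom : (cs.canonicalMatrix H).Group →* H :=
  (cs.canonicalMatrix H).toCoxeterSystem.lift ⟨fun a => (a : H), fun a b => by
    rw [← Subtype.coe_inj]
    exact pow_orderOf_eq_one ((a : H) * (b : H) : W)⟩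

theorem subsystemHom_simple (a : cs.canonicalGenerators H) :
    subsystemHom cs H ((cs.canonicalMatrix H).toCoxeterSystem.simple a) = a :=
  CoxeterSystem.lift_apply_simple _ _ a

/-- Followed by the action of W, this homomorphism is the action attached to the root basis of
canonical roots, which is faithful like that of every root basis. -/
theorem subsystemHom_injective (D : RootBasis M E) : Function.Injective (subsystemHom cs H) := by
  have h1 : (D.restrict cs H).action (cs.canonicalMatrix H).toCoxeterSystem =
      ((D.action cs).comp H.subtype).comp (subsystemHom cs H) := by
    apply CoxeterSystem.ext_simple
    intro a
    rw [action_simple, MonoidHom.comp_apply, subsystemHom_simple]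
    exact ((D.restrict cs H).isReflectionAlong_simpleReflection a).eq
      (D.isReflectionAlong_rootOf a.2.1)
  rw [injective_iff_map_eq_one]
  intro g hg
  apply (D.restrict cs H).action_injective (cs.canonicalMatrix H).toCoxeterSystem
  rw [h1, map_one, MonoidHom.comp_apply, hg, map_one]

theorem subsystemHom_surjective (D : RootBasis M E) (hH : cs.IsReflectionSubgroup H) :
    Function.Surjective (subsystemHom cs H) := by
  have h1 : ∀ g ∈ Subgroup.closure {a | D.IsCanonical cs H a},
      ∃ x, ((subsystemHom cs H x : H) : W) = g := by
    intro g hg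
    induction hg using Subgroup.closure_induction with
    | mem a ha =>
      exact ⟨(cs.canonicalMatrix H).toCoxeterSystem.simple
        ⟨⟨a, ha.2.1⟩, (D.isCanonical_iff (t := ⟨a, ha.2.1⟩)).mp ha⟩, by rw [subsystemHom_simple]⟩
    | one => exact ⟨1, by simp⟩
    | mul x y _ _ hx hy =>
      obtain ⟨x', rfl⟩ := hx
      obtain ⟨y', rfl⟩ := hy
      exact ⟨x' * y', by simp⟩
    | inv x _ hx =>
      obtain ⟨x', rfl⟩ := hx
      exact ⟨x'⁻¹, by simp⟩
  intro g
  obtain ⟨x, hx⟩ := h1 g (by rw [D.closure_isCanonical hH]; exact g.2)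
  exact ⟨x, Subtype.ext hx⟩

variable (hH : cs.IsReflectionSubgroup H)

/-- A reflection subgroup is a Coxeter group with its canonical generators. -/
noncomputable def subsystem : CoxeterSystem (cs.canonicalMatrix H) H :=
  ⟨(MulEquiv.ofBijective (subsystemHom cs H)
    ⟨subsystemHom_injective D, subsystemHom_surjective D hH⟩).symm⟩

theorem subsystem_simple (a : cs.canonicalGenerators H) : (D.subsystem hH).simple a = a :=
  subsystemHom_simple a

theorem restrict_action (h : H) :
    (D.restrict cs H).action (D.subsystem hH) h = D.action cs (h : W) := by
  have h1 : (D.restrict cs H).action (D.subsystem hH) = (D.action cs).comp H.subtype := by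
    apply CoxeterSystem.ext_simple
    intro a
    rw [action_simple, MonoidHom.comp_apply, subsystem_simple]
    exact ((D.restrict cs H).isReflectionAlong_simpleReflection a).eq
      (D.isReflectionAlong_rootOf a.2.1)
  rw [h1]; rfl

theorem subsystem_isReflection_iff {t : H} :
    (D.subsystem hH).IsReflection t ↔ cs.IsReflection (t : W) := by
  constructor
  · rintro ⟨w, a, rfl⟩
    rw [subsystem_simple]
    exact a.2.1.conj (w : W)
  · intro ht
    obtain ⟨⟨h, hh, a, ha, hta⟩, -⟩ := D.canonical_generation H ht t.2
    rw [D.closure_isCanonical hH] at hh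
    refine ⟨⟨h, hh⟩, ⟨⟨a, ha.2.1⟩, (D.isCanonical_iff (t := ⟨a, ha.2.1⟩)).mp ha⟩, ?_⟩
    rw [subsystem_simple]
    exact Subtype.ext hta

theorem restrict_rootOf {t : H} (ht : cs.IsReflection (t : W)) :
    (D.restrict cs H).rootOf (D.subsystem hH) t = D.rootOf cs (t : W) := by
  have ht' := (D.subsystem_isReflection_iff hH).mpr ht
  refine (D.rootOf_eq ht (D.restrict_cone_le ((D.restrict cs H).rootOf_mem_cone ht')) ?_).symm
  rw [← D.restrict_action hH]
  exact (D.restrict cs H).isReflectionAlong_rootOf ht'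

/-- Every root of H or its negative lies in the small cone, and the small cone is contained in the
large one, so the two notions of sign agree. -/
theorem restrict_action_rootOf_mem_cone_iff {t : H} (ht : cs.IsReflection (t : W)) (h : H) :
    (D.restrict cs H).action (D.subsystem hH) h ((D.restrict cs H).rootOf (D.subsystem hH) t) ∈
      (D.restrict cs H).cone ↔ D.action cs (h : W) (D.rootOf cs (t : W)) ∈ D.cone := by
  have ht' := (D.subsystem_isReflection_iff hH).mpr ht
  have key : (D.restrict cs H).action (D.subsystem hH) h
      ((D.restrict cs H).rootOf (D.subsystem hH) t) = D.action cs (h : W) (D.rootOf cs (t : W)) := by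
    rw [restrict_action, D.restrict_rootOf hH ht]
  rcases (D.restrict cs H).action_rootOf_mem_cone_or h ht' with h1 | h1
  · exact iff_of_true h1 (by rw [← key]; exact D.restrict_cone_le h1)
  · refine iff_of_false (fun h2 => (D.restrict cs H).not_mem_cone_and_neg _ ht' h2 h1) fun h2 => ?_
    have h3 := D.restrict_cone_le h1
    rw [key] at h3
    exact D.not_mem_cone_and_neg _ ht h2 h3

/-! ### Cosets of reflection subgroups -/

/-- `w` is the shortest element of its coset `H w`. -/
def IsMinimalRep (cs : CoxeterSystem M W) (H : Subgroup W) (w : W) : Prop :=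
  ∀ t ∈ H, cs.IsReflection t → D.action cs w⁻¹ (D.rootOf cs t) ∈ D.cone

variable (cs H) in
theorem exists_isMinimalRep (u : W) : ∃ h ∈ H, D.IsMinimalRep cs H (h * u) := by
  have hne : {n | ∃ h ∈ H, cs.length (h * u) = n}.Nonempty := ⟨_, 1, one_mem _, rfl⟩
  obtain ⟨h, hh, hlen⟩ := Nat.sInf_mem hne
  refine ⟨h, hh, fun t htH ht => ?_⟩
  rw [← D.length_lt_reflection_mul_iff ht]
  have h1 : cs.length (h * u) ≤ cs.length (t * (h * u)) := by
    rw [hlen]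
    exact Nat.sInf_le ⟨t * h, mul_mem htH hh, by rw [mul_assoc]⟩
  exact lt_of_le_of_ne h1 (ht.length_mul_right_ne _).symm

/-- Up to sign, h⁻¹ sends the root of t to a positive root of H, and x₀⁻¹ keeps all of these
positive. -/
theorem action_inv_rootOf_mem_cone_iff_of_isMinimalRep {x₀ : W} (hx₀ : D.IsMinimalRep cs H x₀)
    {h t : W} (hh : h ∈ H) (ht : cs.IsReflection t) (htH : t ∈ H) :
    D.action cs (h * x₀)⁻¹ (D.rootOf cs t) ∈ D.cone ↔
      D.action cs h⁻¹ (D.rootOf cs t) ∈ D.cone := by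
  have hrefl := ht.conj h⁻¹
  have h1 := hx₀ (h⁻¹ * t * h⁻¹⁻¹) (by
    exact mul_mem (mul_mem (inv_mem hh) htH) (inv_mem (inv_mem hh))) hrefl
  rw [mul_inv_rev, action_mul_apply]
  rcases D.action_rootOf_eq_or h⁻¹ ht with h2 | h2
  · rw [h2]
    exact iff_of_true h1 (D.rootOf_mem_cone hrefl)
  · rw [h2, map_neg]
    refine iff_of_false (fun h3 => ?_) fun h3 => ?_
    · exact D.not_mem_cone_and_neg _ hrefl h1 h3
    · exact D.rootOf_ne_zero hrefl (D.eq_zero_of_mem_cone (D.rootOf_mem_cone hrefl) h3)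

theorem subsystem_length_lt_iff {x₀ : W} (hx₀ : D.IsMinimalRep cs H x₀) {h t : H}
    (ht : cs.IsReflection (t : W)) :
    (D.subsystem hH).length h < (D.subsystem hH).length (t * h) ↔
      cs.length (h * x₀) < cs.length (t * h * x₀) := by
  rw [(D.restrict cs H).length_lt_reflection_mul_iff ((D.subsystem_isReflection_iff hH).mpr ht),
    D.restrict_action_rootOf_mem_cone_iff hH ht, mul_assoc, D.length_lt_reflection_mul_iff ht,
    D.action_inv_rootOf_mem_cone_iff_of_isMinimalRep hx₀ h.2 ht t.2]
  simp

/-- Dyer's theorem: right translation does not change labels, and lengths compare equally on both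
sides because signs of roots do. -/
theorem subsystem_bruhatEdge_iff {x₀ : W} (hx₀ : D.IsMinimalRep cs H x₀) {x y : H} :
    (D.subsystem hH).BruhatEdge x y ↔ cs.BruhatEdge (x * x₀) (y * x₀) := by
  unfold BruhatEdge
  have h1 : (y * x₀ : W) * (x * x₀ : W)⁻¹ = ((y * x⁻¹ : H) : W) := by
    simp [mul_assoc]
  rw [h1, D.subsystem_isReflection_iff hH, and_congr_left_iff]
  intro ht
  have h2 := D.subsystem_length_lt_iff hH hx₀ (h := x) ht
  simpa using h2

end RootBasis

/-! ### Groups generated by two involutions -/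

theorem exists_zpow_of_mem_closure_pair {G : Type*} [Group G] {a b : G} (ha : a * a = 1)
    (hb : b * b = 1) {g : G} (hg : g ∈ Subgroup.closure {a, b}) :
    ∃ n : ℤ, g = (a * b) ^ n ∨ g = (a * b) ^ n * a := by
  have ha' : a⁻¹ = a := inv_eq_of_mul_eq_one_left ha
  have hb' : b⁻¹ = b := inv_eq_of_mul_eq_one_left hb
  have hsemi : ∀ n : ℤ, a * (a * b) ^ n = (a * b) ^ (-n) * a := by
    intro n
    have h1 : SemiconjBy a (a * b) (a * b)⁻¹ := by
      rw [SemiconjBy, mul_inv_rev, ha', hb', ← mul_assoc, ha, mul_assoc, ha, one_mul, mul_one]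
    rw [zpow_neg, ← inv_zpow]
    exact (h1.zpow_right n).eq
  induction hg using Subgroup.closure_induction with
  | mem x hx =>
    rcases hx with rfl | rfl
    · exact ⟨0, Or.inr (by simp)⟩
    · exact ⟨-1, Or.inr (by simp [ha', hb', mul_assoc, ha])⟩
  | one => exact ⟨0, Or.inl (by simp)⟩
  | mul x y _ _ hx hy =>
    obtain ⟨n, rfl | rfl⟩ := hx <;> obtain ⟨m, rfl | rfl⟩ := hy
    · exact ⟨n + m, Or.inl (zpow_add _ _ _).symm⟩
    · exact ⟨n + m, Or.inr (by rw [zpow_add, mul_assoc])⟩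
    · exact ⟨n - m, Or.inr (by rw [mul_assoc, hsemi, sub_eq_add_neg, zpow_add, mul_assoc])⟩
    · refine ⟨n - m, Or.inl ?_⟩
      rw [mul_assoc, ← mul_assoc a, hsemi, mul_assoc, ha, mul_one, sub_eq_add_neg, zpow_add]
  | inv x _ hx =>
    obtain ⟨n, rfl | rfl⟩ := hx
    · exact ⟨-n, Or.inl (zpow_neg _ _).symm⟩
    · refine ⟨n, Or.inr ?_⟩
      rw [mul_inv_rev, ha', ← zpow_neg, hsemi, neg_neg]

namespace CoxeterSystem

variable {B : Type*} {M : CoxeterMatrix B} {W : Type*} [Group W] {cs : CoxeterSystem M W}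

theorem even_length_iff {w : W} : Even (cs.length w) ↔ cs.lengthParity w = 1 := by
  rw [lengthParity_eq_ofAdd_length, ← ofAdd_zero, Equiv.apply_eq_iff_eq, ZMod.natCast_eq_zero_iff_even]

theorem IsReflection.lengthParity_mul {t t' : W} (ht : cs.IsReflection t)
    (ht' : cs.IsReflection t') : cs.lengthParity (t * t') = 1 := by
  rw [← even_length_iff, Nat.even_iff, length_mul_mod_two]
  have h1 := ht.odd_length
  have h2 := ht'.odd_length
  rw [Nat.odd_iff] at h1 h2
  omega

theorem exists_chain_of_odd {a b : W} (ha : cs.IsReflection a) (hb : cs.IsReflection b) {g : W}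
    (hg : g ∈ Subgroup.closure {a, b}) (hodd : Odd (cs.length g)) :
    ∃ k : ℕ, g = (a * b) ^ k * a ∨ g = (b * a) ^ k * b := by
  obtain ⟨n, rfl | rfl⟩ := exists_zpow_of_mem_closure_pair ha.mul_self hb.mul_self hg
  · rw [← Nat.not_even_iff_odd, even_length_iff, map_zpow, ha.lengthParity_mul hb, one_zpow] at hodd
    exact absurd rfl hodd
  · obtain ⟨k, rfl | rfl⟩ := n.eq_nat_or_neg
    · exact ⟨k, Or.inl (by simp)⟩
    · cases k with
      | zero => exact ⟨0, Or.inl (by simp)⟩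
      | succ k =>
        refine ⟨k, Or.inr ?_⟩
        rw [zpow_neg, ← inv_zpow, mul_inv_rev, ha.inv, hb.inv, zpow_natCast, pow_succ, mul_assoc,
          mul_assoc, ha.mul_self, mul_one]

/-- The powers of ab have even length, so an element of odd length lies outside the rotations. -/
theorem isReflection_of_odd {a b : W} (ha : cs.IsReflection a) (hb : cs.IsReflection b) {g : W}
    (hg : g ∈ Subgroup.closure {a, b}) (hodd : Odd (cs.length g)) : cs.IsReflection g := by
  obtain ⟨k, rfl | rfl⟩ := exists_chain_of_odd ha hb hg hodd
  exacts [(ha.chain hb k).1, (ha.chain hb k).2]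

/-! ### Coxeter groups of rank two -/

section RankTwo

variable {i j : B} (hB : ∀ k, k = i ∨ k = j)
include hB

theorem mem_closure_pair_of_rank_two (w : W) : w ∈ Subgroup.closure {cs.simple i, cs.simple j} := by
  have h1 : Set.range cs.simple ⊆ {cs.simple i, cs.simple j} := by
    rintro _ ⟨k, rfl⟩
    rcases hB k with rfl | rfl <;> simp
  have h2 := Subgroup.closure_mono h1
  rw [subgroup_closure_range_simple] at h2
  exact h2 trivial

theorem isReflection_of_rank_two {w : W} (hodd : Odd (cs.length w)) : cs.IsReflection w :=
  isReflection_of_odd (cs.isReflection_simple i) (cs.isReflection_simple j)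
    (mem_closure_pair_of_rank_two hB w) hodd

/-- In rank two a reduced word alternates, so it is determined by its length and its first letter.
Removing that letter exchanges the roles of i and j. -/
theorem eq_of_length_eq_of_isLeftDescent {w w' : W} (hlen : cs.length w = cs.length w')
    (h : cs.IsLeftDescent w i) (h' : cs.IsLeftDescent w' i) : w = w' := by
  induction hn : cs.length w generalizing w w' i j with
  | zero => rw [IsLeftDescent, hn] at h; omega
  | succ n ih =>
    have h1 := cs.isLeftDescent_iff.mp h
    have h2 := cs.isLeftDescent_iff.mp h'
    suffices hs : cs.simple i * w = cs.simple i * w' from mul_left_cancel hs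
    rcases Nat.eq_zero_or_pos n with rfl | hpos
    · rw [cs.length_eq_zero_iff.mp (show cs.length (cs.simple i * w) = 0 by omega),
        cs.length_eq_zero_iff.mp (show cs.length (cs.simple i * w') = 0 by omega)]
    · have key : ∀ w : W, cs.IsLeftDescent w i → cs.length w = n + 1 →
          cs.IsLeftDescent (cs.simple i * w) j := by
        intro w hw hlen
        have h3 := cs.isLeftDescent_iff.mp hw
        obtain ⟨k, hk⟩ := cs.exists_leftDescent_of_ne_one (w := cs.simple i * w) (by
          intro h4
          rw [h4, length_one] at h3
          omega)
        rcases hB k with rfl | rfl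
        · exact absurd hk ((cs.isLeftDescent_iff_not_isLeftDescent_mul).mp hw)
        · exact hk
      exact ih (i := j) (j := i) (fun k => (hB k).symm) (by omega) (key w h hn)
        (key w' h' (by omega)) (by omega)

/-- The automorphism of the diagram that interchanges the two generators. It will pair the two
elements of equal length, which is what a flip does. -/
theorem exists_swap (hij : i ≠ j) : ∃ σ : W →* W, σ (cs.simple i) = cs.simple j ∧
    σ (cs.simple j) = cs.simple i ∧ (∀ w, σ (σ w) = w) ∧ (∀ w, cs.length (σ w) = cs.length w) ∧
    ∀ w, cs.IsLeftDescent (σ w) i ↔ cs.IsLeftDescent w j := by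
  classical
  have hlift : M.IsLiftable (fun k => if k = i then cs.simple j else cs.simple i) := by
    intro k k'
    rcases hB k with rfl | rfl <;> rcases hB k' with rfl | rfl
    · simp
    · simp only [if_true, if_neg hij.symm, M.symmetric k k', simple_mul_simple_pow]
    · simp only [if_true, if_neg hij.symm, M.symmetric k k', simple_mul_simple_pow]
    · simp [hij.symm]
  obtain ⟨σ, hσ⟩ : ∃ σ : W →* W, ∀ k, σ (cs.simple k) = if k = i then cs.simple j else cs.simple i :=
    ⟨cs.lift ⟨_, hlift⟩, fun k => cs.lift_apply_simple hlift k⟩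
  have hi : σ (cs.simple i) = cs.simple j := by simp [hσ]
  have hj : σ (cs.simple j) = cs.simple i := by simp [hσ, hij.symm]
  have hinv : ∀ w, σ (σ w) = w := by
    have : σ.comp σ = MonoidHom.id W := by
      apply cs.ext_simple
      intro k
      rcases hB k with rfl | rfl <;> simp [hi, hj]
    intro w
    exact DFunLike.congr_fun this w
  have hle : ∀ w, cs.length (σ w) ≤ cs.length w := by
    intro w
    induction hn : cs.length w using Nat.strong_induction_on generalizing w with
    | _ n ih =>
      subst hn
      by_cases hw : w = 1
      · simp [hw]
      obtain ⟨k, hk⟩ := cs.exists_leftDescent_of_ne_one hw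
      have h1 := cs.isLeftDescent_iff.mp hk
      have h2 := ih _ hk (cs.simple k * w) rfl
      have h3 : σ w = σ (cs.simple k) * σ (cs.simple k * w) := by
        rw [← map_mul, simple_mul_simple_cancel_left]
      have h4 : cs.length (σ (cs.simple k)) = 1 := by
        rcases hB k with rfl | rfl <;> simp [hi, hj]
      have h5 := cs.length_mul_le (σ (cs.simple k)) (σ (cs.simple k * w))
      rw [h3]
      omega
  have hlen : ∀ w, cs.length (σ w) = cs.length w := fun w =>
    le_antisymm (hle w) (by simpa [hinv] using hle (σ w))
  refine ⟨σ, hi, hj, hinv, hlen, fun w => ?_⟩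
  rw [IsLeftDescent, IsLeftDescent, hlen, ← hj, ← map_mul, hlen]

end RankTwo

end CoxeterSystem

/-! ### Dihedral reflection subgroups -/

namespace RootBasis

open CoxeterSystem

variable {B : Type*} {M : CoxeterMatrix B} {E : Type*} [AddCommGroup E] [Module ℝ E]
  (D : RootBasis M E) {W : Type*} [Group W] {cs : CoxeterSystem M W}

/-- If every vector orthogonal to β' were orthogonal to β, then β - ((β, β') / 2) β' would be
orthogonal to everything, hence 0 by nondegeneracy, although roots of distinct reflections are not
proportional. -/
theorem exists_form_eq_zero_ne_zero {t t' : W} (ht : cs.IsReflection t) (ht' : cs.IsReflection t')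
    (hne : t ≠ t') : ∃ y, D.form (D.rootOf cs t') y = 0 ∧ D.form (D.rootOf cs t) y ≠ 0 := by
  by_contra! hc
  set c := D.form (D.rootOf cs t) (D.rootOf cs t') / 2 with hcdef
  have h1 : ∀ y, D.form (D.rootOf cs t - c • D.rootOf cs t') y = 0 := by
    intro y
    have h2 := hc (y - (D.form (D.rootOf cs t') y / 2) • D.rootOf cs t') (by
      rw [map_sub, map_smul, D.form_rootOf_self ht', smul_eq_mul]; ring)
    rw [map_sub, map_smul, smul_eq_mul] at h2
    rw [map_sub, map_smul, LinearMap.sub_apply, LinearMap.smul_apply, smul_eq_mul, hcdef]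
    linarith
  have h3 := D.nondeg _ (sub_mem (D.mem_span_of_mem_cone (D.rootOf_mem_cone ht))
    (Submodule.smul_mem _ _ (D.mem_span_of_mem_cone (D.rootOf_mem_cone ht')))) h1
  have h4 : (1 : ℝ) • D.rootOf cs t + (-c) • D.rootOf cs t' = 0 := by
    rw [one_smul, neg_smul, ← sub_eq_add_neg, h3]
  exact one_ne_zero (D.smul_rootOf_add_smul_rootOf ht ht' hne h4).1

/-- If `t₁ t₂ = t₃ t₄ ≠ 1`, then the roots of these four reflections lie in a plane. -/
theorem rootOf_mem_span_of_mul_eq_mul {t₁ t₂ t₃ t₄ : W} (h₁ : cs.IsReflection t₁)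
    (h₂ : cs.IsReflection t₂) (h₃ : cs.IsReflection t₃) (h₄ : cs.IsReflection t₄)
    (h : t₁ * t₂ = t₃ * t₄) (hne : t₃ ≠ t₄) :
    D.rootOf cs t₃ ∈ Submodule.span ℝ {D.rootOf cs t₁, D.rootOf cs t₂} ∧
      D.rootOf cs t₄ ∈ Submodule.span ℝ {D.rootOf cs t₁, D.rootOf cs t₂} := by
  have key : ∀ {t₁ t₂ t₃ t₄ : W} (_ : cs.IsReflection t₁) (_ : cs.IsReflection t₂)
      (_ : cs.IsReflection t₃) (_ : cs.IsReflection t₄) (_ : t₁ * t₂ = t₃ * t₄) (_ : t₃ ≠ t₄),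
      D.rootOf cs t₃ ∈ Submodule.span ℝ {D.rootOf cs t₁, D.rootOf cs t₂} := by
    intro t₁ t₂ t₃ t₄ h₁ h₂ h₃ h₄ h hne
    -- The vector y is fixed by t₄ and moved by t₃, so t₃ t₄ moves it by a nonzero multiple of the
    -- root of t₃, whereas t₁ t₂ moves it inside the plane.
    obtain ⟨y, hy, hy'⟩ := D.exists_form_eq_zero_ne_zero h₃ h₄ hne
    have h5 := D.action_sub_mem_of_mem_closure (S := {t₁, t₂})
      (P := Submodule.span ℝ {D.rootOf cs t₁, D.rootOf cs t₂}) (by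
        rintro _ (rfl | rfl)
        · exact ⟨h₁, Submodule.subset_span (by simp)⟩
        · exact ⟨h₂, Submodule.subset_span (by simp)⟩)
      (mul_mem (Subgroup.subset_closure (by simp)) (Subgroup.subset_closure (by simp)) :
        t₁ * t₂ ∈ Subgroup.closure {t₁, t₂}) y
    rw [h, action_mul_apply, D.action_reflection_apply h₄, hy, zero_smul, sub_zero,
      D.action_reflection_apply h₃, sub_sub_cancel_left] at h5
    have h6 := Submodule.smul_mem _ (-(D.form (D.rootOf cs t₃) y)⁻¹) h5
    rwa [smul_neg, neg_smul, neg_neg, smul_smul, inv_mul_cancel₀ hy', one_smul] at h6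
  refine ⟨key h₁ h₂ h₃ h₄ h hne, ?_⟩
  have h' : t₂ * t₁ = t₄ * t₃ := by
    rw [← h₁.inv, ← h₂.inv, ← h₃.inv, ← h₄.inv, ← mul_inv_rev, ← mul_inv_rev, h]
  rw [Set.pair_comm]
  exact key h₂ h₁ h₄ h₃ h' hne.symm

/-- `H` is a maximal dihedral reflection subgroup with canonical generators `a` and `b`: it contains
all reflections whose root lies in the plane spanned by the roots of `a` and `b`. -/
structure IsDihedral (cs : CoxeterSystem M W) (H : Subgroup W) (a b : W) : Prop where
  isReflectionSubgroup : cs.IsReflectionSubgroup H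
  left : D.IsCanonical cs H a
  right : D.IsCanonical cs H b
  ne : a ≠ b
  eq_or_eq : ∀ c, D.IsCanonical cs H c → c = a ∨ c = b
  mem_of_rootOf_mem : ∀ t, cs.IsReflection t →
    D.rootOf cs t ∈ Submodule.span ℝ {D.rootOf cs a, D.rootOf cs b} → t ∈ H

variable {D} {H : Subgroup W} {a b : W}

theorem IsDihedral.symm (h : D.IsDihedral cs H a b) : D.IsDihedral cs H b a :=
  ⟨h.1, h.3, h.2, h.4.symm, fun c hc => (h.5 c hc).symm, by rw [Set.pair_comm]; exact h.6⟩

theorem IsDihedral.exists_coeff (h : D.IsDihedral cs H a b) {t : W} (ht : cs.IsReflection t)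
    (htH : t ∈ H) : ∃ p q : ℝ, 0 ≤ p ∧ 0 ≤ q ∧
      D.rootOf cs t = p • D.rootOf cs a + q • D.rootOf cs b :=
  D.exists_coeff_of_isCanonical_pair h.5 ht htH

theorem IsDihedral.rootOf_mem (h : D.IsDihedral cs H a b) {t : W} (ht : cs.IsReflection t)
    (htH : t ∈ H) : D.rootOf cs t ∈ Submodule.span ℝ {D.rootOf cs a, D.rootOf cs b} := by
  obtain ⟨p, q, -, -, h1⟩ := h.exists_coeff ht htH
  exact Submodule.mem_span_pair.mpr ⟨p, q, h1.symm⟩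

theorem IsDihedral.closure_eq (h : D.IsDihedral cs H a b) : Subgroup.closure {a, b} = H := by
  apply le_antisymm
  · rw [Subgroup.closure_le]
    rintro _ (rfl | rfl)
    exacts [h.left.2.1, h.right.2.1]
  · conv_lhs => rw [← D.closure_isCanonical h.1]
    exact Subgroup.closure_mono fun c hc => h.5 c hc

variable (D) in
-- Take all reflections whose root lies in the plane of the two given roots. A plane admits at most
-- two canonical roots; with only one, all positive roots would be multiples of it and t₁ = t₂.
theorem exists_isDihedral {t₁ t₂ : W} (h₁ : cs.IsReflection t₁) (h₂ : cs.IsReflection t₂)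
    (hne : t₁ ≠ t₂) : ∃ H a b, D.IsDihedral cs H a b ∧ t₁ ∈ H ∧ t₂ ∈ H := by
  set P := Submodule.span ℝ {D.rootOf cs t₁, D.rootOf cs t₂} with hP
  set S := {t | cs.IsReflection t ∧ D.rootOf cs t ∈ P} with hS
  set H := Subgroup.closure S with hHdef
  have hH : cs.IsReflectionSubgroup H := by
    apply le_antisymm
    · rw [Subgroup.closure_le]
      exact fun t ht => ht.1
    · exact Subgroup.closure_mono fun t ht => ⟨Subgroup.subset_closure ht, ht.1⟩
  have hroot : ∀ t ∈ H, cs.IsReflection t → D.rootOf cs t ∈ P := fun t ht htr =>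
    D.rootOf_mem_of_mem_closure (fun s hs => hs) htr ht
  have ht₁ : t₁ ∈ H := Subgroup.subset_closure ⟨h₁, Submodule.subset_span (by simp)⟩
  have ht₂ : t₂ ∈ H := Subgroup.subset_closure ⟨h₂, Submodule.subset_span (by simp)⟩
  obtain ⟨⟨-, -, a, ha, -⟩, -⟩ := D.canonical_generation H h₁ ht₁
  have hb : ∃ b, D.IsCanonical cs H b ∧ a ≠ b := by
    by_contra! hc
    have key : ∀ t ∈ H, cs.IsReflection t → t = a := by
      intro t ht htr
      obtain ⟨p, q, hp, hq, h⟩ := D.exists_coeff_of_isCanonical_pair (a := a) (b := a)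
        (fun c hc' => Or.inl (hc c hc').symm) htr ht
      rw [← add_smul] at h
      exact D.eq_of_smul_rootOf htr ha.1 (by linarith) h
    exact hne ((key t₁ ht₁ h₁).trans (key t₂ ht₂ h₂).symm)
  obtain ⟨b, hb, hab⟩ := hb
  refine ⟨H, a, b, ⟨hH, ha, hb, hab, fun c hc => ?_, fun t ht htr => ?_⟩, ht₁, ht₂⟩
  · exact IsCanonical.eq_or_eq_of_mem_span_pair D hroot ha hb hc hab
  · refine Subgroup.subset_closure ⟨ht, ?_⟩
    have hle : Submodule.span ℝ {D.rootOf cs a, D.rootOf cs b} ≤ P := by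
      rw [Submodule.span_le]
      rintro _ (rfl | rfl)
      exacts [hroot a ha.2.1 ha.1, hroot b hb.2.1 hb.1]
    exact hle htr

theorem IsDihedral.mem_of_mul_eq_mul (h : D.IsDihedral cs H a b) {t₁ t₂ t₃ t₄ : W}
    (h₁ : cs.IsReflection t₁) (h₂ : cs.IsReflection t₂) (h₃ : cs.IsReflection t₃)
    (h₄ : cs.IsReflection t₄) (h12 : t₁ * t₂ = t₃ * t₄) (hne : t₃ ≠ t₄) (hm₁ : t₁ ∈ H)
    (hm₂ : t₂ ∈ H) : t₃ ∈ H ∧ t₄ ∈ H := by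
  have h5 := D.rootOf_mem_span_of_mul_eq_mul h₁ h₂ h₃ h₄ h12 hne
  have hle : Submodule.span ℝ {D.rootOf cs t₁, D.rootOf cs t₂} ≤
      Submodule.span ℝ {D.rootOf cs a, D.rootOf cs b} := by
    rw [Submodule.span_le]
    rintro _ (rfl | rfl)
    exacts [h.rootOf_mem h₁ hm₁, h.rootOf_mem h₂ hm₂]
  exact ⟨h.6 _ h₃ (hle h5.1), h.6 _ h₄ (hle h5.2)⟩

/-- Exactly one of the two canonical generators of a dihedral subgroup shortens a middle vertex. -/
theorem IsDihedral.length_lt_iff_not (h : D.IsDihedral cs H a b) {x y z : W}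
    (hxy : cs.BruhatEdge x y) (hyz : cs.BruhatEdge y z) (hxyH : y * x⁻¹ ∈ H)
    (hyzH : z * y⁻¹ ∈ H) :
    cs.length (a * y) < cs.length y ↔ ¬ cs.length (b * y) < cs.length y := by
  obtain ⟨p, q, hp, hq, h1⟩ := h.exists_coeff hxy.2 hxyH
  obtain ⟨p', q', hp', hq', h2⟩ := h.exists_coeff hyz.2 hyzH
  have h3 : -D.action cs y⁻¹ (D.rootOf cs (y * x⁻¹)) ∈ D.cone := by
    rw [← D.length_reflection_mul_lt_iff hxy.2]
    have : y * x⁻¹ * y = x := by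
      rw [← hxy.2.inv]; group
    rw [this]; exact hxy.1
  have h4 : D.action cs y⁻¹ (D.rootOf cs (z * y⁻¹)) ∈ D.cone := by
    rw [← D.length_lt_reflection_mul_iff hyz.2]
    simpa using hyz.1
  constructor
  · intro ha hb
    rw [D.length_reflection_mul_lt_iff h.left.1] at ha
    rw [D.length_reflection_mul_lt_iff h.right.1] at hb
    refine D.not_mem_cone_and_neg _ hyz.2 h4 ?_
    rw [h2, map_add, map_smul, map_smul, neg_add, ← smul_neg, ← smul_neg]
    exact add_mem (D.smul_mem_cone hp' ha) (D.smul_mem_cone hq' hb)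
  · intro hb
    by_contra ha
    rw [D.length_reflection_mul_lt_iff h.left.1] at ha
    rw [D.length_reflection_mul_lt_iff h.right.1] at hb
    refine D.not_mem_cone_and_neg _ hxy.2 ?_ h3
    rw [h1, map_add, map_smul, map_smul]
    exact add_mem (D.smul_mem_cone hp ((D.action_rootOf_mem_cone_or _ h.left.1).resolve_right ha))
      (D.smul_mem_cone hq ((D.action_rootOf_mem_cone_or _ h.right.1).resolve_right hb))

/-- The structure of the Bruhat graph on a coset of a dihedral reflection subgroup. -/
theorem IsDihedral.exists_level (h : D.IsDihedral cs H a b) (u : W) :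
    ∃ (L : W → ℕ) (σ : W → W),
      (∀ y, y * u⁻¹ ∈ H → σ y * u⁻¹ ∈ H ∧ σ (σ y) = y ∧ L (σ y) = L y ∧
        (cs.length (a * σ y) < cs.length (σ y) ↔ cs.length (b * y) < cs.length y)) ∧
      (∀ y z, y * u⁻¹ ∈ H → z * u⁻¹ ∈ H →
        (cs.BruhatEdge y z ↔ L y < L z ∧ Odd (L y + L z))) ∧
      (∀ y z, y * u⁻¹ ∈ H → z * u⁻¹ ∈ H → L y = L z → z = y ∨ z = σ y) ∧
      (∀ z, z * u⁻¹ ∈ H → 0 < L z → ∃ y, y * u⁻¹ ∈ H ∧ L y + 1 = L z) := by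
  classical
  obtain ⟨h₀, hh₀, hmin⟩ := D.exists_isMinimalRep cs H u
  set x₀ := h₀ * u with hx₀
  have hmem : ∀ y, y * u⁻¹ ∈ H ↔ y * x₀⁻¹ ∈ H := by
    intro y
    rw [hx₀, mul_inv_rev, ← mul_assoc]
    exact (Subgroup.mul_mem_cancel_right H (inv_mem hh₀)).symm
  simp only [hmem]
  set csH := D.subsystem h.1 with hcsH
  let ia : cs.canonicalGenerators H := ⟨⟨a, h.left.2.1⟩, D.isCanonical_iff.mp h.left⟩
  let ib : cs.canonicalGenerators H := ⟨⟨b, h.right.2.1⟩, D.isCanonical_iff.mp h.right⟩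
  have hB : ∀ k : cs.canonicalGenerators H, k = ia ∨ k = ib := by
    intro k
    rcases h.5 _ (D.isCanonical_iff.mpr k.2) with h1 | h1
    · left; exact Subtype.ext (Subtype.ext h1)
    · right; exact Subtype.ext (Subtype.ext h1)
  have hia : ((csH.simple ia : H) : W) = a := by rw [hcsH, subsystem_simple]
  have hib : ((csH.simple ib : H) : W) = b := by rw [hcsH, subsystem_simple]
  have hne : ia ≠ ib := fun hc => h.ne (by rw [← hia, ← hib, hc])
  obtain ⟨σ, hσa, hσb, hσσ, hσlen, hσd⟩ := exists_swap (cs := csH) hB hne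
  have hdesc : ∀ (k : cs.canonicalGenerators H) (d : H), csH.IsLeftDescent d k ↔
      cs.length ((k : H) * (d * x₀) : W) < cs.length (d * x₀) := by
    intro k d
    have h1 := D.subsystem_length_lt_iff h.1 hmin (h := d) (t := (k : H)) k.2.1
    rw [← hcsH, ← subsystem_simple D h.1 k, ← hcsH] at h1
    have h2 := csH.length_simple_mul_ne d k
    have h3 := k.2.1.length_mul_right_ne (d * x₀ : W)
    rw [hcsH, subsystem_simple D h.1 k, ← hcsH] at h1 h2
    rw [IsLeftDescent, hcsH, subsystem_simple D h.1 k, ← hcsH]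
    rw [mul_assoc] at h1
    omega
  -- The position of y in the coset relative to its shortest element; the value 1 outside the coset
  -- is never used.
  let d : W → H := fun y => if hy : y * x₀⁻¹ ∈ H then ⟨y * x₀⁻¹, hy⟩ else 1
  have hd : ∀ y, y * x₀⁻¹ ∈ H → (d y : W) * x₀ = y := by
    intro y hy
    simp only [d, dif_pos hy, inv_mul_cancel_right]
  have hd' : ∀ g : H, d (g * x₀) = g := by
    intro g
    have : (g * x₀ : W) * x₀⁻¹ ∈ H := by simp
    simp only [d, dif_pos this]
    ext
    simp
  have hmem' : ∀ g : H, (g * x₀ : W) * x₀⁻¹ ∈ H := fun g => by simp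
  -- The level is the dihedral length of the position, and the partner of a vertex comes from
  -- interchanging the generators. In rank two all elements of odd length are reflections, so edges
  -- are governed by length and parity.
  refine ⟨fun y => csH.length (d y), fun y => σ (d y) * x₀, ?_, ?_, ?_, ?_⟩
  · intro y hy
    refine ⟨hmem' _, ?_, ?_, ?_⟩
    · simp only [hd', hσσ, hd y hy]
    · simp only [hd', hσlen]
    · have h1 := hσd (d y)
      rw [hdesc, hdesc, hd y hy] at h1
      exact h1
  · intro y z hy hz
    have h1 := D.subsystem_bruhatEdge_iff h.1 hmin (x := d y) (y := d z)
    rw [hd y hy, hd z hz] at h1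
    rw [← h1, ← hcsH, BruhatEdge, and_congr_right_iff]
    intro _
    have h2 : Odd (csH.length (d y) + csH.length (d z)) ↔ Odd (csH.length (d z * (d y)⁻¹)) := by
      rw [Nat.odd_iff, Nat.odd_iff, csH.length_mul_mod_two, length_inv, add_comm]
    rw [h2]
    exact ⟨fun h3 => h3.odd_length, isReflection_of_rank_two hB⟩
  · intro y z hy hz hL
    change csH.length (d y) = csH.length (d z) at hL
    have key : d z = d y ∨ d z = σ (d y) := by
      by_cases h1 : d y = 1
      · left
        have h2 : csH.length (d z) = 0 := by rw [← hL, h1, length_one]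
        rw [csH.length_eq_zero_iff.mp h2, h1]
      · have h1' : d z ≠ 1 := by
          intro h2
          apply h1
          rw [← csH.length_eq_zero_iff, hL, h2, length_one]
        obtain ⟨k, hk⟩ := csH.exists_leftDescent_of_ne_one h1
        obtain ⟨k', hk'⟩ := csH.exists_leftDescent_of_ne_one h1'
        have hσd' : ∀ w, csH.IsLeftDescent (σ w) ib ↔ csH.IsLeftDescent w ia := by
          intro w
          rw [← hσd, hσσ]
        rcases hB k with rfl | rfl <;> rcases hB k' with rfl | rfl
        · left; exact eq_of_length_eq_of_isLeftDescent hB hL.symm hk' hk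
        · right
          exact eq_of_length_eq_of_isLeftDescent (fun k => (hB k).symm)
            (by rw [hσlen]; exact hL.symm) hk' ((hσd' _).mpr hk)
        · right
          exact eq_of_length_eq_of_isLeftDescent hB
            (by rw [hσlen]; exact hL.symm) hk' ((hσd _).mpr hk)
        · left
          exact eq_of_length_eq_of_isLeftDescent (fun k => (hB k).symm) hL.symm hk' hk
    rcases key with h1 | h1
    · left; rw [← hd z hz, h1, hd y hy]
    · right; rw [← hd z hz, h1]
  · intro z hz hpos
    have h1 : d z ≠ 1 := fun h2 => by
      simp only [h2, length_one] at hpos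
      omega
    obtain ⟨k, hk⟩ := csH.exists_leftDescent_of_ne_one h1
    refine ⟨(csH.simple k * d z : H) * x₀, hmem' _, ?_⟩
    simp only [hd']
    exact csH.isLeftDescent_iff.mp hk

end RootBasis

/-! ### Flips -/

namespace CoxeterSystem

variable {B : Type*} {M : CoxeterMatrix B} {W : Type*} [Group W] {cs : CoxeterSystem M W}

/-- There is a path of length two from `x` to `y` or from `y` to `x`. -/
def TwoStepComparable (cs : CoxeterSystem M W) (x y : W) : Prop :=
  ∃ z, (cs.BruhatEdge x z ∧ cs.BruhatEdge z y) ∨ (cs.BruhatEdge y z ∧ cs.BruhatEdge z x)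

end CoxeterSystem

namespace RootBasis

open CoxeterSystem

variable {B : Type*} {M : CoxeterMatrix B} {E : Type*} [AddCommGroup E] [Module ℝ E]
  {D : RootBasis M E} {W : Type*} [Group W] {cs : CoxeterSystem M W} {H : Subgroup W} {a b : W}

/-- The two labels have product t t', so their roots lie in the plane of H, and H contains all
reflections of its plane. -/
theorem IsDihedral.mem_of_path (h : D.IsDihedral cs H a b) {x y z : W}
    (hxy : cs.BruhatEdge x y) (hyz : cs.BruhatEdge y z) {t t' : W} (ht : cs.IsReflection t)
    (ht' : cs.IsReflection t') (htH : t ∈ H) (htH' : t' ∈ H) (heq : t * t' = z * x⁻¹) :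
    y * x⁻¹ ∈ H ∧ z * y⁻¹ ∈ H := by
  refine (h.mem_of_mul_eq_mul ht ht' hyz.2 hxy.2 (by rw [heq]; group) ?_ htH htH').symm
  intro hc
  have h1 : z * x⁻¹ = 1 := by
    calc z * x⁻¹ = (z * y⁻¹) * (y * x⁻¹) := by group
      _ = 1 := by rw [hc, hxy.2.mul_self]
  rw [mul_inv_eq_one] at h1
  have := hxy.1.trans hyz.1
  rw [h1] at this
  exact lt_irrefl _ this

/-- On the middle vertices, which all lie in one coset of H, the partner map σ of
`IsDihedral.exists_level` is the only flip involution. Flipping therefore preserves the level and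
changes which of a and b shortens the vertex. -/
theorem IsDihedral.flipMiddle_spec (h : D.IsDihedral cs H a b) {u v x : W}
    (hx : x ∈ cs.middles u v) (hxu : x * u⁻¹ ∈ H) (hvx : v * x⁻¹ ∈ H) :
    cs.flipMiddle u v x ∈ cs.middles u v ∧ cs.flipMiddle u v x ≠ x ∧
      cs.flipMiddle u v (cs.flipMiddle u v x) = x ∧
      ¬ cs.TwoStepComparable x (cs.flipMiddle u v x) ∧
      (∀ y ∈ cs.middles u v, y ≠ x → ¬ cs.TwoStepComparable x y → y = cs.flipMiddle u v x) ∧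
      cs.flipMiddle u v x * u⁻¹ ∈ H ∧ v * (cs.flipMiddle u v x)⁻¹ ∈ H ∧
      (cs.length (a * cs.flipMiddle u v x) < cs.length (cs.flipMiddle u v x) ↔
        ¬ cs.length (a * x) < cs.length x) := by
  obtain ⟨L, σ, hσ, hedge, hlev, hdown⟩ := h.exists_level u
  have huH : u * u⁻¹ ∈ H := by simp
  have hvH : v * u⁻¹ ∈ H := by
    have := mul_mem hvx hxu
    rwa [← mul_assoc, inv_mul_cancel_right] at this
  have hmid : ∀ y ∈ cs.middles u v, y * u⁻¹ ∈ H ∧ v * y⁻¹ ∈ H := fun y hy =>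
    h.mem_of_path hy.1 hy.2 hx.2.2 hx.1.2 hvx hxu (by group)
  have hbetween : ∀ y z, y * u⁻¹ ∈ H → z * u⁻¹ ∈ H → L y < L z → ¬ Odd (L y + L z) →
      ∃ w, cs.BruhatEdge y w ∧ cs.BruhatEdge w z := by
    intro y z hy hz hlt hodd
    obtain ⟨w, hw, hwz⟩ := hdown z hz (by omega)
    rw [Nat.not_odd_iff_even, Nat.even_iff] at hodd
    refine ⟨w, (hedge y w hy hw).mpr ⟨by omega, ?_⟩, (hedge w z hw hz).mpr ⟨by omega, ?_⟩⟩ <;>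
    · rw [Nat.odd_iff]; omega
  have hlen : ∀ y z, y * u⁻¹ ∈ H → z * u⁻¹ ∈ H → L y < L z → cs.length y < cs.length z := by
    intro y z hy hz hlt
    by_cases hodd : Odd (L y + L z)
    · exact ((hedge y z hy hz).mpr ⟨hlt, hodd⟩).1
    · obtain ⟨w, h1, h2⟩ := hbetween y z hy hz hlt hodd
      exact h1.1.trans h2.1
  have hmiddle : ∀ y, y ∈ cs.middles u v ↔ y * u⁻¹ ∈ H ∧ (L u < L y ∧ Odd (L u + L y)) ∧
      (L y < L v ∧ Odd (L y + L v)) := by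
    intro y
    constructor
    · intro hy
      have hyH := (hmid y hy).1
      exact ⟨hyH, (hedge u y huH hyH).mp hy.1, (hedge y v hyH hvH).mp hy.2⟩
    · rintro ⟨hyH, h1, h2⟩
      exact ⟨(hedge u y huH hyH).mpr h1, (hedge y v hyH hvH).mpr h2⟩
  have hmaps : ∀ y ∈ cs.middles u v, σ y ∈ cs.middles u v := by
    intro y hy
    rw [hmiddle] at hy ⊢
    rw [(hσ y hy.1).2.2.1]
    exact ⟨(hσ y hy.1).1, hy.2⟩
  have hdesc : ∀ y ∈ cs.middles u v,
      (cs.length (a * σ y) < cs.length (σ y) ↔ ¬ cs.length (a * y) < cs.length y) := by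
    intro y hy
    obtain ⟨h1, h2⟩ := hmid y hy
    rw [(hσ y h1).2.2.2, h.length_lt_iff_not hy.1 hy.2 h1 h2, not_not]
  have hfix : ∀ y ∈ cs.middles u v, σ y ≠ y := by
    intro y hy hc
    have := hdesc y hy
    rw [hc] at this
    exact (iff_not_self this)
  have hinv : ∀ y ∈ cs.middles u v, σ (σ y) = y := fun y hy => (hσ y (hmid y hy).1).2.1
  have hL : ∀ y ∈ cs.middles u v, L (σ y) = L y := fun y hy => (hσ y (hmid y hy).1).2.2.1
  have hflip : cs.IsFlipInvolution u v σ := by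
    refine ⟨hmaps, hinv, hfix, fun y hy z hz hlt hne => ?_⟩
    obtain ⟨h1, h2⟩ := hmid y hy
    obtain ⟨h3, h4⟩ := hmid z hz
    apply hlen _ _ (hσ y h1).1 (hσ z h3).1
    rw [hL y hy, hL z hz]
    rcases lt_trichotomy (L y) (L z) with h5 | h5 | h5
    · exact h5
    · rcases hlev y z h1 h3 h5 with rfl | h6
      · exact absurd hlt (lt_irrefl _)
      · exact absurd h6 hne
    · exact absurd (hlen z y h3 h1 h5) (by omega)
  -- At a lowest level where f differs from σ, both f y and f (σ y) lie on higher levels. Then y is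
  -- shorter than f (σ y), so `length_lt` makes f y shorter than σ y, although it lies on a higher
  -- level.
  have huniq : ∀ f, cs.IsFlipInvolution u v f → ∀ y ∈ cs.middles u v, f y = σ y := by
    intro f hf y hy
    induction hn : L y using Nat.strong_induction_on generalizing y with
    | _ n ih =>
      subst hn
      have step : ∀ z ∈ cs.middles u v, L z = L y → f z ≠ σ z → L y < L (f z) := by
        intro z hz hzy hne
        have hfz := hf.mapsTo z hz
        rcases lt_trichotomy (L (f z)) (L y) with h5 | h5 | h5
        · have h6 := ih _ h5 (f z) hfz rfl
          rw [hf.invol z hz] at h6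
          have h7 := hL (f z) hfz
          rw [← h6] at h7
          omega
        · rcases hlev z (f z) (hmid z hz).1 (hmid _ hfz).1 (by omega) with h6 | h6
          · exact absurd h6 (hf.fixedPointFree z hz)
          · exact absurd h6 hne
        · exact h5
      by_contra hne
      have hyσ := hmaps y hy
      have h1 := step y hy rfl hne
      have hne' : f (σ y) ≠ σ (σ y) := by
        rw [hinv y hy]
        intro hc
        apply hne
        rw [← hf.invol (σ y) hyσ, hc]
      have h2 := step (σ y) hyσ (hL y hy) hne'
      have hd := hf.mapsTo _ hyσ
      have hc := hf.mapsTo _ hy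
      have h3 := hf.length_lt y hy (f (σ y)) hd
        (hlen _ _ (hmid y hy).1 (hmid _ hd).1 h2) (by
          intro h4
          have h5 := congrArg f h4
          rw [hf.invol _ hyσ, hf.invol _ hy] at h5
          exact hfix y hy h5)
      rw [hf.invol _ hyσ] at h3
      have h4 := hlen (σ y) (f y) (hmid _ hyσ).1 (hmid _ hc).1 (by rw [hL y hy]; exact h1)
      omega
  have hex : ∃ f : W → W, cs.IsFlipInvolution u v f := ⟨σ, hflip⟩
  have hfm : ∀ y ∈ cs.middles u v, cs.flipMiddle u v y = σ y := by
    intro y hy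
    rw [flipMiddle, dif_pos hex]
    exact huniq _ hex.choose_spec y hy
  rw [hfm x hx, hfm _ (hmaps x hx)]
  refine ⟨hmaps x hx, hfix x hx, hinv x hx, ?_, ?_, (hmid _ (hmaps x hx)).1,
    (hmid _ (hmaps x hx)).2, hdesc x hx⟩
  · have hxσ := hmaps x hx
    -- A two-step path between middle vertices stays in the coset, since z y⁻¹ is a product of two
    -- reflections of H; so it strictly raises the level.
    have key : ∀ y z w, y ∈ cs.middles u v → z ∈ cs.middles u v → cs.BruhatEdge y w →
        cs.BruhatEdge w z → L y = L z → False := by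
      intro y z w hy hz hyw hwz hyz
      obtain ⟨hyu, hvy⟩ := hmid y hy
      obtain ⟨hzu, hvz⟩ := hmid z hz
      have h1 := (h.mem_of_path hyw hwz (t := z * u⁻¹) (t' := y * u⁻¹) hz.1.2 hy.1.2 hzu hyu
        (by rw [← hy.1.2.inv]; group)).1
      have h2 : w * u⁻¹ ∈ H := by
        have := mul_mem h1 hyu
        rwa [← mul_assoc, inv_mul_cancel_right] at this
      have h3 := ((hedge y w hyu h2).mp hyw).1
      have h4 := ((hedge w z h2 hzu).mp hwz).1
      omega
    rintro ⟨z, ⟨h1, h2⟩ | ⟨h1, h2⟩⟩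
    · exact key _ _ _ hx hxσ h1 h2 (hL x hx).symm
    · exact key _ _ _ hxσ hx h1 h2 (hL x hx)
  · intro y hy hne hnot
    have hyu := (hmid y hy).1
    -- All middle vertices have levels of the same parity, so distinct levels differ by at least 2
    -- and leave room for a vertex in between.
    have hparity : ¬ Odd (L x + L y) ∧ ¬ Odd (L y + L x) := by
      have h1 := ((hmiddle x).mp hx).2.1.2
      have h2 := ((hmiddle y).mp hy).2.1.2
      rw [Nat.odd_iff] at h1 h2
      rw [Nat.odd_iff, Nat.odd_iff]
      omega
    rcases lt_trichotomy (L x) (L y) with h5 | h5 | h5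
    · obtain ⟨w, h6⟩ := hbetween x y hxu hyu h5 hparity.1
      exact absurd ⟨w, Or.inl h6⟩ hnot
    · exact (hlev x y hxu hyu h5).resolve_left hne
    · obtain ⟨w, h6⟩ := hbetween y x hyu hxu h5 hparity.2
      exact absurd ⟨w, Or.inr h6⟩ hnot

variable (D)

theorem exists_isDihedral_of_mem_middles {u v x : W} (hx : x ∈ cs.middles u v) :
    ∃ H a b, D.IsDihedral cs H a b ∧ x * u⁻¹ ∈ H ∧ v * x⁻¹ ∈ H := by
  refine D.exists_isDihedral hx.1.2 hx.2.2 fun hc => ?_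
  have h1 : v = u := by
    calc v = (v * x⁻¹) * (x * u⁻¹) * u := by group
      _ = u := by rw [← hc, hx.1.2.mul_self, one_mul]
  have h2 := hx.1.1.trans hx.2.1
  rw [h1] at h2
  exact lt_irrefl _ h2

include D

theorem flipMiddle_mem {u v x : W} (hx : x ∈ cs.middles u v) :
    cs.flipMiddle u v x ∈ cs.middles u v := by
  obtain ⟨H, a, b, h, h1, h2⟩ := D.exists_isDihedral_of_mem_middles hx
  exact (h.flipMiddle_spec hx h1 h2).1

theorem flipMiddle_flipMiddle {u v x : W} (hx : x ∈ cs.middles u v) :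
    cs.flipMiddle u v (cs.flipMiddle u v x) = x := by
  obtain ⟨H, a, b, h, h1, h2⟩ := D.exists_isDihedral_of_mem_middles hx
  exact (h.flipMiddle_spec hx h1 h2).2.2.1

/-- A description of the flip by edges of the Bruhat graph alone, without lengths or a dihedral
subgroup. It lets flips be compared in different Coxeter groups. -/
theorem flipMiddle_eq_iff {u v x y : W} (hx : x ∈ cs.middles u v) :
    cs.flipMiddle u v x = y ↔ y ∈ cs.middles u v ∧ y ≠ x ∧ ¬ cs.TwoStepComparable x y := by
  obtain ⟨H, a, b, h, h1, h2⟩ := D.exists_isDihedral_of_mem_middles hx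
  have h3 := h.flipMiddle_spec hx h1 h2
  constructor
  · rintro rfl
    exact ⟨h3.1, h3.2.1, h3.2.2.2.1⟩
  · rintro ⟨h4, h5, h6⟩
    exact (h3.2.2.2.2.1 y h4 h5 h6).symm

end RootBasis

/-! ### The standard root basis -/

theorem dihedralCoeff_two_mul_cos (θ : ℝ) (k : ℕ) :
    dihedralCoeff (2 * Real.cos θ) k * Real.sin θ = Real.sin (k * θ) := by
  induction k using Nat.twoStepInduction with
  | zero => simp
  | one => simp
  | more k ih1 ih2 =>
    rw [dihedralCoeff_add_two, sub_mul, mul_assoc, ih2, ih1]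
    push_cast
    have h1 : ((k : ℝ) + 1 + 1) * θ = (k + 1) * θ + θ := by ring
    have h2 : (k : ℝ) * θ = (k + 1) * θ - θ := by ring
    rw [show ((k : ℝ) + 2) * θ = (k + 1) * θ + θ by ring, h2, Real.sin_add, Real.sin_sub]
    ring

theorem dihedralCoeff_two (k : ℕ) : dihedralCoeff 2 k = k := by
  induction k using Nat.twoStepInduction with
  | zero => simp
  | one => simp
  | more k ih1 ih2 =>
    rw [dihedralCoeff_add_two, ih1, ih2]
    push_cast
    ring

namespace CoxeterMatrix

variable {B : Type*} (M : CoxeterMatrix B)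

/-- The symmetric bilinear form on `(B →₀ ℝ) × (B →₀ ℝ)` that extends the form of the geometric
representation on the first factor and pairs the two factors. -/
noncomputable def standardForm :
    ((B →₀ ℝ) × (B →₀ ℝ)) →ₗ[ℝ] ((B →₀ ℝ) × (B →₀ ℝ)) →ₗ[ℝ] ℝ :=
  LinearMap.mk₂ ℝ (fun y z =>
    Finsupp.linearCombination ℝ (fun i => Finsupp.linearCombination ℝ
      (fun j => -(2 * Real.cos (Real.pi / M i j)))) y.1 z.1 +
    Finsupp.linearCombination ℝ (fun i => (Finsupp.lapply i : (B →₀ ℝ) →ₗ[ℝ] ℝ)) y.2 z.1 +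
    Finsupp.linearCombination ℝ (fun i => (Finsupp.lapply i : (B →₀ ℝ) →ₗ[ℝ] ℝ)) z.2 y.1)
    (by intros; simp only [Prod.fst_add, Prod.snd_add, map_add, LinearMap.add_apply]; ring)
    (by
      intros
      simp only [Prod.smul_fst, Prod.smul_snd, map_smul, LinearMap.smul_apply, smul_eq_mul]; ring)
    (by intros; simp only [Prod.fst_add, Prod.snd_add, map_add, LinearMap.add_apply]; ring)
    (by
      intros
      simp only [Prod.smul_fst, Prod.smul_snd, map_smul, LinearMap.smul_apply, smul_eq_mul]; ring)

theorem standardForm_apply (y z : (B →₀ ℝ) × (B →₀ ℝ)) : M.standardForm y z =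
    Finsupp.linearCombination ℝ (fun i => Finsupp.linearCombination ℝ
      (fun j => -(2 * Real.cos (Real.pi / M i j)))) y.1 z.1 +
    Finsupp.linearCombination ℝ (fun i => (Finsupp.lapply i : (B →₀ ℝ) →ₗ[ℝ] ℝ)) y.2 z.1 +
    Finsupp.linearCombination ℝ (fun i => (Finsupp.lapply i : (B →₀ ℝ) →ₗ[ℝ] ℝ)) z.2 y.1 := rfl

theorem standardForm_single (i j : B) :
    M.standardForm (Finsupp.single i 1, 0) (Finsupp.single j 1, 0) =
      -(2 * Real.cos (Real.pi / M i j)) := by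
  simp [standardForm_apply]

theorem standardForm_comm (y z : (B →₀ ℝ) × (B →₀ ℝ)) :
    M.standardForm y z = M.standardForm z y := by
  have h : ∀ v w : B →₀ ℝ, Finsupp.linearCombination ℝ (fun i => Finsupp.linearCombination ℝ
      (fun j => -(2 * Real.cos (Real.pi / M i j)))) v w =
      Finsupp.linearCombination ℝ (fun i => Finsupp.linearCombination ℝ
      (fun j => -(2 * Real.cos (Real.pi / M i j)))) w v := by
    intro v w
    induction v using Finsupp.induction_linear with
    | zero => simp
    | add v v' hv hv' => rw [map_add, map_add, LinearMap.add_apply, hv, hv']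
    | single i a =>
      induction w using Finsupp.induction_linear with
      | zero => simp
      | add w w' hw hw' => rw [map_add, map_add, LinearMap.add_apply, hw, hw']
      | single j b => simp [M.symmetric i j]; ring
  rw [standardForm_apply, standardForm_apply, h]
  ring

theorem coord_nonneg_of_mem_span {y : (B →₀ ℝ) × (B →₀ ℝ)}
    (hy : y ∈ Submodule.span ℝ≥0
      (Set.range fun i : B => ((Finsupp.single i 1, 0) : (B →₀ ℝ) × (B →₀ ℝ)))) :
    (∀ i, 0 ≤ y.1 i) ∧ y.2 = 0 := by
  classical
  induction hy using Submodule.span_induction with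
  | mem y hy =>
    obtain ⟨j, rfl⟩ := hy
    refine ⟨fun i => ?_, rfl⟩
    rw [Finsupp.single_apply]
    split_ifs <;> simp
  | zero => simp
  | add y z _ _ hy hz =>
    exact ⟨fun i => add_nonneg (hy.1 i) (hz.1 i), by simp [hy.2, hz.2]⟩
  | smul c y _ hy =>
    rw [NNReal.smul_def]
    exact ⟨fun i => mul_nonneg c.2 (hy.1 i), by simp [hy.2]⟩

theorem snd_eq_zero_of_mem_span {y : (B →₀ ℝ) × (B →₀ ℝ)}
    (hy : y ∈ Submodule.span ℝ
      (Set.range fun i : B => ((Finsupp.single i 1, 0) : (B →₀ ℝ) × (B →₀ ℝ)))) : y.2 = 0 := by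
  induction hy using Submodule.span_induction with
  | mem y hy => obtain ⟨j, rfl⟩ := hy; rfl
  | zero => rfl
  | add y z _ _ hy hz => simp [hy, hz]
  | smul c y _ hy => simp [hy]

/-- The standard root basis: the simple roots of the geometric representation, in a space on which
the bilinear form is nondegenerate. -/
noncomputable def standardRootBasis : RootBasis M ((B →₀ ℝ) × (B →₀ ℝ)) where
  form := M.standardForm
  form_comm := M.standardForm_comm
  root i := (Finsupp.single i 1, 0)
  form_root_self i := by simp [standardForm_single]
  coeff_nonneg i j hij k hk := by
    rw [standardForm_single, neg_neg]
    rcases Nat.eq_zero_or_pos (M i j) with h0 | hpos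
    -- For M i j = 0 the quotient π / 0 is 0, so the parameter is 2 cos 0 = 2 and the coefficients
    -- are p k = k: the infinite dihedral case.
    · rw [h0]
      simp [dihedralCoeff_two]
    · have h2 : 2 ≤ M i j := by have := M.off_diagonal i j hij; omega
      have h2' : (2 : ℝ) ≤ M i j := by exact_mod_cast h2
      have hk' : (k : ℝ) ≤ M i j := by exact_mod_cast (by omega : k ≤ M i j)
      have hsin : 0 < Real.sin (Real.pi / M i j) := by
        apply Real.sin_pos_of_pos_of_lt_pi
        · positivity
        · exact div_lt_self Real.pi_pos (by linarith)
      have h3 : 0 ≤ Real.sin (k * (Real.pi / M i j)) := by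
        apply Real.sin_nonneg_of_nonneg_of_le_pi
        · positivity
        · rw [mul_div_assoc', div_le_iff₀ (by linarith), mul_comm]
          exact mul_le_mul_of_nonneg_left hk' Real.pi_pos.le
      rw [← dihedralCoeff_two_mul_cos] at h3
      exact nonneg_of_mul_nonneg_left h3 hsin
  coeff_eq_zero i j hij := by
    rw [standardForm_single, neg_neg]
    rcases Nat.eq_zero_or_pos (M i j) with h0 | hpos
    · rw [h0]; simp
    · have h2 : 2 ≤ M i j := by have := M.off_diagonal i j hij; omega
      have h2' : (2 : ℝ) ≤ M i j := by exact_mod_cast h2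
      have hsin : 0 < Real.sin (Real.pi / M i j) := by
        apply Real.sin_pos_of_pos_of_lt_pi
        · positivity
        · exact div_lt_self Real.pi_pos (by linarith)
      have h3 := dihedralCoeff_two_mul_cos (Real.pi / M i j) (M i j)
      rw [mul_div_cancel₀ _ (by linarith : (M i j : ℝ) ≠ 0), Real.sin_pi] at h3
      exact (mul_eq_zero.mp h3).resolve_right hsin.ne'
  salient y hy hy' := by
    obtain ⟨h1, h2⟩ := coord_nonneg_of_mem_span hy
    obtain ⟨h3, -⟩ := coord_nonneg_of_mem_span hy'
    refine Prod.ext (Finsupp.ext fun i => le_antisymm ?_ (h1 i)) h2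
    simpa using h3 i
  nondeg y hy h := by
    have h2 := snd_eq_zero_of_mem_span hy
    refine Prod.ext (Finsupp.ext fun i => ?_) h2
    -- The second factor is there for this: its basis vectors read off the coordinates of the first.
    simpa [standardForm_apply] using h (0, Finsupp.single i 1)

theorem linearIndependent_standardRootBasis_root :
    LinearIndependent ℝ M.standardRootBasis.root := by
  have h : LinearIndependent ℝ fun i : B => Finsupp.single i (1 : ℝ) :=
    Finsupp.linearIndependent_single_one ℝ B
  exact (h.map' (LinearMap.inl ℝ (B →₀ ℝ) (B →₀ ℝ))
    (LinearMap.ker_eq_bot.mpr LinearMap.inl_injective))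

end CoxeterMatrix

/-! ### Reflection orderings -/

namespace RootBasis

open CoxeterSystem

variable {B : Type*} {M : CoxeterMatrix B} {E : Type*} [AddCommGroup E] [Module ℝ E]
  (D : RootBasis M E) {W : Type*} [Group W] {cs : CoxeterSystem M W}

/-- With respect to the basis given by the roots of `a` and `b`, the pair of the roots of `t` and
`t'` is positively oriented. -/
def DetLT (cs : CoxeterSystem M W) (a b t t' : W) : Prop :=
  ∃ p q p' q' : ℝ, D.rootOf cs t = p • D.rootOf cs a + q • D.rootOf cs b ∧
    D.rootOf cs t' = p' • D.rootOf cs a + q' • D.rootOf cs b ∧ 0 < p * q' - q * p'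

variable {D} {H : Subgroup W} {a b : W}

theorem DetLT.swap {t t' : W} (h : D.DetLT cs a b t t') : D.DetLT cs b a t' t := by
  obtain ⟨p, q, p', q', h1, h2, h3⟩ := h
  exact ⟨q', p', q, p, by rw [h2, add_comm], by rw [h1, add_comm], by linarith⟩

theorem DetLT.not_swap (ha : cs.IsReflection a) (hb : cs.IsReflection b) (hab : a ≠ b) {t t' : W}
    (h : D.DetLT cs a b t t') : ¬ D.DetLT cs a b t' t := by
  obtain ⟨p, q, p', q', h1, h2, h3⟩ := h
  rintro ⟨r', s', r, s, h4, h5, h6⟩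
  rw [h1] at h5
  rw [h2] at h4
  obtain ⟨rfl, rfl⟩ := D.rootOf_coeff_unique ha hb hab h4
  obtain ⟨rfl, rfl⟩ := D.rootOf_coeff_unique ha hb hab h5
  linarith

theorem eq_of_det_eq_zero {t t' : W} (ht : cs.IsReflection t) (ht' : cs.IsReflection t')
    {p q p' q' : ℝ} (h : D.rootOf cs t = p • D.rootOf cs a + q • D.rootOf cs b)
    (h' : D.rootOf cs t' = p' • D.rootOf cs a + q' • D.rootOf cs b) (hdet : p * q' - q * p' = 0) :
    t = t' := by
  by_contra hne
  have h1 : q' • D.rootOf cs t + (-q) • D.rootOf cs t' = 0 := by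
    have : q' • D.rootOf cs t + (-q) • D.rootOf cs t' = (p * q' - q * p') • D.rootOf cs a := by
      rw [h, h']; module
    rw [this, hdet, zero_smul]
  have h2 : p' • D.rootOf cs t + (-p) • D.rootOf cs t' = 0 := by
    have : p' • D.rootOf cs t + (-p) • D.rootOf cs t' = (-(p * q' - q * p')) • D.rootOf cs b := by
      rw [h, h']; module
    rw [this, hdet, neg_zero, zero_smul]
  have h3 := D.smul_rootOf_add_smul_rootOf ht ht' hne h1
  have h4 := D.smul_rootOf_add_smul_rootOf ht ht' hne h2
  have hp : p = 0 := by linarith [h4.2]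
  have hq : q = 0 := by linarith [h3.2]
  rw [hp, hq, zero_smul, zero_smul, add_zero] at h
  exact D.rootOf_ne_zero ht h

theorem rootOf_chain (ha : D.IsCanonical cs H a) (hb : D.IsCanonical cs H b) (hab : a ≠ b) {j : ℕ}
    (hj : orderOf (a * b) = 0 ∨ j < orderOf (a * b)) :
    D.rootOf cs ((a * b) ^ j * a) =
      dihedralCoeff (-D.form (D.rootOf cs a) (D.rootOf cs b)) (j + 1) • D.rootOf cs a +
        dihedralCoeff (-D.form (D.rootOf cs a) (D.rootOf cs b)) j • D.rootOf cs b ∧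
    D.rootOf cs ((b * a) ^ j * b) =
      dihedralCoeff (-D.form (D.rootOf cs a) (D.rootOf cs b)) j • D.rootOf cs a +
        dihedralCoeff (-D.form (D.rootOf cs a) (D.rootOf cs b)) (j + 1) • D.rootOf cs b := by
  have h1 := (D.dihedralCoeff_of_isCanonical ha hb hab).1
  have h2 := ha.1.chain hb.1 j
  have h3 := D.isReflectionAlong_chain ha.1 hb.1 j
  exact ⟨D.rootOf_eq h2.1 (add_mem (D.smul_mem_cone (h1 _ (by omega)) (D.rootOf_mem_cone ha.1))
      (D.smul_mem_cone (h1 _ (by omega)) (D.rootOf_mem_cone hb.1))) h3.1,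
    D.rootOf_eq h2.2 (add_mem (D.smul_mem_cone (h1 _ (by omega)) (D.rootOf_mem_cone ha.1))
      (D.smul_mem_cone (h1 _ (by omega)) (D.rootOf_mem_cone hb.1))) h3.2⟩

theorem detLT_chain (ha : D.IsCanonical cs H a) (hb : D.IsCanonical cs H b) (hab : a ≠ b) {i j : ℕ}
    (hij : i < j) (hj : orderOf (a * b) = 0 ∨ j < orderOf (a * b)) :
    D.DetLT cs a b ((a * b) ^ i * a) ((a * b) ^ j * a) ∧
      D.DetLT cs a b ((b * a) ^ j * b) ((b * a) ^ i * b) := by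
  have hi := rootOf_chain ha hb hab (j := i) (by omega)
  have hj' := rootOf_chain ha hb hab hj
  have hpos := dihedralCoeff_pos _ (D.dihedralCoeff_of_isCanonical ha hb hab).1
    (k := j - i) (by omega) (by omega)
  have hid := dihedralCoeff_mul_sub_mul (-D.form (D.rootOf cs a) (D.rootOf cs b)) i (j - i)
  rw [show i + (j - i) = j by omega] at hid
  exact ⟨⟨_, _, _, _, hi.1, hj'.1, by linarith⟩, ⟨_, _, _, _, hj'.2, hi.2, by linarith⟩⟩

theorem detLT_chain_chain (ha : D.IsCanonical cs H a) (hb : D.IsCanonical cs H b) (hab : a ≠ b)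
    {i j : ℕ} (hij : orderOf (a * b) = 0 ∨ i + j + 1 < orderOf (a * b)) :
    D.DetLT cs a b ((a * b) ^ i * a) ((b * a) ^ j * b) := by
  have hi := rootOf_chain ha hb hab (j := i) (by omega)
  have hj := rootOf_chain ha hb hab (j := j) (by omega)
  have hpos := dihedralCoeff_pos _ (D.dihedralCoeff_of_isCanonical ha hb hab).1
    (k := i + j + 1) (by omega) hij
  have hid := dihedralCoeff_mul_sub_mul' (-D.form (D.rootOf cs a) (D.rootOf cs b)) i j
  exact ⟨_, _, _, _, hi.1, hj.2, by linarith⟩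

theorem isDihedralChain_of_detLT (ha : D.IsCanonical cs H a) (hb : D.IsCanonical cs H b)
    (hab : a ≠ b) {r : W → W → Prop}
    (hr : ∀ t t', cs.IsReflection t → cs.IsReflection t' → D.DetLT cs a b t t' → r t t') :
    IsDihedralChain r a b := by
  refine ⟨fun i j hij hj => ?_, fun i j hij hj => ?_, fun i j hij => ?_⟩
  · exact hr _ _ (ha.1.chain hb.1 i).1 (ha.1.chain hb.1 j).1 (detLT_chain ha hb hab hij hj).1
  · exact hr _ _ (ha.1.chain hb.1 j).2 (ha.1.chain hb.1 i).2 (detLT_chain ha hb hab hij hj).2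
  · exact hr _ _ (ha.1.chain hb.1 i).1 (ha.1.chain hb.1 j).2 (detLT_chain_chain ha hb hab hij)

/-- If ab has finite order, the exponent can be reduced modulo it, so one of the two chains already
lists all reflections. -/
theorem exists_chain_lt (ha : cs.IsReflection a) (hb : cs.IsReflection b) {t : W}
    (ht : cs.IsReflection t) (htH : t ∈ Subgroup.closure {a, b}) :
    (∃ k, (orderOf (a * b) = 0 ∨ k < orderOf (a * b)) ∧ t = (a * b) ^ k * a) ∨
      (orderOf (a * b) = 0 ∧ ∃ k, t = (b * a) ^ k * b) := by
  rcases Nat.eq_zero_or_pos (orderOf (a * b)) with h0 | hpos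
  · obtain ⟨k, hk | hk⟩ := exists_chain_of_odd ha hb htH ht.odd_length
    · exact Or.inl ⟨k, Or.inl h0, hk⟩
    · exact Or.inr ⟨h0, k, hk⟩
  · left
    obtain ⟨n, rfl | rfl⟩ := exists_zpow_of_mem_closure_pair ha.mul_self hb.mul_self htH
    · have hodd := ht.odd_length
      rw [← Nat.not_even_iff_odd, even_length_iff, map_zpow, ha.lengthParity_mul hb,
        one_zpow] at hodd
      exact absurd rfl hodd
    · have h1 := Int.emod_nonneg n (b := orderOf (a * b)) (by omega)
      have h2 := Int.emod_lt_of_pos n (b := orderOf (a * b)) (by omega)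
      refine ⟨(n % orderOf (a * b)).toNat, Or.inr (by omega), ?_⟩
      rw [← zpow_natCast, Int.toNat_of_nonneg h1, zpow_mod_orderOf]

theorem rel_of_isDihedralChain (ha : D.IsCanonical cs H a) (hb : D.IsCanonical cs H b)
    (hab : a ≠ b) {r : W → W → Prop} (hr : IsDihedralChain r a b) {t t' : W}
    (ht : cs.IsReflection t) (ht' : cs.IsReflection t') (htH : t ∈ Subgroup.closure {a, b})
    (htH' : t' ∈ Subgroup.closure {a, b}) (hdet : D.DetLT cs a b t t') : r t t' := by
  have hirr : ¬ D.DetLT cs a b t t := fun h => h.not_swap ha.1 hb.1 hab h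
  have hns := hdet.not_swap ha.1 hb.1 hab
  rcases exists_chain_lt ha.1 hb.1 ht htH with ⟨k, hk, rfl⟩ | ⟨h0, k, rfl⟩ <;>
  rcases exists_chain_lt ha.1 hb.1 ht' htH' with ⟨l, hl, rfl⟩ | ⟨h0', l, rfl⟩
  · rcases lt_trichotomy k l with h | rfl | h
    · exact hr.1 k l h hl
    · exact absurd hdet hirr
    · exact absurd (detLT_chain ha hb hab h hk).1 hns
  · exact hr.2.2 k l (Or.inl h0')
  · exact absurd (detLT_chain_chain ha hb hab (Or.inl h0)) hns
  · rcases lt_trichotomy k l with h | rfl | h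
    · exact absurd (detLT_chain ha hb hab h (Or.inl h0)).2 hns
    · exact absurd hdet hirr
    · exact hr.2.1 l k h (Or.inl h0)

theorem isDihedralChain_of_isReflectionOrdering {r : W → W → Prop}
    (hr : cs.IsReflectionOrdering r) (hH : cs.IsReflectionSubgroup H) (ha : D.IsCanonical cs H a)
    (hb : D.IsCanonical cs H b) (hab : a ≠ b) (hc : ∀ c, D.IsCanonical cs H c → c = a ∨ c = b) :
    IsDihedralChain r a b ∨ IsDihedralChain r b a := by
  refine hr.dihedral H hH ⟨a, ha.2.1⟩ ⟨b, hb.2.1⟩ (fun h => hab (congrArg Subtype.val h)) ?_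
  ext c
  rw [← D.isCanonical_iff]
  simp only [Set.mem_insert_iff, Set.mem_singleton_iff, Subtype.ext_iff]
  refine ⟨hc c, ?_⟩
  rintro (h | h) <;> rw [h]
  exacts [ha, hb]

/-- The betweenness property of reflection orderings. -/
theorem between_of_isReflectionOrdering {r : W → W → Prop} (hr : cs.IsReflectionOrdering r)
    {t t₁ t₂ : W} (ht : cs.IsReflection t) (h₁ : cs.IsReflection t₁) (h₂ : cs.IsReflection t₂)
    (hne : t₁ ≠ t₂) {c₁ c₂ : ℝ} (hc₁ : 0 < c₁) (hc₂ : 0 < c₂)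
    (h : D.rootOf cs t = c₁ • D.rootOf cs t₁ + c₂ • D.rootOf cs t₂) :
    (r t₁ t ∧ r t t₂) ∨ (r t₂ t ∧ r t t₁) := by
  obtain ⟨H, a, b, hd, hm₁, hm₂⟩ := D.exists_isDihedral h₁ h₂ hne
  wlog hchain : IsDihedralChain r a b generalizing a b
  · refine this b a hd.symm ?_
    exact (isDihedralChain_of_isReflectionOrdering hr hd.1 hd.2 hd.3 hd.4 hd.5).resolve_left hchain
  obtain ⟨p₁, q₁, -, -, hβ₁⟩ := hd.exists_coeff h₁ hm₁
  obtain ⟨p₂, q₂, -, -, hβ₂⟩ := hd.exists_coeff h₂ hm₂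
  have hβ : D.rootOf cs t = (c₁ * p₁ + c₂ * p₂) • D.rootOf cs a +
      (c₁ * q₁ + c₂ * q₂) • D.rootOf cs b := by
    rw [h, hβ₁, hβ₂]; module
  have hm : t ∈ H := hd.6 t ht (Submodule.mem_span_pair.mpr ⟨_, _, hβ.symm⟩)
  have hrel : ∀ s s', cs.IsReflection s → cs.IsReflection s' → s ∈ H → s' ∈ H →
      D.DetLT cs a b s s' → r s s' := by
    intro s s' hs hs' hsH hsH' hdet
    rw [← hd.closure_eq] at hsH hsH'
    exact rel_of_isDihedralChain hd.2 hd.3 hd.4 hchain hs hs' hsH hsH' hdet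
  rcases lt_trichotomy 0 (p₁ * q₂ - q₁ * p₂) with hδ | hδ | hδ
  · left
    constructor
    · exact hrel _ _ h₁ ht hm₁ hm ⟨_, _, _, _, hβ₁, hβ, by nlinarith⟩
    · exact hrel _ _ ht h₂ hm hm₂ ⟨_, _, _, _, hβ, hβ₂, by nlinarith⟩
  · exact absurd (eq_of_det_eq_zero h₁ h₂ hβ₁ hβ₂ hδ.symm) hne
  · right
    constructor
    · exact hrel _ _ h₂ ht hm₂ hm ⟨_, _, _, _, hβ₂, hβ, by nlinarith⟩
    · exact hrel _ _ ht h₁ hm hm₁ ⟨_, _, _, _, hβ, hβ₁, by nlinarith⟩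

/-- A path of length two in a dihedral coset has increasing labels if and only if its middle vertex
is shortened by the first generator. -/
theorem IsDihedral.detLT_iff (h : D.IsDihedral cs H a b) {x y z : W}
    (hxy : cs.BruhatEdge x y) (hyz : cs.BruhatEdge y z) (hxyH : y * x⁻¹ ∈ H)
    (hyzH : z * y⁻¹ ∈ H) :
    D.DetLT cs a b (y * x⁻¹) (z * y⁻¹) ↔ cs.length (a * y) < cs.length y := by
  have key : ∀ {a b : W} (_ : D.IsDihedral cs H a b), cs.length (a * y) < cs.length y →
      D.DetLT cs a b (y * x⁻¹) (z * y⁻¹) := by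
    intro a b h ha
    have hb := (h.length_lt_iff_not hxy hyz hxyH hyzH).mp ha
    rw [D.length_reflection_mul_lt_iff h.right.1] at hb
    have hb' := (D.action_rootOf_mem_cone_or y⁻¹ h.right.1).resolve_right hb
    obtain ⟨p, q, hp, hq, h1⟩ := h.exists_coeff hxy.2 hxyH
    obtain ⟨p', q', hp', hq', h2⟩ := h.exists_coeff hyz.2 hyzH
    have h3 : -D.action cs y⁻¹ (D.rootOf cs (y * x⁻¹)) ∈ D.cone := by
      rw [← D.length_reflection_mul_lt_iff hxy.2]
      have : y * x⁻¹ * y = x := by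
        rw [← hxy.2.inv]; group
      rw [this]; exact hxy.1
    have h4 : D.action cs y⁻¹ (D.rootOf cs (z * y⁻¹)) ∈ D.cone := by
      rw [← D.length_lt_reflection_mul_iff hyz.2]
      simpa using hyz.1
    -- Eliminating the root of a from the two label roots. The outgoing label stays positive under
    -- y⁻¹, the incoming one becomes negative, and b stays positive, so the determinant is not
    -- negative.
    have h5 : (p * q' - q * p') • D.action cs y⁻¹ (D.rootOf cs b) ∈ D.cone := by
      have h6 : (p * q' - q * p') • D.action cs y⁻¹ (D.rootOf cs b) =
          p • D.action cs y⁻¹ (D.rootOf cs (z * y⁻¹)) +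
          p' • -D.action cs y⁻¹ (D.rootOf cs (y * x⁻¹)) := by
        rw [h1, h2]
        simp only [map_add, map_smul]
        module
      rw [h6]
      exact add_mem (D.smul_mem_cone hp h4) (D.smul_mem_cone hp' h3)
    refine ⟨p, q, p', q', h1, h2, ?_⟩
    rcases lt_trichotomy 0 (p * q' - q * p') with hδ | hδ | hδ
    · exact hδ
    · exfalso
      have h6 := eq_of_det_eq_zero hxy.2 hyz.2 h1 h2 hδ.symm
      have h7 : z = x := by
        calc z = (z * y⁻¹) * (y * x⁻¹) * x := by group
          _ = x := by rw [← h6, hxy.2.mul_self, one_mul]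
      have h8 := hxy.1.trans hyz.1
      rw [h7] at h8
      exact lt_irrefl _ h8
    · exfalso
      refine D.not_mem_cone_and_neg _ h.right.1 hb' ?_
      have h6 := D.smul_mem_cone (c := (-(p * q' - q * p'))⁻¹)
        (inv_nonneg.mpr (by linarith)) h5
      rwa [smul_smul, inv_neg, neg_mul, inv_mul_cancel₀ hδ.ne, neg_one_smul] at h6
  refine ⟨fun hdet => ?_, key h⟩
  by_contra hc
  have h1 := h.symm.length_lt_iff_not hxy hyz hxyH hyzH
  exact hdet.not_swap h.left.1 h.right.1 h.ne (key h.symm (h1.mpr hc)).swap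

/-! ### Restriction of reflection orderings -/

/-- A reflection subgroup K of H has the same canonical generators whether it is viewed in H or in
W, because signs of roots agree. -/
theorem isReflectionOrdering_subsystem {r : W → W → Prop} (hr : cs.IsReflectionOrdering r)
    (hH : cs.IsReflectionSubgroup H) :
    (D.subsystem hH).IsReflectionOrdering fun x y => r x y := by
  have hrefl := fun t : H => (D.subsystem_isReflection_iff hH (t := t))
  refine ⟨fun s hs => hr.refl s ((hrefl s).mp hs),
    fun s t hs ht h1 h2 => Subtype.ext (hr.antisymm s t ((hrefl s).mp hs) ((hrefl t).mp ht) h1 h2),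
    fun s t w hs ht hw => hr.trans s t w ((hrefl s).mp hs) ((hrefl t).mp ht) ((hrefl w).mp hw),
    fun s t hs ht => hr.total s t ((hrefl s).mp hs) ((hrefl t).mp ht), ?_⟩
  intro K hK a b hab hcan
  have hK' : cs.IsReflectionSubgroup (K.map H.subtype) := by
    apply le_antisymm
    · rw [Subgroup.closure_le]
      exact fun t ht => ht.1
    · conv_lhs => rw [← hK]
      rw [MonoidHom.map_closure]
      refine Subgroup.closure_mono ?_
      rintro _ ⟨t, ⟨htK, ht⟩, rfl⟩
      exact ⟨⟨t, htK, rfl⟩, (hrefl t).mp ht⟩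
  have hiff : ∀ t : H, D.IsCanonical cs (K.map H.subtype) (t : W) ↔
      (D.restrict cs H).IsCanonical (D.subsystem hH) K t := by
    intro t
    constructor
    · rintro ⟨h1, ⟨t', h2, h2'⟩, h3⟩
      obtain rfl : t' = t := Subtype.ext h2'
      refine ⟨(hrefl t').mpr h1, h2, fun s hs hsK hne => ?_⟩
      rw [D.restrict_action_rootOf_mem_cone_iff hH ((hrefl s).mp hs)]
      exact h3 s ((hrefl s).mp hs) ⟨s, hsK, rfl⟩ fun h => hne (Subtype.ext h)
    · rintro ⟨h1, h2, h3⟩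
      refine ⟨(hrefl t).mp h1, ⟨t, h2, rfl⟩, ?_⟩
      rintro _ hs ⟨s, hsK, rfl⟩ hne
      rw [Subgroup.subtype_apply] at hs ⊢
      rw [← D.restrict_action_rootOf_mem_cone_iff hH hs]
      exact h3 s ((hrefl s).mpr hs) hsK fun h => hne (by rw [h]; rfl)
  have hmem : ∀ t : K, D.IsCanonical cs (K.map H.subtype) ((t : H) : W) ↔ t = a ∨ t = b := by
    intro t
    rw [hiff, isCanonical_iff, hcan]
    rfl
  have hres := isDihedralChain_of_isReflectionOrdering (D := D) hr hK' (a := ((a : H) : W))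
    (b := ((b : H) : W)) ((hmem a).mpr (Or.inl rfl)) ((hmem b).mpr (Or.inr rfl))
    (fun h => hab (Subtype.ext (Subtype.ext h))) (by
      intro c hc
      obtain ⟨c', hc', rfl⟩ := hc.2.1
      rcases (hmem ⟨c', hc'⟩).mp hc with h | h
      · left; rw [← h]; rfl
      · right; rw [← h]; rfl)
  have hchain : ∀ s t : H, IsDihedralChain r (s : W) (t : W) →
      IsDihedralChain (fun x y : H => r x y) s t := by
    intro s t h
    have hord : orderOf (s * t) = orderOf (s * t : W) := by
      rw [← Subgroup.orderOf_coe, Subgroup.coe_mul]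
    unfold IsDihedralChain
    rw [hord]
    exact h
  exact hres.imp (hchain _ _) (hchain _ _)

end RootBasis

/-! ### Existence of reflection orderings -/

namespace CoxeterSystem

variable {B : Type*} {M : CoxeterMatrix B} {W : Type*} [Group W] (cs : CoxeterSystem M W)

/-- Scale all positive roots to height one and order them lexicographically. The scaled roots of a
dihedral subgroup lie on a line, along which the lexicographic order is monotone. -/
theorem exists_isReflectionOrdering : ∃ r, cs.IsReflectionOrdering r := by
  classical
  let _ : LinearOrder B := linearOrderOfSTO (WellOrderingRel (α := B))
  set D := M.standardRootBasis with hD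
  let ht : ((B →₀ ℝ) × (B →₀ ℝ)) →ₗ[ℝ] ℝ :=
    (Finsupp.linearCombination ℝ fun _ => (1 : ℝ)).comp (LinearMap.fst ℝ _ _)
  have hcone : ∀ t, cs.IsReflection t → (∀ i, 0 ≤ (D.rootOf cs t).1 i) ∧ (D.rootOf cs t).2 = 0 :=
    fun t h => CoxeterMatrix.coord_nonneg_of_mem_span (D.rootOf_mem_cone h)
  have hpos : ∀ t, cs.IsReflection t → 0 < ht (D.rootOf cs t) := by
    intro t h
    obtain ⟨h1, h2⟩ := hcone t h
    have h3 : (D.rootOf cs t).1 ≠ 0 := fun h4 => D.rootOf_ne_zero h (Prod.ext h4 h2)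
    obtain ⟨i, hi⟩ := Finsupp.ne_iff.mp h3
    simp only [ht, LinearMap.comp_apply, LinearMap.fst_apply, Finsupp.linearCombination_apply,
      Finsupp.sum, smul_eq_mul, mul_one]
    exact Finset.sum_pos' (fun j _ => h1 j)
      ⟨i, Finsupp.mem_support_iff.mpr hi, lt_of_le_of_ne (h1 i) (Ne.symm hi)⟩
  let n : W → (B →₀ ℝ) := fun t => (ht (D.rootOf cs t))⁻¹ • (D.rootOf cs t).1
  have hinj : ∀ s t, cs.IsReflection s → cs.IsReflection t → n s = n t → s = t := by
    intro s t hs h h1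
    refine D.eq_of_smul_rootOf hs h (c := ht (D.rootOf cs s) * (ht (D.rootOf cs t))⁻¹)
      (mul_nonneg (hpos s hs).le (inv_nonneg.mpr (hpos t h).le)) (Prod.ext ?_ ?_)
    · rw [Prod.smul_fst, mul_smul]
      change _ = _ • n t
      rw [← h1]
      simp only [n]
      rw [smul_smul, mul_inv_cancel₀ (hpos s hs).ne', one_smul]
    · rw [(hcone s hs).2, Prod.smul_snd, (hcone t h).2, smul_zero]
  have hdet : ∀ a b, cs.IsReflection a → cs.IsReflection b → toLex (n a) < toLex (n b) →
      ∀ s t, cs.IsReflection s → cs.IsReflection t → D.DetLT cs a b s t →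
        toLex (n s) ≤ toLex (n t) := by
    rintro a b ha hb hlt s t hs h ⟨p, q, p', q', h1, h2, h3⟩
    apply le_of_lt
    obtain ⟨i, hi1, hi2⟩ := Finsupp.Lex.lt_iff.mp hlt
    have hps := hpos s hs
    have hpt := hpos t h
    have hpa := hpos a ha
    have hpb := hpos b hb
    have hsv : ht (D.rootOf cs s) = p * ht (D.rootOf cs a) + q * ht (D.rootOf cs b) := by
      rw [h1, map_add, map_smul, map_smul]; rfl
    have htv : ht (D.rootOf cs t) = p' * ht (D.rootOf cs a) + q' * ht (D.rootOf cs b) := by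
      rw [h2, map_add, map_smul, map_smul]; rfl
    -- The difference of two scaled roots in the plane is a multiple of that for a and b, and the
    -- factor has the sign of the determinant.
    have hkey : ∀ k, n t k - n s k = ((p * q' - q * p') * ht (D.rootOf cs a) *
        ht (D.rootOf cs b) / (ht (D.rootOf cs s) * ht (D.rootOf cs t))) * (n b k - n a k) := by
      intro k
      simp only [n, Finsupp.smul_apply, smul_eq_mul]
      have e1 : (D.rootOf cs s).1 k = p * (D.rootOf cs a).1 k + q * (D.rootOf cs b).1 k := by
        rw [h1]; rfl
      have e2 : (D.rootOf cs t).1 k = p' * (D.rootOf cs a).1 k + q' * (D.rootOf cs b).1 k := by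
        rw [h2]; rfl
      rw [e1, e2]
      generalize (D.rootOf cs a).1 k = A at *
      generalize (D.rootOf cs b).1 k = B' at *
      generalize ht (D.rootOf cs s) = S at *
      generalize ht (D.rootOf cs t) = T at *
      generalize ht (D.rootOf cs a) = α at *
      generalize ht (D.rootOf cs b) = β at *
      have := hps.ne'
      have := hpt.ne'
      have := hpa.ne'
      have := hpb.ne'
      field_simp
      rw [hsv, htv]
      ring
    have hcpos : 0 < (p * q' - q * p') * ht (D.rootOf cs a) *
        ht (D.rootOf cs b) / (ht (D.rootOf cs s) * ht (D.rootOf cs t)) := by positivity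
    refine Finsupp.Lex.lt_iff.mpr ⟨i, fun j hj => ?_, ?_⟩
    · have h4 := hkey j
      have h5 : n a j = n b j := hi1 j hj
      rw [h5, sub_self, mul_zero] at h4
      change n s j = n t j
      linarith
    · have h4 := hkey i
      have h5 : n a i < n b i := hi2
      have h6 := mul_pos hcpos (sub_pos.mpr h5)
      change n s i < n t i
      linarith
  refine ⟨fun s t => toLex (n s) ≤ toLex (n t), fun s _ => le_rfl,
    fun s t hs h h1 h2 => hinj s t hs h (toLex.injective (le_antisymm h1 h2)),
    fun s t w _ _ _ => le_trans, fun s t _ _ => le_total _ _, ?_⟩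
  intro H hH a b hab hcan
  have ha : D.IsCanonical cs H (a : W) := by rw [D.isCanonical_iff, hcan]; simp
  have hb : D.IsCanonical cs H (b : W) := by rw [D.isCanonical_iff, hcan]; simp
  have hab' : (a : W) ≠ b := fun h => hab (Subtype.ext h)
  rcases lt_trichotomy (toLex (n a)) (toLex (n b)) with h | h | h
  · left
    exact RootBasis.isDihedralChain_of_detLT ha hb hab' (hdet a b ha.1 hb.1 h)
  · exact absurd (hinj _ _ ha.1 hb.1 (toLex.injective h)) hab'
  · right
    exact RootBasis.isDihedralChain_of_detLT hb ha hab'.symm (hdet b a hb.1 ha.1 h)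

end CoxeterSystem

/-! ### Paths as lists of labels -/

theorem List.append_inj_of_disjoint {α : Type*} {l₁ l₂ l₃ l₁' l₂' l₃' : List α} {p q r : α → Prop}
    (hpq : ∀ a, p a → ¬ q a) (hpr : ∀ a, p a → ¬ r a) (hqr : ∀ a, q a → ¬ r a)
    (h₁ : ∀ a ∈ l₁, p a) (h₂ : ∀ a ∈ l₂, q a) (h₃ : ∀ a ∈ l₃, r a)
    (h₁' : ∀ a ∈ l₁', p a) (h₂' : ∀ a ∈ l₂', q a) (h₃' : ∀ a ∈ l₃', r a)
    (h : l₁ ++ (l₂ ++ l₃) = l₁' ++ (l₂' ++ l₃')) : l₁ = l₁' ∧ l₂ = l₂' ∧ l₃ = l₃' := by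
  classical
  have key : ∀ {k₁ k₂ k₃ : List α}, (∀ a ∈ k₁, p a) → (∀ a ∈ k₂, q a) → (∀ a ∈ k₃, r a) →
      (k₁ ++ (k₂ ++ k₃)).filter (fun a => p a) = k₁ ∧
      (k₁ ++ (k₂ ++ k₃)).filter (fun a => q a) = k₂ := by
    intro k₁ k₂ k₃ g₁ g₂ g₃
    simp only [List.filter_append]
    constructor
    · rw [List.filter_eq_self.mpr (by simpa using g₁),
        List.filter_eq_nil_iff.mpr (by simpa using fun a ha hp => hpq a hp (g₂ a ha)),
        List.filter_eq_nil_iff.mpr (by simpa using fun a ha hp => hpr a hp (g₃ a ha))]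
      simp
    · rw [List.filter_eq_nil_iff.mpr (by simpa using fun a ha => hpq a (g₁ a ha)),
        List.filter_eq_self.mpr (by simpa using g₂),
        List.filter_eq_nil_iff.mpr (by simpa using fun a ha hp => hqr a hp (g₃ a ha))]
      simp
  have e₁ := key h₁ h₂ h₃
  have e₂ := key h₁' h₂' h₃'
  rw [h] at e₁
  have h1 := e₁.1.symm.trans e₂.1
  have h2 := e₁.2.symm.trans e₂.2
  subst h1 h2
  exact ⟨rfl, rfl, List.append_cancel_left (List.append_cancel_left h)⟩

namespace CoxeterSystem

variable {B : Type*} {M : CoxeterMatrix B} {W : Type*} [Group W] (cs : CoxeterSystem M W)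

/-- The end of the path that starts at `w` and has the list of labels `l`. -/
def endpoint (w : W) (l : List W) : W := l.foldl (fun w t => t * w) w

@[simp] theorem endpoint_nil (w : W) : endpoint w [] = w := rfl

@[simp] theorem endpoint_cons (w t : W) (l : List W) :
    endpoint w (t :: l) = endpoint (t * w) l := rfl

theorem endpoint_append (w : W) (l l' : List W) :
    endpoint w (l ++ l') = endpoint (endpoint w l) l' := List.foldl_append

/-- There is a path in the Bruhat graph that starts at `w` and has the list of labels `l`. -/
def IsLabelPath : W → List W → Prop
  | _, [] => True
  | w, t :: l => cs.BruhatEdge w (t * w) ∧ IsLabelPath (t * w) l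

theorem isLabelPath_append {w : W} {l l' : List W} :
    cs.IsLabelPath w (l ++ l') ↔ cs.IsLabelPath w l ∧ cs.IsLabelPath (endpoint w l) l' := by
  induction l generalizing w with
  | nil => simp [IsLabelPath]
  | cons t l ih => simp [IsLabelPath, ih, and_assoc]

/-- `P` is a set of label lists of paths that start at `u`, closed under all flips. -/
structure IsFlipClosed (u : W) (P : Set (List W)) : Prop where
  isLabelPath : ∀ l ∈ P, cs.IsLabelPath u l
  flip_mem : ∀ l₁ t t' l₂, l₁ ++ t :: t' :: l₂ ∈ P →
    ∀ w m, w = endpoint u l₁ → m = cs.flipMiddle w (t' * (t * w)) (t * w) →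
      l₁ ++ (m * w⁻¹) :: (t' * (t * w) * m⁻¹) :: l₂ ∈ P

/-- Flip a path at all its inner vertices, one after the other. -/
noncomputable def flipAll (w : W) : List W → List W
  | [] => []
  | [t] => [t]
  | t :: t' :: l =>
    cs.flipMiddle w (t' * (t * w)) (t * w) * w⁻¹ ::
      flipAll (cs.flipMiddle w (t' * (t * w)) (t * w))
        (t' * (t * w) * (cs.flipMiddle w (t' * (t * w)) (t * w))⁻¹ :: l)
  termination_by l => l.length

/-- The reflection `a` shortens all inner vertices of a path. -/
def ShortensInner (a : W) : W → List W → Prop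
  | _, [] => True
  | _, [_] => True
  | w, t :: t' :: l =>
    cs.length (a * (t * w)) < cs.length (t * w) ∧ ShortensInner a (t * w) (t' :: l)

variable {cs}

end CoxeterSystem

namespace RootBasis

open CoxeterSystem

variable {B : Type*} {M : CoxeterMatrix B} {E : Type*} [AddCommGroup E] [Module ℝ E]
  {D : RootBasis M E} {W : Type*} [Group W] {cs : CoxeterSystem M W} {H : Subgroup W} {a b : W}

theorem IsDihedral.shortensInner_iff (h : D.IsDihedral cs H a b) {w : W} {l : List W}
    (hl : cs.IsLabelPath w l) (hlH : ∀ t ∈ l, t ∈ H) :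
    cs.ShortensInner a w l ↔ l.IsChain (D.DetLT cs a b) := by
  induction l generalizing w with
  | nil => simp [ShortensInner]
  | cons t l ih =>
    cases l with
    | nil => simp [ShortensInner]
    | cons t' l =>
      have h1 := h.detLT_iff hl.1 hl.2.1 (by simpa using hlH t (by simp))
        (by rw [mul_inv_cancel_right]; exact hlH t' (by simp))
      rw [mul_inv_cancel_right, mul_inv_cancel_right] at h1
      rw [ShortensInner, List.isChain_cons_cons, ih hl.2 (fun s hs => hlH s (by simp [hs])), h1]

/-- The coefficient vectors lie in one quadrant, where positive orientation is a transitive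
comparison of slopes. -/
theorem IsDihedral.detLT_trans (h : D.IsDihedral cs H a b) {t t' t'' : W}
    (ht : cs.IsReflection t) (ht' : cs.IsReflection t') (ht'' : cs.IsReflection t'')
    (hH : t ∈ H) (hH' : t' ∈ H) (hH'' : t'' ∈ H) (h₁ : D.DetLT cs a b t t')
    (h₂ : D.DetLT cs a b t' t'') : D.DetLT cs a b t t'' := by
  obtain ⟨p, q, hp, hq, h3⟩ := h.exists_coeff ht hH
  obtain ⟨p', q', hp', hq', h4⟩ := h.exists_coeff ht' hH'
  obtain ⟨p'', q'', hp'', hq'', h5⟩ := h.exists_coeff ht'' hH''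
  obtain ⟨x, y, x', y', e1, e2, e3⟩ := h₁
  obtain ⟨z, w, z', w', e4, e5, e6⟩ := h₂
  obtain ⟨rfl, rfl⟩ := D.rootOf_coeff_unique h.left.1 h.right.1 h.ne (e1.symm.trans h3)
  obtain ⟨rfl, rfl⟩ := D.rootOf_coeff_unique h.left.1 h.right.1 h.ne (e2.symm.trans h4)
  obtain ⟨rfl, rfl⟩ := D.rootOf_coeff_unique h.left.1 h.right.1 h.ne (e4.symm.trans h4)
  obtain ⟨rfl, rfl⟩ := D.rootOf_coeff_unique h.left.1 h.right.1 h.ne (e5.symm.trans h5)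
  refine ⟨_, _, _, _, h3, h5, ?_⟩
  rcases hq'.eq_or_lt with h0 | h0
  · rw [← h0] at e3
    nlinarith [mul_nonneg hq hp']
  · have h7 : w * (x * w' - y * z') = w' * (x * w - y * z) + y * (z * w' - w * z') := by ring
    have h8 : 0 < w' := by
      rcases hq''.eq_or_lt with h9 | h9
      · rw [← h9] at e6
        nlinarith [mul_nonneg hq' hp'']
      · exact h9
    have h9 : 0 < w * (x * w' - y * z') := by
      rw [h7]
      have := mul_pos h8 e3
      have := mul_nonneg hq e6.le
      linarith
    exact (pos_iff_pos_of_mul_pos h9).mp h0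

theorem IsDihedral.pairwise_of_isChain (h : D.IsDihedral cs H a b) {l : List W}
    (hl : ∀ t ∈ l, cs.IsReflection t ∧ t ∈ H) (hc : l.IsChain (D.DetLT cs a b)) :
    l.Pairwise (D.DetLT cs a b) := by
  have h1 : l.IsChain fun t t' => (cs.IsReflection t ∧ t ∈ H) ∧ (cs.IsReflection t' ∧ t' ∈ H) ∧
      D.DetLT cs a b t t' := by
    rw [List.isChain_iff_getElem] at hc ⊢
    exact fun i hi => ⟨hl _ (List.getElem_mem _), hl _ (List.getElem_mem _), hc i hi⟩
  have : IsTrans W fun t t' => (cs.IsReflection t ∧ t ∈ H) ∧ (cs.IsReflection t' ∧ t' ∈ H) ∧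
      D.DetLT cs a b t t' :=
    ⟨fun t t' t'' h1 h2 => ⟨h1.1, h2.2.1,
      h.detLT_trans h1.1.1 h1.2.1.1 h2.2.1.1 h1.1.2 h1.2.1.2 h2.2.1.2 h1.2.2 h2.2.2⟩⟩
  exact (List.isChain_iff_pairwise.mp h1).imp fun h => h.2.2

/-- Each single flip changes which generator shortens the flipped vertex and leaves the later
vertices alone, so flipping from left to right turns a path increasing towards b into one increasing
towards a. The last clause carries the surrounding path along. -/
theorem IsDihedral.flipAll_spec (h : D.IsDihedral cs H a b) {w : W} {l : List W}
    (hl : cs.IsLabelPath w l) (hlH : ∀ t ∈ l, t ∈ H) (hs : cs.ShortensInner a w l) :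
    cs.IsLabelPath w (cs.flipAll w l) ∧ (∀ t ∈ cs.flipAll w l, t ∈ H) ∧
      cs.ShortensInner b w (cs.flipAll w l) ∧ endpoint w (cs.flipAll w l) = endpoint w l ∧
      (cs.flipAll w l).length = l.length ∧
      ∀ u P l₁ l₃, cs.IsFlipClosed u P → endpoint u l₁ = w → l₁ ++ (l ++ l₃) ∈ P →
        l₁ ++ (cs.flipAll w l ++ l₃) ∈ P := by
  induction hn : l.length generalizing w l with
  | zero =>
    obtain rfl := List.length_eq_zero_iff.mp hn
    simp [flipAll, IsLabelPath, ShortensInner]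
  | succ n ih =>
    match l, hn with
    | [t], _ =>
      rw [show cs.flipAll w [t] = [t] by simp only [flipAll]]
      exact ⟨hl, hlH, trivial, rfl, ‹_›, fun _ _ _ _ _ _ h => h⟩
    | t :: t' :: l, hn =>
      have hx : t * w ∈ cs.middles w (t' * (t * w)) := ⟨hl.1, hl.2.1⟩
      obtain ⟨s1, s2, s3, s4, s5, s6, s7, s8⟩ := h.flipMiddle_spec hx
        (by simpa using hlH t (by simp)) (by rw [mul_inv_cancel_right]; exact hlH t' (by simp))
      rw [flipAll]
      set m := cs.flipMiddle w (t' * (t * w)) (t * w) with hm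
      set t₁ := m * w⁻¹ with ht₁
      set t₁' := t' * (t * w) * m⁻¹ with ht₁'
      have e1 : t₁ * w = m := by rw [ht₁]; group
      have e2 : t₁' * m = t' * (t * w) := by rw [ht₁']; group
      have hp : cs.IsLabelPath m (t₁' :: l) := ⟨by rw [e2]; exact s1.2, by rw [e2]; exact hl.2.2⟩
      have hpH : ∀ s ∈ t₁' :: l, s ∈ H := by
        intro s hs
        rcases List.mem_cons.mp hs with rfl | hs
        · exact s7
        · exact hlH s (by simp [hs])
      have hps : cs.ShortensInner a m (t₁' :: l) := by
        cases l with
        | nil => trivial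
        | cons t'' l =>
          refine ⟨?_, ?_⟩
          · rw [e2]; exact hs.2.1
          · rw [e2]; exact hs.2.2
      obtain ⟨i1, i2, i3, i4, i5, i6⟩ := ih hp hpH hps (by simpa using hn)
      refine ⟨⟨by rw [e1]; exact s1.1, by rw [e1]; exact i1⟩, ?_, ?_, ?_, ?_, ?_⟩
      · intro s hs
        rcases List.mem_cons.mp hs with rfl | hs
        · exact s6
        · exact i2 s hs
      · obtain ⟨r, l', hr⟩ : ∃ r l', cs.flipAll m (t₁' :: l) = r :: l' := by
          cases hc : cs.flipAll m (t₁' :: l) with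
          | nil => rw [hc] at i5; simp at i5; simp at hn; omega
          | cons r l' => exact ⟨r, l', rfl⟩
        rw [hr] at i1 i2 i3 ⊢
        refine ⟨?_, by rw [e1]; exact i3⟩
        rw [e1]
        -- The vertex m is not flipped again. Flipping took it out of the reach of a, and exactly
        -- one of a and b shortens it.
        by_contra hb
        have := (h.length_lt_iff_not s1.1 i1.1 s6 (by simpa using i2 r (by simp))).mpr hb
        exact s8.mp this hs.1
      · rw [endpoint_cons, e1, i4, endpoint_cons, e2, endpoint_cons, endpoint_cons]
      · rw [List.length_cons, i5]
      · intro u P l₁ l₃ hP hu hmem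
        have h1 : (l₁ ++ [t₁]) ++ ((t₁' :: l) ++ l₃) ∈ P := by
          have := hP.flip_mem l₁ t t' (l ++ l₃) (by simpa using hmem) w m hu.symm hm
          simpa using this
        have h2 := i6 u P (l₁ ++ [t₁]) l₃ hP (by rw [endpoint_append, hu]; simpa using e1) h1
        simpa using h2

/-- The first label of the result determines the new vertex m; induction recovers the rest, and the
flip at the first inner vertex is undone by flipping back. -/
theorem flipAll_injOn (D : RootBasis M E) {w : W} {l l' : List W} (hl : cs.IsLabelPath w l)
    (hl' : cs.IsLabelPath w l')
    (hlen : l.length = l'.length) (h : cs.flipAll w l = cs.flipAll w l') : l = l' := by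
  induction hn : l.length generalizing w l l' with
  | zero =>
    rw [hn] at hlen
    rw [List.length_eq_zero_iff.mp hn, List.length_eq_zero_iff.mp hlen.symm]
  | succ n ih =>
    match l, l', hn, hlen with
    | [t], [t'], _, _ => simpa [flipAll] using h
    | t :: t' :: l, s :: s' :: l', hn, hlen =>
      have hx : t * w ∈ cs.middles w (t' * (t * w)) := ⟨hl.1, hl.2.1⟩
      have hy : s * w ∈ cs.middles w (s' * (s * w)) := ⟨hl'.1, hl'.2.1⟩
      rw [flipAll, flipAll] at h
      have hx1 := D.flipMiddle_mem hx
      have hy1 := D.flipMiddle_mem hy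
      have hx2 := D.flipMiddle_flipMiddle hx
      have hy2 := D.flipMiddle_flipMiddle hy
      set m := cs.flipMiddle w (t' * (t * w)) (t * w) with hm
      set m' := cs.flipMiddle w (s' * (s * w)) (s * w) with hm'
      obtain ⟨h1, h2⟩ := List.cons_eq_cons.mp h
      have hmm : m = m' := mul_right_cancel h1
      rw [← hmm] at h2 hy1 hy2
      have e2 : ∀ x : W, x * m⁻¹ * m = x := fun x => by group
      have h3 := ih (w := m) (l := t' * (t * w) * m⁻¹ :: l) (l' := s' * (s * w) * m⁻¹ :: l')
        ⟨by rw [e2]; exact hx1.2, by rw [e2]; exact hl.2.2⟩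
        ⟨by rw [e2]; exact hy1.2, by rw [e2]; exact hl'.2.2⟩ (by simpa using hlen) h2
        (by simpa using hn)
      obtain ⟨h4, rfl⟩ := List.cons_eq_cons.mp h3
      have h5 : t' * (t * w) = s' * (s * w) := mul_right_cancel h4
      have h6 : t * w = s * w := by rw [← hx2, ← hy2, h5]
      have h7 : t = s := mul_right_cancel h6
      subst h7
      rw [mul_right_cancel h5]

/-- The core of the invariance of c(F). Cut a path at the block C and apply `flipAll` to the middle
part. The result is sorted the other way and uses only reflections of H, so it is a sublist of C'.
Since the big list has no repetitions, the three parts can be recovered, and the map is injective.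
-/
theorem IsDihedral.encard_sublist_le (h : D.IsDihedral cs H a b) {u : W} {P : Set (List W)}
    (hP : cs.IsFlipClosed u P) {L₁ L₃ C C' : List W} (hnodup : (L₁ ++ (C ++ L₃)).Nodup)
    (hC : ∀ t ∈ C, cs.IsReflection t ∧ t ∈ H) (hCC : ∀ t, t ∈ C ↔ t ∈ C')
    (hall : ∀ t ∈ H, cs.IsReflection t → t ∈ C) (hCd : C.Pairwise (D.DetLT cs a b))
    (hCd' : C'.Pairwise (D.DetLT cs b a)) :
    {l | l ∈ P ∧ l.Sublist (L₁ ++ (C ++ L₃))}.encard ≤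
      {l | l ∈ P ∧ l.Sublist (L₁ ++ (C' ++ L₃))}.encard := by
  have hdec : ∀ l ∈ {l | l ∈ P ∧ l.Sublist (L₁ ++ (C ++ L₃))}, ∃ l₁ l₂ l₃ : List W,
      l = l₁ ++ (l₂ ++ l₃) ∧ l₁.Sublist L₁ ∧ l₂.Sublist C ∧ l₃.Sublist L₃ := by
    rintro l ⟨-, hl⟩
    obtain ⟨l₁, l₂₃, rfl, h1, h2⟩ := List.sublist_append_iff.mp hl
    obtain ⟨l₂, l₃, rfl, h3, h4⟩ := List.sublist_append_iff.mp h2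
    exact ⟨l₁, l₂, l₃, rfl, h1, h3, h4⟩
  choose! d₁ d₂ d₃ hd h₁ h₂ h₃ using hdec
  have hspec : ∀ l ∈ {l | l ∈ P ∧ l.Sublist (L₁ ++ (C ++ L₃))},
      cs.IsLabelPath (endpoint u (d₁ l)) (d₂ l) ∧ (∀ t ∈ d₂ l, t ∈ H) ∧
        cs.ShortensInner a (endpoint u (d₁ l)) (d₂ l) := by
    intro l hl
    have h1 := hP.isLabelPath l hl.1
    rw [hd l hl, isLabelPath_append, isLabelPath_append] at h1
    have h2 : ∀ t ∈ d₂ l, t ∈ H := fun t ht => (hC t ((h₂ l hl).subset ht)).2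
    refine ⟨h1.2.1, h2, (h.shortensInner_iff h1.2.1 h2).mpr ?_⟩
    exact (hCd.sublist (h₂ l hl)).isChain
  have hlabel : ∀ {w : W} {l : List W}, cs.IsLabelPath w l → ∀ t ∈ l, cs.IsReflection t := by
    intro w l hl
    induction l generalizing w with
    | nil => simp
    | cons s l ih =>
      intro t ht
      rcases List.mem_cons.mp ht with rfl | ht
      · simpa using hl.1.2
      · exact ih hl.2 t ht
  have hmem : ∀ l ∈ {l | l ∈ P ∧ l.Sublist (L₁ ++ (C ++ L₃))},
      ∀ t ∈ cs.flipAll (endpoint u (d₁ l)) (d₂ l), cs.IsReflection t ∧ t ∈ H := by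
    intro l hl t ht
    obtain ⟨g1, g2, g3⟩ := hspec l hl
    obtain ⟨f1, f2, -⟩ := h.flipAll_spec g1 g2 g3
    exact ⟨hlabel f1 t ht, f2 t ht⟩
  refine Set.encard_le_encard_of_injOn
    (f := fun l => d₁ l ++ (cs.flipAll (endpoint u (d₁ l)) (d₂ l) ++ d₃ l)) ?_ ?_
  · intro l hl
    obtain ⟨g1, g2, g3⟩ := hspec l hl
    obtain ⟨f1, f2, f3, f4, f5, f6⟩ := h.flipAll_spec g1 g2 g3
    refine ⟨f6 u P _ _ hP rfl (by rw [← hd l hl]; exact hl.1), ?_⟩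
    refine (h₁ l hl).append (List.Sublist.append ?_ (h₃ l hl))
    have hirr : ∀ t, ¬ D.DetLT cs b a t t := fun t ht =>
      ht.not_swap h.right.1 h.left.1 h.ne.symm ht
    have hpw := h.symm.pairwise_of_isChain (hmem l hl) ((h.symm.shortensInner_iff f1 f2).mp f3)
    have : Std.Antisymm (D.DetLT cs b a) :=
      ⟨fun t t' h1 h2 => absurd h2 (h1.not_swap h.right.1 h.left.1 h.ne.symm)⟩
    refine List.sublist_of_subperm_of_pairwise (List.Nodup.subperm ?_ ?_) hpw hCd'
    · exact hpw.imp (S := (· ≠ ·)) fun {t t'} hd he => hirr t (by rw [← he] at hd; exact hd)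
    · intro t ht
      exact (hCC t).mp (hall t (hmem l hl t ht).2 (hmem l hl t ht).1)
  · intro l hl l' hl' heq
    rw [List.nodup_append, List.nodup_append] at hnodup
    obtain ⟨-, ⟨-, -, hn1⟩, hn2⟩ := hnodup
    have hsub : ∀ l ∈ {l | l ∈ P ∧ l.Sublist (L₁ ++ (C ++ L₃))},
        ∀ t ∈ cs.flipAll (endpoint u (d₁ l)) (d₂ l), t ∈ C := fun l hl t ht =>
      hall t (hmem l hl t ht).2 (hmem l hl t ht).1
    obtain ⟨h1, h2, h3⟩ := List.append_inj_of_disjoint (p := (· ∈ L₁)) (q := (· ∈ C))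
      (r := (· ∈ L₃)) (fun x hx hx' => hn2 x hx x (by simp [hx']) rfl)
      (fun x hx hx' => hn2 x hx x (by simp [hx']) rfl) (fun x hx hx' => hn1 x hx x hx' rfl)
      (fun x hx => (h₁ l hl).subset hx) (hsub l hl) (fun x hx => (h₃ l hl).subset hx)
      (fun x hx => (h₁ l' hl').subset hx) (hsub l' hl') (fun x hx => (h₃ l' hl').subset hx) heq
    obtain ⟨g1, g2, g3⟩ := hspec l hl
    obtain ⟨g1', g2', g3'⟩ := hspec l' hl'
    have f5 := (h.flipAll_spec g1 g2 g3).2.2.2.2.1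
    have f5' := (h.flipAll_spec g1' g2' g3').2.2.2.2.1
    rw [h2, f5'] at f5
    rw [← h1] at h2 g1'
    rw [hd l hl, hd l' hl', h1, h3, flipAll_injOn D g1 g1' f5.symm h2]

end RootBasis

/-! ### Reduced words -/

namespace RootBasis

open CoxeterSystem

variable {B : Type*} {M : CoxeterMatrix B} {E : Type*} [AddCommGroup E] [Module ℝ E]
  {D : RootBasis M E} {W : Type*} [Group W] {cs : CoxeterSystem M W} {H : Subgroup W} {a b : W}

/-- Two reduced words of the same element are equivalent under braid moves. -/
theorem eq_of_wordProd_eq (D : RootBasis M E) (cs : CoxeterSystem M W) {α : Type*}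
    (f : List B → α)
    (hf : ∀ (ν τ : List B) (i j : B), i ≠ j → M i j ≠ 0 →
      cs.IsReduced (ν ++ alternatingWord i j (M i j) ++ τ) →
      ¬ cs.IsRightDescent (cs.wordProd ν) i → ¬ cs.IsRightDescent (cs.wordProd ν) j →
      f (ν ++ alternatingWord i j (M i j) ++ τ) = f (ν ++ alternatingWord j i (M i j) ++ τ))
    {ω ω' τ : List B} (h : cs.wordProd ω = cs.wordProd ω') (hω : cs.IsReduced (ω ++ τ))
    (hω' : cs.IsReduced (ω' ++ τ)) : f (ω ++ τ) = f (ω' ++ τ) := by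
  have hlen : ∀ {ω ω' : List B}, cs.wordProd ω = cs.wordProd ω' → cs.IsReduced ω →
      cs.IsReduced ω' → ω.length = ω'.length := fun h h1 h2 => by rw [← h1.eq, ← h2.eq, h]
  have hleft : ∀ {ω τ : List B}, cs.IsReduced (ω ++ τ) → cs.IsReduced ω := fun {ω τ} h => by
    simpa using h.take ω.length
  induction hn : ω.length generalizing ω ω' τ with
  | zero =>
    have h1 := hlen h (hleft hω) (hleft hω')
    rw [hn] at h1
    rw [List.length_eq_zero_iff.mp hn, List.length_eq_zero_iff.mp h1.symm]
  | succ n ih =>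
    have h1 := hlen h (hleft hω) (hleft hω')
    have same : ∀ {ω ω' : List B} {i : B} {τ : List B}, ω.length = n →
        cs.wordProd (ω ++ [i]) = cs.wordProd (ω' ++ [i]) → cs.IsReduced (ω ++ [i] ++ τ) →
        cs.IsReduced (ω' ++ [i] ++ τ) → f (ω ++ [i] ++ τ) = f (ω' ++ [i] ++ τ) := by
      intro ω ω' i τ hn h hω hω'
      rw [List.append_assoc, List.append_assoc]
      rw [List.append_assoc] at hω hω'
      rw [wordProd_append, wordProd_append] at h
      exact ih (mul_right_cancel h) hω hω' hn
    obtain ⟨ω₁, i, rfl⟩ : ∃ ω₁ i, ω = ω₁ ++ [i] := by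
      rcases List.eq_nil_or_concat ω with rfl | ⟨l, i, rfl⟩
      · simp at hn
      · exact ⟨l, i, List.concat_eq_append⟩
    obtain ⟨ω₁', j, rfl⟩ : ∃ ω₁ i, ω' = ω₁ ++ [i] := by
      rcases List.eq_nil_or_concat ω' with rfl | ⟨l, i, rfl⟩
      · simp at h1
      · exact ⟨l, i, List.concat_eq_append⟩
    have hn1 : ω₁.length = n := by simpa using hn
    have hn1' : ω₁'.length = n := by simpa [hn1] using h1.symm
    by_cases hij : i = j
    · subst hij
      exact same hn1 h hω hω'
    set w := cs.wordProd (ω₁ ++ [i]) with hw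
    have hlw : cs.length w = n + 1 := by rw [hw, (hleft hω).eq, hn]
    have hdesc : ∀ {ω₁ : List B} {i : B}, ω₁.length = n → w = cs.wordProd (ω₁ ++ [i]) →
        cs.IsRightDescent w i := by
      intro ω₁ i hn1 hw
      rw [IsRightDescent, hlw, hw, wordProd_append, wordProd_singleton, simple_mul_simple_cancel_right]
      exact Nat.lt_succ_of_le ((cs.length_wordProd_le _).trans hn1.le)
    have hi := hdesc hn1 hw
    have hj := hdesc hn1' h
    obtain ⟨v, k, hvi, hvj, hdec, hk⟩ := cs.exists_eq_mul_alternatingWord (i := i) (j := j) w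
    have hvi' := D.action_root_mem_cone cs hvi
    have hvj' := D.action_root_mem_cone cs hvj
    -- With fewer than M i j alternating letters, w would keep the root of i or of j positive,
    -- although both are right descents.
    have hMk : M i j ≠ 0 ∧ M i j ≤ k := by
      by_contra hc
      have hc' : M i j = 0 ∨ k < M i j := by omega
      rcases hdec with hdec | hdec
      · exact (D.isRightDescent_iff cs).mp.mt (fun h => D.action_ne_zero cs w (D.root_ne_zero i)
          (D.eq_zero_of_mem_cone (D.action_root_mem_cone_of_decomposition cs hij hvi' hvj' hdec hc') h))
          hi
      · exact (D.isRightDescent_iff cs).mp.mt (fun h => D.action_ne_zero cs w (D.root_ne_zero j)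
          (D.eq_zero_of_mem_cone (D.action_root_mem_cone_of_decomposition cs (Ne.symm hij) hvj' hvi'
            hdec (by rwa [M.symmetric j i])) h)) hj
    have hredk : ∀ {p q : B}, w = v * cs.wordProd (alternatingWord p q k) →
        cs.IsReduced (alternatingWord p q k) := by
      intro p q h
      have h1 := cs.length_mul_le v (cs.wordProd (alternatingWord p q k))
      rw [← h, hk] at h1
      have h2 := cs.length_wordProd_le (alternatingWord p q k)
      rw [length_alternatingWord] at h2
      rw [CoxeterSystem.IsReduced, length_alternatingWord]
      omega
    have hkM : k = M i j := by
      by_contra hc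
      have hlt : k > M i j := by omega
      rcases hdec with hdec | hdec
      · exact cs.not_isReduced_alternatingWord i j hMk.1 hlt (hredk hdec)
      · exact cs.not_isReduced_alternatingWord j i (by rw [M.symmetric]; exact hMk.1)
          (by rw [M.symmetric]; exact hlt) (hredk hdec)
    have hbraid : cs.wordProd (alternatingWord i j (M i j)) =
        cs.wordProd (alternatingWord j i (M i j)) := by
      rw [cs.prod_alternatingWord_eq_prod_alternatingWord_sub i j _ (by omega)]
      congr 2; omega
    subst hkM
    have hwij : w = v * cs.wordProd (alternatingWord i j (M i j)) := by
      rcases hdec with hdec | hdec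
      · exact hdec
      · rw [hdec, hbraid]
    have hwji := hwij
    rw [hbraid] at hwji
    obtain ⟨ν, hν, rfl⟩ := cs.exists_isReduced v
    have hνlen : ν.length + M i j = n + 1 := by rw [← hν.eq, ← hk, hlw]
    obtain ⟨m, hm⟩ : ∃ m, M i j = m + 1 := ⟨M i j - 1, by omega⟩
    have hredτ : ∀ {p q : B}, w = cs.wordProd ν * cs.wordProd (alternatingWord p q (M i j)) →
        cs.IsReduced (ν ++ alternatingWord p q (M i j) ++ τ) := by
      intro p q h1
      have h2 : cs.wordProd (ν ++ alternatingWord p q (M i j) ++ τ) =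
          cs.wordProd (ω₁ ++ [i] ++ τ) := by
        rw [wordProd_append, wordProd_append, ← h1, wordProd_append _ (ω₁ ++ [i])]
      rw [CoxeterSystem.IsReduced, h2, hω.eq]
      simp only [List.length_append, List.length_singleton, length_alternatingWord, hn1]
      omega
    have r1 := hredτ hwij
    have r2 := hredτ hwji
    have e1 : ∀ p q : B, ν ++ alternatingWord p q (M i j) = (ν ++ alternatingWord q p m) ++ [q] := by
      intro p q
      rw [hm, alternatingWord_succ, List.concat_eq_append, List.append_assoc]
    -- Both words end in i, so induction applies after moving that letter into the suffix. The same
    -- is done with j, and the two resulting words differ by one braid move.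
    have s1 : f (ω₁ ++ [i] ++ τ) = f (ν ++ alternatingWord j i (M i j) ++ τ) := by
      rw [e1 j i] at r2 ⊢
      refine same hn1 ?_ hω r2
      rw [← e1, wordProd_append _ ν, ← hwji]
    have s2 : f (ω₁' ++ [j] ++ τ) = f (ν ++ alternatingWord i j (M i j) ++ τ) := by
      rw [e1 i j] at r1 ⊢
      refine same hn1' ?_ hω' r1
      rw [← e1, wordProd_append _ ν, ← hwij, h]
    rw [s1, s2]
    exact (hf ν τ i j hij hMk.1 r1 hvi hvj).symm

/-- Besides the first letter s, an inversion of s x is the conjugate by s of an inversion of x,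
because s keeps the other positive roots positive. -/
theorem mem_leftInvSeq_iff (D : RootBasis M E) {ω : List B} (hω : cs.IsReduced ω) {t : W}
    (ht : cs.IsReflection t) :
    t ∈ cs.leftInvSeq ω ↔ cs.length (t * cs.wordProd ω) < cs.length (cs.wordProd ω) := by
  refine ⟨fun h => (cs.isLeftInversion_of_mem_leftInvSeq hω h).2, ?_⟩
  clear hω
  induction ω generalizing t with
  | nil => simp
  | cons i ω ih =>
    intro h
    rw [leftInvSeq, List.mem_cons]
    by_cases hti : t = cs.simple i
    · exact Or.inl hti
    right
    rw [List.mem_map]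
    have h1 := D.action_simple_rootOf_mem_cone ht hti
    refine ⟨cs.simple i * t * (cs.simple i)⁻¹, ih (ht.conj _) ?_, ?_⟩
    · rw [D.length_reflection_mul_lt_iff (ht.conj _), ← D.action_rootOf_of_mem_cone ht h1]
      rw [D.length_reflection_mul_lt_iff ht, wordProd_cons, mul_inv_rev, action_mul_apply,
        inv_simple] at h
      exact h
    · simp [MulAut.conj_apply, mul_assoc]

/-- A right descent i of y⁻¹ x would give a root, namely x α_i up to sign, on which x⁻¹ and y⁻¹ have
different signs. -/
theorem eq_of_forall_length_lt_iff (D : RootBasis M E) {x y : W}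
    (h : ∀ t, cs.IsReflection t →
      (cs.length (t * x) < cs.length x ↔ cs.length (t * y) < cs.length y)) : x = y := by
  have h1 : ∀ t, cs.IsReflection t →
      (D.action cs x⁻¹ (D.rootOf cs t) ∈ D.cone ↔ D.action cs y⁻¹ (D.rootOf cs t) ∈ D.cone) := by
    intro t ht
    rw [← D.length_lt_reflection_mul_iff ht, ← D.length_lt_reflection_mul_iff ht]
    have := h t ht
    have := ht.length_mul_right_ne x
    have := ht.length_mul_right_ne y
    omega
  have h2 : y⁻¹ * x = 1 := by
    by_contra hne
    obtain ⟨i, hi⟩ := cs.exists_rightDescent_of_ne_one hne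
    have hs := cs.isReflection_simple i
    have hneg := (D.isRightDescent_iff cs).mp hi
    rw [action_mul_apply, ← D.rootOf_simple (cs := cs)] at hneg
    have ht := hs.conj x
    have e : D.rootOf cs (cs.simple i) ∈ D.cone := D.rootOf_mem_cone hs
    rcases D.action_rootOf_mem_cone_or x hs with hc | hc
    · have h3 := h1 _ ht
      rw [← D.action_rootOf_of_mem_cone hs hc, action_inv_action] at h3
      have h4 := h3.mp e
      have h5 := D.eq_zero_of_mem_cone h4 hneg
      exact D.action_ne_zero cs _ (D.action_ne_zero cs _ (D.rootOf_ne_zero hs)) h5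
    · have h3 := h1 _ ht
      have h4 : D.rootOf cs (x * cs.simple i * x⁻¹) =
          -D.action cs x (D.rootOf cs (cs.simple i)) := by
        rcases D.action_rootOf_eq_or x hs with h5 | h5
        · rw [h5] at hc
          exact absurd (D.eq_zero_of_mem_cone (D.rootOf_mem_cone ht) hc) (D.rootOf_ne_zero ht)
        · rw [h5, neg_neg]
      rw [h4, map_neg, map_neg, action_inv_action] at h3
      exact D.rootOf_ne_zero hs (D.eq_zero_of_mem_cone e (h3.mpr hneg))
  rw [inv_mul_eq_one] at h2
  exact h2.symm

/-! ### The number of paths along a reduced word -/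

/-- If v keeps the two canonical roots positive, it keeps all positive roots of H positive, so it
transports the whole structure. -/
theorem IsDihedral.conj {p q : W} (h : D.IsDihedral cs H p q) {v : W}
    (hp : D.action cs v (D.rootOf cs p) ∈ D.cone) (hq : D.action cs v (D.rootOf cs q) ∈ D.cone) :
    ∃ K, D.IsDihedral cs K (v * p * v⁻¹) (v * q * v⁻¹) := by
  set K : Subgroup W := H.map (MulAut.conj v).toMonoidHom with hK
  have hmem : ∀ t, t ∈ K ↔ v⁻¹ * t * v ∈ H := by
    intro t
    constructor
    · rintro ⟨s, hs, rfl⟩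
      simpa [MulAut.conj_apply, mul_assoc] using hs
    · intro ht
      exact ⟨_, ht, by simp [MulAut.conj_apply, mul_assoc]⟩
  have hconj : ∀ t, cs.IsReflection t → cs.IsReflection (v⁻¹ * t * v) := fun t ht => by
    simpa using ht.conj v⁻¹
  have hpos : ∀ t, cs.IsReflection t → t ∈ H → D.action cs v (D.rootOf cs t) ∈ D.cone := by
    intro t ht htH
    obtain ⟨x, y, hx, hy, h1⟩ := h.exists_coeff ht htH
    rw [h1, map_add, map_smul, map_smul]
    exact add_mem (D.smul_mem_cone hx hp) (D.smul_mem_cone hy hq)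
  have hroot : ∀ t, cs.IsReflection t → t ∈ H →
      D.rootOf cs (v * t * v⁻¹) = D.action cs v (D.rootOf cs t) := fun t ht htH =>
    (D.action_rootOf_of_mem_cone ht (hpos t ht htH)).symm
  have hcan : ∀ s, D.IsCanonical cs H s → D.IsCanonical cs K (v * s * v⁻¹) := by
    intro s hs
    refine ⟨hs.1.conj v, (hmem _).mpr (by simpa [mul_assoc] using hs.2.1), fun r hr hrK hne => ?_⟩
    have h1 := (hmem r).mp hrK
    have h2 := hconj r hr
    have hne' : v⁻¹ * r * v ≠ s := by
      rintro rfl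
      exact hne (by group)
    have h3 := hs.2.2 _ h2 h1 hne'
    have h4 : r = v * (v⁻¹ * r * v) * v⁻¹ := by group
    rw [h4, hroot _ h2 h1, ← action_mul_apply, inv_mul_cancel_right, action_mul_apply,
      D.action_rootOf_of_mem_cone h2 h3]
    exact hpos _ (h2.conj _) (mul_mem (mul_mem hs.2.1 h1) (inv_mem hs.2.1))
  have hspan : ∀ t ∈ K, cs.IsReflection t → D.rootOf cs t ∈ Submodule.span ℝ
      {D.action cs v (D.rootOf cs p), D.action cs v (D.rootOf cs q)} := by
    intro t htK ht
    have h1 := (hmem t).mp htK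
    have h2 := hconj t ht
    obtain ⟨x, y, -, -, h3⟩ := h.exists_coeff h2 h1
    have h4 : t = v * (v⁻¹ * t * v) * v⁻¹ := by group
    rw [h4, hroot _ h2 h1, h3, map_add, map_smul, map_smul]
    exact Submodule.mem_span_pair.mpr ⟨x, y, rfl⟩
  have hne : v * p * v⁻¹ ≠ v * q * v⁻¹ := fun h1 => h.ne (by simpa using h1)
  refine ⟨K, ?_, hcan p h.left, hcan q h.right, hne, fun c hc =>
    (hcan p h.left).eq_or_eq_of_mem_span_pair D hspan (hcan q h.right) hc hne, ?_⟩
  · apply le_antisymm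
    · rw [Subgroup.closure_le]
      exact fun t ht => ht.1
    · rw [hK]
      conv_lhs => rw [← h.isReflectionSubgroup]
      rw [MonoidHom.map_closure]
      refine Subgroup.closure_mono ?_
      rintro _ ⟨t, ⟨htH, ht⟩, rfl⟩
      exact ⟨⟨t, htH, rfl⟩, ht.conj v⟩
  · intro t ht hts
    rw [hroot p h.left.1 h.left.2.1, hroot q h.right.1 h.right.2.1] at hts
    obtain ⟨x, y, h1⟩ := Submodule.mem_span_pair.mp hts
    refine (hmem t).mpr (h.mem_of_rootOf_mem _ (hconj t ht) ?_)
    have h2 : D.action cs v⁻¹ (D.rootOf cs t) = x • D.rootOf cs p + y • D.rootOf cs q := by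
      rw [← h1, map_add, map_smul, map_smul, action_inv_action, action_inv_action]
    have h3 := D.action_rootOf_eq_or v⁻¹ ht
    rw [inv_inv] at h3
    rcases h3 with h3 | h3
    · rw [← h3, h2]
      exact Submodule.mem_span_pair.mpr ⟨x, y, rfl⟩
    · rw [← neg_eq_iff_eq_neg] at h3
      rw [← h3, h2]
      exact neg_mem (Submodule.mem_span_pair.mpr ⟨x, y, rfl⟩)

theorem exists_isDihedral_simple (D : RootBasis M E) (cs : CoxeterSystem M W) {i j : B}
    (hij : cs.simple i ≠ cs.simple j) : ∃ H, D.IsDihedral cs H (cs.simple i) (cs.simple j) := by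
  obtain ⟨H, a, b, h, hi, hj⟩ :=
    D.exists_isDihedral (cs.isReflection_simple i) (cs.isReflection_simple j) hij
  refine ⟨H, ?_⟩
  rcases h.eq_or_eq _ (D.isCanonical_simple hi) with h1 | h1 <;>
  rcases h.eq_or_eq _ (D.isCanonical_simple hj) with h2 | h2
  · exact absurd (h1.trans h2.symm) hij
  · rw [h1, h2]; exact h
  · rw [h1, h2]; exact h.symm
  · exact absurd (h1.trans h2.symm) hij

end RootBasis

namespace CoxeterSystem

variable {B : Type*} {M : CoxeterMatrix B} {W : Type*} [Group W] (cs : CoxeterSystem M W)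

/-- The list `a, aba, ababa, …` of length `m`. -/
def chainList (a b : W) (m : ℕ) : List W := (List.range m).map fun k => (a * b) ^ k * a

theorem chainList_succ {a b : W} (hb : b * b = 1) (m : ℕ) :
    chainList b a (m + 1) = b :: (chainList a b m).map (MulAut.conj b) := by
  rw [chainList, List.range_succ_eq_map, List.map_cons, List.map_map, chainList, List.map_map]
  congr 1
  · simp
  · refine List.map_congr_left fun k _ => ?_
    have h1 : b⁻¹ = b := inv_eq_of_mul_eq_one_left hb
    have h2 : ∀ k : ℕ, (b * a) ^ k * b = b * (a * b) ^ k := by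
      intro k
      induction k with
      | zero => simp
      | succ k ih => rw [pow_succ', mul_assoc, ih, pow_succ']; simp only [mul_assoc]
    simp only [Function.comp_apply, MulAut.conj_apply, h1]
    rw [h2 (k + 1), pow_succ]
    group

theorem map_conj_chainList (v a b : W) (m : ℕ) :
    (chainList a b m).map (MulAut.conj v) = chainList (v * a * v⁻¹) (v * b * v⁻¹) m := by
  rw [chainList, List.map_map, chainList]
  refine List.map_congr_left fun k _ => ?_
  simp only [Function.comp_apply, ← MulAut.conj_apply, ← map_mul, ← map_pow]

/-- The chain starts with the first letter of the word, which the parity of m determines, as the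
last letter is j. -/
theorem leftInvSeq_alternatingWord (i j : B) (m : ℕ) :
    cs.leftInvSeq (alternatingWord i j m) = if Even m then
      chainList (cs.simple i) (cs.simple j) m else chainList (cs.simple j) (cs.simple i) m := by
  induction m with
  | zero => simp [alternatingWord, chainList]
  | succ m ih =>
    rw [alternatingWord_succ', leftInvSeq, ih]
    by_cases h : Even m
    · have h' : ¬ Even (m + 1) := by simpa [Nat.even_add_one] using h
      simp only [h, h', if_true, if_false]
      rw [chainList_succ (cs.simple_mul_simple_self j)]
    · have h' : Even (m + 1) := by simpa [Nat.even_add_one] using h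
      simp only [h, h', if_true, if_false]
      rw [chainList_succ (cs.simple_mul_simple_self i)]

theorem leftInvSeq_append (ω ω' : List B) : cs.leftInvSeq (ω ++ ω') =
    cs.leftInvSeq ω ++ (cs.leftInvSeq ω').map (MulAut.conj (cs.wordProd ω)) := by
  induction ω with
  | nil => simp
  | cons i ω ih =>
    rw [List.cons_append, leftInvSeq, ih, leftInvSeq, List.map_append, List.map_map, wordProd_cons,
      List.cons_append]
    congr 3
    ext t
    simp [MulAut.conj_apply, mul_assoc]

end CoxeterSystem

namespace RootBasis

open CoxeterSystem

variable {B : Type*} {M : CoxeterMatrix B} {E : Type*} [AddCommGroup E] [Module ℝ E]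
  {D : RootBasis M E} {W : Type*} [Group W] {cs : CoxeterSystem M W} {H : Subgroup W} {a b : W}

/-- Absence of repetitions forces ab to have order exactly m, so the chain lists each reflection of
H once, and starting from b lists them in the opposite order. -/
theorem IsDihedral.encard_sublist_chainList_le (h : D.IsDihedral cs H a b) {u : W}
    {P : Set (List W)} (hP : cs.IsFlipClosed u P) {L₁ L₃ : List W} {m : ℕ} (hm : 0 < m)
    (hab : (a * b) ^ m = 1) (hnodup : (L₁ ++ (chainList a b m ++ L₃)).Nodup) :
    {l | l ∈ P ∧ l.Sublist (L₁ ++ (chainList a b m ++ L₃))}.encard ≤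
      {l | l ∈ P ∧ l.Sublist (L₁ ++ (chainList b a m ++ L₃))}.encard := by
  have ha := h.left.1
  have hb := h.right.1
  have hpos : 0 < orderOf (a * b) := orderOf_pos_iff.mpr (isOfFinOrder_iff_pow_eq_one.mpr ⟨m, hm, hab⟩)
  have hord : orderOf (a * b) = m := by
    refine le_antisymm (orderOf_le_of_pow_eq_one hm hab) ?_
    by_contra! hlt
    have h1 : (chainList a b m).Nodup := hnodup.sublist
      ((List.sublist_append_left _ _).trans (List.sublist_append_right _ _))
    rw [chainList, List.nodup_map_iff_inj_on List.nodup_range] at h1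
    have h2 := h1 0 (by simpa using hm) _ (by simpa using hlt) (by simp [pow_orderOf_eq_one])
    omega
  have hord' : orderOf (b * a) = m := by
    rw [← hord, ← orderOf_inv, mul_inv_rev, ha.inv, hb.inv]
  have hmem : ∀ {a b : W}, D.IsDihedral cs H a b → orderOf (a * b) = m → ∀ t,
      t ∈ chainList a b m ↔ cs.IsReflection t ∧ t ∈ H := by
    intro a b h hord t
    rw [chainList, List.mem_map]
    constructor
    · rintro ⟨k, -, rfl⟩
      refine ⟨(h.left.1.chain h.right.1 k).1, ?_⟩
      exact mul_mem (pow_mem (mul_mem h.left.2.1 h.right.2.1) _) h.left.2.1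
    · rintro ⟨ht, htH⟩
      rw [← h.closure_eq] at htH
      rcases exists_chain_lt h.left.1 h.right.1 ht htH with ⟨k, hk, rfl⟩ | ⟨h0, -⟩
      · exact ⟨k, by simp only [List.mem_range]; omega, rfl⟩
      · omega
  have hpw : ∀ {a b : W}, D.IsDihedral cs H a b → orderOf (a * b) = m →
      (chainList a b m).Pairwise (D.DetLT cs a b) := by
    intro a b h hord
    rw [chainList, List.pairwise_map, List.pairwise_iff_getElem]
    intro i j hi hj hij
    simp only [List.getElem_range]
    simp only [List.length_range] at hj
    exact (detLT_chain h.left h.right h.ne hij (by omega)).1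
  refine h.encard_sublist_le hP hnodup (fun t ht => (hmem h hord t).mp ht) (fun t => ?_)
    (fun t htH ht => (hmem h hord t).mpr ⟨ht, htH⟩) (hpw h hord) (hpw h.symm hord')
  rw [hmem h hord, hmem h.symm hord']

/-- By Matsumoto's theorem it suffices to treat a braid move, which only reverses one block of the
inversion sequence: the chain of a dihedral subgroup conjugated by the prefix. The prefix has
neither descent, so it keeps both simple roots positive. An inequality for every move is enough,
since moves are reversible. -/
theorem encard_sublist_leftInvSeq (D : RootBasis M E) {u : W} {P : Set (List W)}
    (hP : cs.IsFlipClosed u P) {ω ω' : List B} (h : cs.wordProd ω = cs.wordProd ω')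
    (hω : cs.IsReduced ω) (hω' : cs.IsReduced ω') :
    {l | l ∈ P ∧ l.Sublist (cs.leftInvSeq ω)}.encard =
      {l | l ∈ P ∧ l.Sublist (cs.leftInvSeq ω')}.encard := by
  have key := D.eq_of_wordProd_eq cs (τ := [])
    (fun ω => {l | l ∈ P ∧ l.Sublist (cs.leftInvSeq ω)}.encard) ?_ h (by simpa using hω)
    (by simpa using hω')
  · simpa using key
  have half : ∀ (ν τ : List B) (i j : B), i ≠ j → M i j ≠ 0 →
      cs.IsReduced (ν ++ alternatingWord i j (M i j) ++ τ) →
      ¬ cs.IsRightDescent (cs.wordProd ν) i → ¬ cs.IsRightDescent (cs.wordProd ν) j →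
      {l | l ∈ P ∧ l.Sublist (cs.leftInvSeq (ν ++ alternatingWord i j (M i j) ++ τ))}.encard ≤
      {l | l ∈ P ∧ l.Sublist (cs.leftInvSeq (ν ++ alternatingWord j i (M i j) ++ τ))}.encard := by
    intro ν τ i j hij hM hred hi hj
    have hbraid : cs.wordProd (alternatingWord i j (M i j)) =
        cs.wordProd (alternatingWord j i (M i j)) := by
      rw [cs.prod_alternatingWord_eq_prod_alternatingWord_sub i j _ (by omega)]
      congr 2; omega
    have hnodup := hred.nodup_leftInvSeq
    rw [leftInvSeq_append, leftInvSeq_append] at hnodup ⊢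
    rw [leftInvSeq_append, leftInvSeq_append, wordProd_append _ ν (alternatingWord j i _), ← hbraid,
      ← wordProd_append]
    rw [leftInvSeq_alternatingWord, leftInvSeq_alternatingWord] at *
    have hne : cs.simple i ≠ cs.simple j := by
      intro h1
      have h2 := D.form_root_root_nonpos hij
      rw [← D.rootOf_simple (cs := cs) i, h1, D.rootOf_simple, D.form_root_self] at h2
      linarith
    obtain ⟨H, hH⟩ := D.exists_isDihedral_simple cs hne
    obtain ⟨K, hK⟩ := hH.conj (v := cs.wordProd ν)
      (by rw [rootOf_simple]; exact D.action_root_mem_cone cs hi)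
      (by rw [rootOf_simple]; exact D.action_root_mem_cone cs hj)
    have hpow : ∀ i j : B, (cs.wordProd ν * cs.simple i * (cs.wordProd ν)⁻¹ *
        (cs.wordProd ν * cs.simple j * (cs.wordProd ν)⁻¹)) ^ M i j = 1 := by
      intro i j
      simp only [← MulAut.conj_apply, ← map_mul, ← map_pow]
      rw [cs.simple_mul_simple_pow, map_one]
    by_cases he : Even (M i j)
    · simp only [he, if_true, map_conj_chainList, List.append_assoc] at hnodup ⊢
      exact hK.encard_sublist_chainList_le hP (Nat.pos_of_ne_zero hM) (hpow i j) hnodup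
    · simp only [he, if_false, map_conj_chainList, List.append_assoc] at hnodup ⊢
      refine hK.symm.encard_sublist_chainList_le hP (Nat.pos_of_ne_zero hM) ?_ hnodup
      rw [M.symmetric]; exact hpow j i
  intro ν τ i j hij hM hred hi hj
  refine le_antisymm (half ν τ i j hij hM hred hi hj) ?_
  have hbraid : cs.wordProd (alternatingWord i j (M i j)) =
      cs.wordProd (alternatingWord j i (M i j)) := by
    rw [cs.prod_alternatingWord_eq_prod_alternatingWord_sub i j _ (by omega)]
    congr 2; omega
  have := half ν τ j i hij.symm (by rwa [M.symmetric]) (by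
    rw [M.symmetric j i]
    rw [CoxeterSystem.IsReduced, wordProd_append, wordProd_append] at hred ⊢
    rw [← hbraid, hred]
    simp) hj hi
  rwa [M.symmetric j i] at this

end RootBasis

/-! ### Reflection orderings of finite Coxeter groups -/

namespace RootBasis

open CoxeterSystem

variable {B : Type*} {M : CoxeterMatrix B} {E : Type*} [AddCommGroup E] [Module ℝ E]
  {D : RootBasis M E} {W : Type*} [Group W] {cs : CoxeterSystem M W}

/-- If the inversions of `w` form an initial segment of a reflection ordering, then the next
reflection is the conjugate of a simple reflection by `w`. -/
theorem exists_eq_conj_simple (D : RootBasis M E) {r : W → W → Prop}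
    (hr : cs.IsReflectionOrdering r) {w t : W} (ht : cs.IsReflection t)
    (hw : ∀ s, cs.IsReflection s →
      (cs.length (s * w) < cs.length w ↔ r s t ∧ s ≠ t)) :
    ∃ i, t = w * cs.simple i * w⁻¹ := by
  have hconj : cs.IsReflection (w⁻¹ * t * w) := by simpa using ht.conj w⁻¹
  by_contra! hc
  obtain ⟨i, -, hpos⟩ := exists_simple_conj_lt (D := D) hconj (fun i h => hc i (by rw [← h]; group))
  set t' := w⁻¹ * t * w with ht'
  have hi := cs.isReflection_simple i
  have htc : w * t' * w⁻¹ = t := by rw [ht']; group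
  have hne : t' ≠ cs.simple i := fun h => hc i (by rw [← h, htc])
  have hδ := D.action_simple_rootOf_mem_cone hconj hne
  have hs' : cs.IsReflection (cs.simple i * t' * (cs.simple i)⁻¹) := hconj.conj _
  set s' := cs.simple i * t' * (cs.simple i)⁻¹ with hs'def
  have hδ' := D.action_rootOf_of_mem_cone hconj hδ
  rw [← hs'def] at hδ'
  have hdec : D.rootOf cs t' = D.rootOf cs s' +
      D.form (D.root i) (D.rootOf cs t') • D.rootOf cs (cs.simple i) := by
    rw [← hδ', action_simple_apply, rootOf_simple]
    module
  have hinv : ∀ s, cs.IsReflection s → (D.action cs w⁻¹ (D.rootOf cs s) ∈ D.cone ↔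
      ¬ (r s t ∧ s ≠ t)) := by
    intro s hs
    rw [← hw s hs, ← D.length_lt_reflection_mul_iff hs]
    have := hs.length_mul_right_ne w
    omega
  have hγ : D.action cs w (D.rootOf cs t') = D.rootOf cs t := by
    have h1 : D.action cs w⁻¹ (D.rootOf cs t) ∈ D.cone := (hinv t ht).mpr (fun h => h.2 rfl)
    have h2 := D.action_rootOf_of_mem_cone ht h1
    rw [inv_inv] at h2
    rw [ht', ← h2, action_action_inv]
  have sign : ∀ s, cs.IsReflection s →
      (D.action cs w (D.rootOf cs s) = D.rootOf cs (w * s * w⁻¹) ∧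
        ¬ (r (w * s * w⁻¹) t ∧ w * s * w⁻¹ ≠ t)) ∨
      (D.action cs w (D.rootOf cs s) = -D.rootOf cs (w * s * w⁻¹) ∧
        (r (w * s * w⁻¹) t ∧ w * s * w⁻¹ ≠ t)) := by
    intro s hs
    have h1 := hinv _ (hs.conj w)
    rcases D.action_rootOf_eq_or w hs with h | h
    · refine Or.inl ⟨h, h1.mp ?_⟩
      rw [← h, action_inv_action]
      exact D.rootOf_mem_cone hs
    · refine Or.inr ⟨h, ?_⟩
      by_contra hn
      have h2 := h1.mpr hn
      rw [← neg_eq_iff_eq_neg] at h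
      rw [← h, map_neg, action_inv_action] at h2
      exact D.rootOf_ne_zero hs (D.eq_zero_of_mem_cone (D.rootOf_mem_cone hs) h2)
  have hdec' : D.rootOf cs t = D.action cs w (D.rootOf cs s') +
      D.form (D.root i) (D.rootOf cs t') • D.action cs w (D.rootOf cs (cs.simple i)) := by
    rw [← hγ, ← map_smul, ← map_add, ← hdec]
  set c := D.form (D.root i) (D.rootOf cs t') with hcdef
  have hne1 : s' ≠ cs.simple i := by
    intro h
    apply hne
    have h1 : t' = (cs.simple i)⁻¹ * s' * cs.simple i := by rw [hs'def]; group
    rw [h1, h]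
    group
  have hs1 := hs'.conj w
  have hi1 := hi.conj w
  have hne2 : w * s' * w⁻¹ ≠ w * cs.simple i * w⁻¹ := fun h => hne1 (by simpa using h)
  have hst : w * s' * w⁻¹ ≠ t := by
    intro h
    have h1 : s' = t' := by rw [← htc] at h; simpa using h
    rw [h1] at hdec
    have h2 : c • D.rootOf cs (cs.simple i) = 0 := by simpa using hdec
    rcases smul_eq_zero.mp h2 with h3 | h3
    · exact hpos.ne' h3
    · exact D.rootOf_ne_zero hi h3
  have hit : w * cs.simple i * w⁻¹ ≠ t := fun h => hc i h.symm
  -- Both positive: t lies between two reflections that do not precede it. One negative: a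
  -- reflection that does not precede t lies between t and one that does. Both negative: the root of
  -- t would be negative.
  rcases sign s' hs' with ⟨e1, n1⟩ | ⟨e1, n1⟩ <;>
  rcases sign _ hi with ⟨e2, n2⟩ | ⟨e2, n2⟩ <;> rw [e1, e2] at hdec'
  · rcases between_of_isReflectionOrdering hr ht hs1 hi1 hne2 one_pos hpos
      (by rw [one_smul]; exact hdec') with h | h
    · exact n1 ⟨h.1, hst⟩
    · exact n2 ⟨h.1, hit⟩
  · rcases between_of_isReflectionOrdering hr hs1 ht hi1 hit.symm one_pos hpos
      (by rw [one_smul, hdec']; module) with h | h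
    · exact n2.2 (hr.antisymm _ _ hi1 ht n2.1 (hr.trans _ _ _ ht hs1 hi1 h.1 h.2))
    · exact n1 ⟨h.2, hst⟩
  · have hcinv : (0 : ℝ) < c⁻¹ := inv_pos.mpr hpos
    rcases between_of_isReflectionOrdering hr hi1 ht hs1 hst.symm hcinv hcinv
      (by
        rw [hdec', smul_add, smul_smul, inv_mul_cancel₀ hpos.ne', one_smul]
        module) with h | h
    · exact n1.2 (hr.antisymm _ _ hs1 ht n1.1 (hr.trans _ _ _ ht hi1 hs1 h.1 h.2))
    · exact n2 ⟨h.2, hit⟩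
  · refine D.rootOf_ne_zero ht (D.eq_zero_of_mem_cone (D.rootOf_mem_cone ht) ?_)
    rw [hdec', smul_neg, ← neg_add, neg_neg]
    exact add_mem (D.rootOf_mem_cone hs1) (D.smul_mem_cone hpos.le (D.rootOf_mem_cone hi1))

/-- Every initial segment of the ordering is the inversion sequence of a reduced word, and the next
reflection appends one letter to that word. -/
theorem exists_leftInvSeq_eq (D : RootBasis M E) {r : W → W → Prop}
    (hr : cs.IsReflectionOrdering r) {R : List W} (hR : ∀ t, t ∈ R ↔ cs.IsReflection t)
    (hn : R.Nodup) (hpw : R.Pairwise r) : ∃ ω, cs.IsReduced ω ∧ cs.leftInvSeq ω = R := by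
  suffices h : ∀ R₁ R₂, R = R₁ ++ R₂ → ∃ ω, cs.IsReduced ω ∧ cs.leftInvSeq ω = R₁ from
    h R [] (by simp)
  intro R₁
  induction R₁ using List.reverseRecOn with
  | nil => exact fun R₂ _ => ⟨[], by simp [CoxeterSystem.IsReduced], rfl⟩
  | append_singleton R₁ t ih =>
    intro R₂ hR₂
    rw [List.append_assoc, List.singleton_append] at hR₂
    obtain ⟨ω, hω, hlis⟩ := ih _ hR₂
    have ht : cs.IsReflection t := (hR t).mp (by rw [hR₂]; simp)
    rw [hR₂, List.pairwise_append, List.pairwise_cons] at hpw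
    rw [hR₂, List.nodup_append, List.nodup_cons] at hn
    have hinv : ∀ s, cs.IsReflection s →
        (cs.length (s * cs.wordProd ω) < cs.length (cs.wordProd ω) ↔ r s t ∧ s ≠ t) := by
      intro s hs
      rw [← D.mem_leftInvSeq_iff hω hs, hlis]
      constructor
      · exact fun h => ⟨hpw.2.2 s h t (by simp), hn.2.2 s h t (by simp)⟩
      · rintro ⟨h1, h2⟩
        have h3 := (hR s).mpr hs
        rw [hR₂, List.mem_append, List.mem_cons] at h3
        rcases h3 with h3 | h3 | h3
        · exact h3
        · exact absurd h3 h2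
        · exact absurd (hr.antisymm s t hs ht h1 (hpw.2.1.1 s h3)) h2
    obtain ⟨i, hi⟩ := D.exists_eq_conj_simple hr ht hinv
    refine ⟨ω ++ [i], ?_, ?_⟩
    · have h1 : cs.wordProd (ω ++ [i]) = t * cs.wordProd ω := by
        rw [wordProd_append, wordProd_singleton, hi]; group
      have h2 : ¬ cs.length (t * cs.wordProd ω) < cs.length (cs.wordProd ω) := fun h =>
        ((hinv t ht).mp h).2 rfl
      have h3 := cs.length_wordProd_le (ω ++ [i])
      have h4 := ht.length_mul_right_ne (cs.wordProd ω)
      have h5 := hω.eq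
      rw [CoxeterSystem.IsReduced]
      rw [h1] at h3 ⊢
      simp only [List.length_append, List.length_singleton] at h3 ⊢
      omega
    · rw [leftInvSeq_append, hlis, leftInvSeq_singleton, hi]
      simp

end RootBasis

/-! ### Increasing paths as sublists of the sorted reflections -/

namespace CoxeterSystem

variable {B : Type*} {M : CoxeterMatrix B} {W : Type*} [Group W] {cs : CoxeterSystem M W}

theorem exists_sorted_reflections [Finite W] {r : W → W → Prop} (hr : cs.IsReflectionOrdering r) :
    ∃ R : List W, (∀ t, t ∈ R ↔ cs.IsReflection t) ∧ R.Nodup ∧ R.Pairwise r := by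
  classical
  let T := {t // cs.IsReflection t}
  have : Fintype T := Fintype.ofFinite T
  let r' : T → T → Prop := fun s t => r s t
  have : Std.Total r' := ⟨fun s t => hr.total s t s.2 t.2⟩
  have : IsTrans T r' := ⟨fun s t w => hr.trans s t w s.2 t.2 w.2⟩
  have hp := List.perm_insertionSort r' (Finset.univ : Finset T).toList
  refine ⟨((Finset.univ : Finset T).toList.insertionSort r').map Subtype.val, fun t => ?_, ?_, ?_⟩
  · rw [List.mem_map]
    refine ⟨?_, fun ht => ⟨⟨t, ht⟩, hp.mem_iff.mpr (by simp), rfl⟩⟩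
    rintro ⟨s, -, rfl⟩
    exact s.2
  · exact (hp.nodup_iff.mpr (Finset.nodup_toList _)).map Subtype.val_injective
  · rw [List.pairwise_map]
    exact List.pairwise_insertionSort r' _

theorem isReflection_pathLabel {h : ℕ} {u v : W} {x : Fin (h + 1) → W}
    (hx : x ∈ cs.bruhatPaths h u v) (i : Fin h) : cs.IsReflection (pathLabel x i) :=
  (hx.2.2 i).2

theorem endpoint_take_pathLabel {h : ℕ} (x : Fin (h + 1) → W) (k : ℕ) (hk : k < h + 1) :
    endpoint (x 0) ((List.ofFn (pathLabel x)).take k) = x ⟨k, hk⟩ := by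
  induction k with
  | zero => rfl
  | succ k ih =>
    have h1 : (List.ofFn (pathLabel x)).take (k + 1) =
        (List.ofFn (pathLabel x)).take k ++ [pathLabel x ⟨k, by omega⟩] := by
      rw [List.take_add_one, List.getElem?_ofFn]
      simp [show k < h by omega]
    rw [h1, endpoint_append, ih (by omega)]
    simp [pathLabel]

theorem pathLabel_injective {h : ℕ} {x y : Fin (h + 1) → W} (h₀ : x 0 = y 0)
    (hxy : pathLabel x = pathLabel y) : x = y := by
  funext ⟨k, hk⟩
  rw [← endpoint_take_pathLabel x, ← endpoint_take_pathLabel y, hxy, h₀]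

theorem isLabelPath_of_forall {h : ℕ} {x : Fin (h + 1) → W}
    (hx : ∀ i : Fin h, cs.BruhatEdge (x i.castSucc) (x i.succ)) :
    cs.IsLabelPath (x 0) (List.ofFn (pathLabel x)) := by
  induction h with
  | zero => simp [IsLabelPath]
  | succ h ih =>
    rw [List.ofFn_succ]
    have h1 : pathLabel x 0 * x 0 = x 1 := by simp [pathLabel]
    refine ⟨?_, ?_⟩
    · rw [h1]; exact hx 0
    · rw [h1]
      exact ih (x := fun i => x i.succ) fun i => hx i.succ

theorem pathLabel_flip {h : ℕ} {x : Fin (h + 1) → W} {l₁ l₂ : List W} {t t' : W}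
    (hx : List.ofFn (pathLabel x) = l₁ ++ t :: t' :: l₂) :
    ∃ hi : l₁.length + 1 < h, ∀ w m, w = endpoint (x 0) l₁ →
      m = cs.flipMiddle w (t' * (t * w)) (t * w) →
      List.ofFn (pathLabel (cs.flip l₁.length hi x)) =
        l₁ ++ (m * w⁻¹) :: (t' * (t * w) * m⁻¹) :: l₂ := by
  have hlen : h = l₁.length + (l₂.length + 1 + 1) := by
    have := congrArg List.length hx
    simpa using this
  have hi : l₁.length + 1 < h := by omega
  refine ⟨hi, ?_⟩
  rintro w m hw hm
  have hlab : ∀ (k : ℕ) (hk : k < h), pathLabel x ⟨k, hk⟩ =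
      (l₁ ++ t :: t' :: l₂)[k]'(by simp; omega) := by
    intro k hk
    simp only [← hx, List.getElem_ofFn]
  have e0 : x ⟨l₁.length, by omega⟩ = w := by
    rw [← endpoint_take_pathLabel x, hx, hw]; simp
  have e1 : x ⟨l₁.length + 1, by omega⟩ = t * w := by
    have h1 := hlab l₁.length (by omega)
    rw [List.getElem_append_right (le_refl _)] at h1
    simp only [pathLabel, Nat.sub_self, List.getElem_cons_zero, Fin.succ_mk, Fin.castSucc_mk] at h1
    rw [e0] at h1
    rw [← h1]; group
  have e2 : x ⟨l₁.length + 2, by omega⟩ = t' * (t * w) := by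
    have h1 := hlab (l₁.length + 1) (by omega)
    rw [List.getElem_append_right (by omega)] at h1
    simp only [pathLabel, Nat.add_sub_cancel_left, List.getElem_cons_succ, List.getElem_cons_zero,
      Fin.succ_mk, Fin.castSucc_mk] at h1
    rw [e1] at h1
    rw [← h1]; group
  have hflip : cs.flip l₁.length hi x = Function.update x ⟨l₁.length + 1, by omega⟩ m := by
    rw [flip, e0, e1, e2, hm]
  rw [hflip]
  refine List.ext_getElem (by simp; omega) fun k hk hk' => ?_
  have hkh : k < h := by simpa using hk
  rw [List.getElem_ofFn]
  simp only [pathLabel, Fin.succ_mk, Fin.castSucc_mk, Function.update_apply, Fin.mk.injEq]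
  rcases lt_trichotomy k l₁.length with hlt | rfl | hgt
  · rw [if_neg (by omega), if_neg (by omega), List.getElem_append_left hlt]
    have h1 := hlab k hkh
    rw [List.getElem_append_left hlt] at h1
    exact h1
  · rw [if_pos rfl, if_neg (by omega), e0, List.getElem_append_right (le_refl _)]
    simp
  · obtain ⟨j, rfl⟩ := Nat.exists_eq_add_of_lt hgt
    rw [List.getElem_append_right (by omega)]
    rcases j with _ | j
    · rw [if_neg (by omega), if_pos rfl, e2]
      simp
    · rw [if_neg (by omega), if_neg (by omega)]
      have h1 := hlab _ hkh
      rw [List.getElem_append_right (by omega)] at h1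
      have e3 : l₁.length + (j + 1) + 1 - l₁.length = j + 1 + 1 := by omega
      simp only [e3, List.getElem_cons_succ] at h1 ⊢
      exact h1

theorem isFlipClosed_image {h : ℕ} {u v : W} {F : Set (Fin (h + 1) → W)}
    (hF : F ⊆ cs.bruhatPaths h u v) (hflip : ∀ x ∈ F, ∀ (i : ℕ) (hi : i + 1 < h), cs.flip i hi x ∈ F) :
    cs.IsFlipClosed u ((fun x => List.ofFn (pathLabel x)) '' F) := by
  constructor
  · rintro _ ⟨x, hx, rfl⟩
    have h1 := hF hx
    rw [← h1.1]
    exact isLabelPath_of_forall h1.2.2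
  · rintro l₁ t t' l₂ ⟨x, hx, hl⟩ w m hw hm
    obtain ⟨hi, h1⟩ := pathLabel_flip (cs := cs) hl
    exact ⟨_, hflip x hx _ hi, h1 w m (by rw [hw, (hF hx).1]) hm⟩

theorem isIncreasing_iff_sublist {h : ℕ} {u v : W} {x : Fin (h + 1) → W}
    (hx : x ∈ cs.bruhatPaths h u v) {r : W → W → Prop} (hr : cs.IsReflectionOrdering r)
    {R : List W} (hR : ∀ t, t ∈ R ↔ cs.IsReflection t) (hpw : R.Pairwise r) :
    IsIncreasing r x ↔ (List.ofFn (pathLabel x)).Sublist R := by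
  have href := isReflection_pathLabel hx
  constructor
  · intro hinc
    -- Equal consecutive labels would lead back to the starting vertex. So weakly increasing labels
    -- are strictly increasing, and the label list has no repetitions.
    have hadj : ∀ (k : ℕ) (hk : k + 1 < h),
        pathLabel x ⟨k, by omega⟩ ≠ pathLabel x ⟨k + 1, hk⟩ := by
      intro k hk heq
      have h1 := (hx.2.2 ⟨k, by omega⟩).1.trans (hx.2.2 ⟨k + 1, hk⟩).1
      have h2 : x ⟨k + 1 + 1, by omega⟩ = x ⟨k, by omega⟩ := by
        have e1 : x ⟨k + 1 + 1, by omega⟩ = pathLabel x ⟨k + 1, hk⟩ *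
            (pathLabel x ⟨k, by omega⟩ * x ⟨k, by omega⟩) := by
          simp [pathLabel]
        rw [e1, ← heq, ← mul_assoc, (href _).mul_self, one_mul]
      simp only [Fin.succ_mk, Fin.castSucc_mk] at h1
      rw [h2] at h1
      exact lt_irrefl _ h1
    have hnodup : (List.ofFn (pathLabel x)).Nodup := by
      rw [List.nodup_ofFn]
      intro i j hij
      by_contra hne
      wlog hlt : i < j generalizing i j
      · exact this hij.symm (Ne.symm hne) (lt_of_le_of_ne (not_lt.mp hlt) (Ne.symm hne))
      have hk : (i : ℕ) + 1 < h := by have := j.2; omega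
      apply hadj i hk
      have h1 : r (pathLabel x i) (pathLabel x ⟨i + 1, hk⟩) := hinc _ _ (by simp [Fin.lt_def])
      refine hr.antisymm _ _ (href _) (href _) h1 ?_
      rcases eq_or_lt_of_le (show (⟨i + 1, hk⟩ : Fin h) ≤ j from hlt) with h2 | h2
      · rw [h2, ← hij]
        exact hr.refl _ (href _)
      · have h3 := hinc _ _ h2
        rwa [← hij] at h3
    let r' : W → W → Prop := fun s t => cs.IsReflection s ∧ cs.IsReflection t ∧ r s t
    have : Std.Antisymm r' := ⟨fun s t h1 h2 => hr.antisymm s t h1.1 h1.2.1 h1.2.2 h2.2.2⟩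
    refine List.sublist_of_subperm_of_pairwise (r := r') (hnodup.subperm ?_) ?_ ?_
    · intro t ht
      rw [List.mem_ofFn] at ht
      obtain ⟨i, rfl⟩ := ht
      exact (hR _).mpr (href i)
    · rw [List.pairwise_ofFn]
      exact fun i j hij => ⟨href i, href j, hinc i j hij⟩
    · exact hpw.imp_of_mem fun hs ht h => ⟨(hR _).mp hs, (hR _).mp ht, h⟩
  · intro hsub
    have h1 := hpw.sublist hsub
    rw [List.pairwise_ofFn] at h1
    exact fun i j hij => h1 hij

/-- In a finite Coxeter group, the number of increasing paths in a set of paths closed under all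
flips does not depend on the reflection ordering. -/
theorem encard_isIncreasing_eq [Finite W] {h : ℕ} {u v : W} {F : Set (Fin (h + 1) → W)}
    (hF : F ⊆ cs.bruhatPaths h u v)
    (hflip : ∀ x ∈ F, ∀ (i : ℕ) (hi : i + 1 < h), cs.flip i hi x ∈ F)
    {r r' : W → W → Prop} (hr : cs.IsReflectionOrdering r) (hr' : cs.IsReflectionOrdering r') :
    {x | x ∈ F ∧ IsIncreasing r x}.encard = {x | x ∈ F ∧ IsIncreasing r' x}.encard := by
  set D := M.standardRootBasis
  have key : ∀ r : W → W → Prop, cs.IsReflectionOrdering r → ∃ ω, cs.IsReduced ω ∧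
      (∀ t, cs.IsReflection t →
        cs.length (t * cs.wordProd ω) < cs.length (cs.wordProd ω)) ∧
      {x | x ∈ F ∧ IsIncreasing r x}.encard =
        {l | l ∈ (fun x => List.ofFn (pathLabel x)) '' F ∧
          l.Sublist (cs.leftInvSeq ω)}.encard := by
    intro r hr
    obtain ⟨R, hR, hn, hpw⟩ := exists_sorted_reflections hr
    obtain ⟨ω, hω, hlis⟩ := D.exists_leftInvSeq_eq hr hR hn hpw
    refine ⟨ω, hω, fun t ht => ?_, ?_⟩
    · rw [← D.mem_leftInvSeq_iff hω ht, hlis]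
      exact (hR t).mpr ht
    · rw [hlis]
      have hset : {l | l ∈ (fun x => List.ofFn (pathLabel x)) '' F ∧ l.Sublist R} =
          (fun x => List.ofFn (pathLabel x)) '' {x | x ∈ F ∧ IsIncreasing r x} := by
        ext l
        constructor
        · rintro ⟨⟨x, hx, rfl⟩, hl⟩
          exact ⟨x, ⟨hx, (isIncreasing_iff_sublist (hF hx) hr hR hpw).mpr hl⟩, rfl⟩
        · rintro ⟨x, ⟨hx, hinc⟩, rfl⟩
          exact ⟨⟨x, hx, rfl⟩, (isIncreasing_iff_sublist (hF hx) hr hR hpw).mp hinc⟩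
      rw [hset, Set.InjOn.encard_image]
      intro x hx y hy hxy
      exact pathLabel_injective ((hF hx.1).1.trans (hF hy.1).1.symm) (List.ofFn_injective hxy)
  obtain ⟨ω, hω, h1, h2⟩ := key r hr
  obtain ⟨ω', hω', h1', h2'⟩ := key r' hr'
  rw [h2, h2']
  refine D.encard_sublist_leftInvSeq (isFlipClosed_image hF hflip) ?_ hω hω'
  -- Both words invert every reflection, so both represent the longest element.
  exact D.eq_of_forall_length_lt_iff fun t ht => iff_of_true (h1 t ht) (h1' t ht)

end CoxeterSystem

/-! ### Flipclasses -/

namespace CoxeterSystem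

variable {B : Type*} {M : CoxeterMatrix B} {W : Type*} [Group W] {cs : CoxeterSystem M W}
  {h : ℕ} {F : Set (Fin (h + 1) → W)}

theorem IsFlipclass.nonempty (hF : cs.IsFlipclass F) : F.Nonempty := by
  obtain ⟨u, v, hmin⟩ := hF
  exact hmin.1.1

theorem IsFlipclass.flip_mem (hF : cs.IsFlipclass F) {x : Fin (h + 1) → W} (hx : x ∈ F) (i : ℕ)
    (hi : i + 1 < h) : cs.flip i hi x ∈ F := by
  obtain ⟨u, v, hmin⟩ := hF
  exact hmin.1.2.2 x hx i hi

theorem IsFlipclass.exists_subset (hF : cs.IsFlipclass F) : ∃ u v, F ⊆ cs.bruhatPaths h u v := by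
  obtain ⟨u, v, hmin⟩ := hF
  exact ⟨u, v, hmin.1.2.1⟩

theorem IsFlipclass.bruhatEdge (hF : cs.IsFlipclass F) {x : Fin (h + 1) → W} (hx : x ∈ F)
    (i : Fin h) : cs.BruhatEdge (x i.castSucc) (x i.succ) := by
  obtain ⟨u, v, hsub⟩ := hF.exists_subset
  exact (hsub hx).2.2 i

theorem IsFlipclass.isReflection (hF : cs.IsFlipclass F) {t : W} (ht : t ∈ labelSet F) :
    cs.IsReflection t := by
  obtain ⟨x, hx, i, rfl⟩ := ht
  exact (hF.bruhatEdge hx i).2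

/-- The paths of F with the property form a nonempty subset closed under flips, which is all of F by
minimality. -/
theorem IsFlipclass.induction (hF : cs.IsFlipclass F) {p : (Fin (h + 1) → W) → Prop}
    (h₁ : ∃ x ∈ F, p x)
    (h₂ : ∀ x ∈ F, p x → ∀ (i : ℕ) (hi : i + 1 < h), p (cs.flip i hi x)) : ∀ x ∈ F, p x := by
  obtain ⟨u, v, hmin⟩ := hF
  have h3 := hmin.2 (y := {x | x ∈ F ∧ p x}) ⟨h₁, fun x hx => hmin.1.2.1 hx.1,
    fun x hx i hi => ⟨hmin.1.2.2 x hx.1 i hi, h₂ x hx.1 hx.2 i hi⟩⟩ (fun x hx => hx.1)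
  exact fun x hx => (h3 hx).2

theorem IsFlipclass.isReflectionSubgroup (hF : cs.IsFlipclass F) :
    cs.IsReflectionSubgroup (labelSubgroup F) := by
  apply le_antisymm
  · rw [Subgroup.closure_le]
    exact fun t ht => ht.1
  · exact Subgroup.closure_mono fun t ht => ⟨Subgroup.subset_closure ht, hF.isReflection ht⟩

theorem flip_apply_of_ne {i : ℕ} (hi : i + 1 < h) (x : Fin (h + 1) → W) {k : Fin (h + 1)}
    (hk : (k : ℕ) ≠ i + 1) : cs.flip i hi x k = x k := by
  rw [flip, Function.update_of_ne]
  exact fun h => hk (by rw [h])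

theorem pathLabel_flip_of_ne {i : ℕ} (hi : i + 1 < h) (x : Fin (h + 1) → W) {k : Fin h}
    (hk : (k : ℕ) ≠ i) (hk' : (k : ℕ) ≠ i + 1) :
    pathLabel (cs.flip i hi x) k = pathLabel x k := by
  rw [pathLabel, flip_apply_of_ne hi x (by simpa using hk), flip_apply_of_ne hi x (by simpa using hk')]
  rfl

theorem pathLabel_mul_pathLabel_flip {i : ℕ} (hi : i + 1 < h) (x : Fin (h + 1) → W) :
    pathLabel (cs.flip i hi x) ⟨i + 1, hi⟩ * pathLabel (cs.flip i hi x) ⟨i, by omega⟩ =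
      pathLabel x ⟨i + 1, hi⟩ * pathLabel x ⟨i, by omega⟩ := by
  have h1 : ∀ y : Fin (h + 1) → W, pathLabel y ⟨i + 1, hi⟩ * pathLabel y ⟨i, by omega⟩ =
      y ⟨i + 2, by omega⟩ * (y ⟨i, by omega⟩)⁻¹ := by
    intro y
    simp [pathLabel]
  rw [h1, h1, flip_apply_of_ne hi x (by simp), flip_apply_of_ne hi x (by simp)]

theorem pathLabel_succ_ne {x : Fin (h + 1) → W}
    (hx : ∀ i : Fin h, cs.BruhatEdge (x i.castSucc) (x i.succ)) {i : ℕ} (hi : i + 1 < h) :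
    pathLabel x ⟨i + 1, hi⟩ ≠ pathLabel x ⟨i, by omega⟩ := by
  intro heq
  have h1 := (hx ⟨i, by omega⟩).1.trans (hx ⟨i + 1, hi⟩).1
  have h2 : x ⟨i + 1 + 1, by omega⟩ = x ⟨i, by omega⟩ := by
    have e1 : x ⟨i + 1 + 1, by omega⟩ = pathLabel x ⟨i + 1, hi⟩ *
        (pathLabel x ⟨i, by omega⟩ * x ⟨i, by omega⟩) := by
      simp [pathLabel]
    rw [e1, heq, ← mul_assoc]
    have h3 : cs.IsReflection (pathLabel x ⟨i, by omega⟩) := (hx ⟨i, by omega⟩).2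
    rw [h3.mul_self, one_mul]
  simp only [Fin.succ_mk, Fin.castSucc_mk] at h1
  rw [h2] at h1
  exact lt_irrefl _ h1

theorem labelSet_map {W' : Type*} [Group W'] {F' : Set (Fin (h + 1) → W')} (φ : W' →* W)
    (hφ : labelSet F = φ '' labelSet F') (hpart : HasCommutingPartition (labelSet F')) :
    (hinj : Function.Injective φ) → HasCommutingPartition (labelSet F) := by
  intro hinj
  obtain ⟨X₁, X₂, h1, h2, h3, h4, h5⟩ := hpart
  refine ⟨φ '' X₁, φ '' X₂, h1.image _, h2.image _, (Set.disjoint_image_iff hinj).mpr h3, ?_, ?_⟩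
  · rw [← Set.image_union, h4, hφ]
  · rintro _ ⟨a, ha, rfl⟩ _ ⟨b, hb, rfl⟩
    rw [← map_mul, h5 a ha b hb, map_mul]

end CoxeterSystem

/-! ### The span of the label roots -/

namespace RootBasis

open CoxeterSystem

variable {B : Type*} {M : CoxeterMatrix B} {E : Type*} [AddCommGroup E] [Module ℝ E]
  (D : RootBasis M E) {W : Type*} [Group W] {cs : CoxeterSystem M W}
  {h : ℕ} {F : Set (Fin (h + 1) → W)}

/-- A flip replaces two consecutive labels by two with the same product, whose roots lie in the same
plane. -/
theorem rootOf_pathLabel_flip_mem (hF : cs.IsFlipclass F) {P : Submodule ℝ E}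
    {x : Fin (h + 1) → W} (hx : x ∈ F) (hP : ∀ k, D.rootOf cs (pathLabel x k) ∈ P) (i : ℕ)
    (hi : i + 1 < h) (k : Fin h) : D.rootOf cs (pathLabel (cs.flip i hi x) k) ∈ P := by
  have hy := hF.flip_mem hx i hi
  have hspan := D.rootOf_mem_span_of_mul_eq_mul (hF.bruhatEdge hx ⟨i + 1, hi⟩).2
    (hF.bruhatEdge hx ⟨i, by omega⟩).2 (hF.bruhatEdge hy ⟨i + 1, hi⟩).2
    (hF.bruhatEdge hy ⟨i, by omega⟩).2 (pathLabel_mul_pathLabel_flip hi x).symm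
    (pathLabel_succ_ne (hF.bruhatEdge hy) hi)
  have hle : Submodule.span ℝ {D.rootOf cs (pathLabel x ⟨i + 1, hi⟩),
      D.rootOf cs (pathLabel x ⟨i, by omega⟩)} ≤ P := by
    rw [Submodule.span_le]
    rintro _ (rfl | rfl)
    exacts [hP _, hP _]
  by_cases h1 : (k : ℕ) = i
  · have : k = ⟨i, by omega⟩ := Fin.ext h1
    rw [this]
    exact hle hspan.2
  by_cases h2 : (k : ℕ) = i + 1
  · have : k = ⟨i + 1, hi⟩ := Fin.ext h2
    rw [this]
    exact hle hspan.1
  rw [pathLabel_flip_of_ne hi x h1 h2]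
  exact hP k

theorem rootOf_mem_of_flipclass (hF : cs.IsFlipclass F) {P : Submodule ℝ E}
    {x : Fin (h + 1) → W} (hx : x ∈ F) (hP : ∀ k, D.rootOf cs (pathLabel x k) ∈ P) {t : W}
    (ht : cs.IsReflection t) (htF : t ∈ labelSubgroup F) : D.rootOf cs t ∈ P := by
  refine D.rootOf_mem_of_mem_closure (S := labelSet F) ?_ ht htF
  rintro s hs
  refine ⟨hF.isReflection hs, ?_⟩
  obtain ⟨y, hy, k, rfl⟩ := hs
  exact hF.induction (p := fun y => ∀ k, D.rootOf cs (pathLabel y k) ∈ P) ⟨x, hx, hP⟩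
    (fun y hy hyP i hi => D.rootOf_pathLabel_flip_mem hF hy hyP i hi) y hy k

theorem form_eq_zero_of_commute {i j : B} (hij : i ≠ j)
    (hc : cs.simple i * cs.simple j = cs.simple j * cs.simple i) :
    D.form (D.root i) (D.root j) = 0 := by
  have h1 := D.action_rootOf_eq_or (cs.simple i) (cs.isReflection_simple j)
  rw [hc, mul_inv_cancel_right, rootOf_simple, action_simple_apply] at h1
  have hnp := D.form_root_root_nonpos hij
  rcases h1 with h1 | h1
  · have h2 : D.form (D.root i) (D.root j) • D.root i = 0 := by simpa using h1
    exact (smul_eq_zero.mp h2).resolve_right (D.root_ne_zero i)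
  · exfalso
    have h2 : -D.root j = (-(D.form (D.root i) (D.root j)) / 2) • D.root i := by
      have h3 : D.form (D.root i) (D.root j) • D.root i = (2 : ℝ) • D.root j := by
        have h4 := sub_eq_iff_eq_add.mp h1
        rw [two_smul]
        nth_rewrite 2 [h4]
        abel
      rw [neg_div, neg_smul, div_eq_inv_mul, mul_smul, h3, smul_smul]
      norm_num
    refine D.root_ne_zero j (D.eq_zero_of_mem_cone (D.root_mem_cone j) ?_)
    rw [h2]
    exact D.smul_mem_cone (by linarith) (D.root_mem_cone i)

/-- Commuting simple reflections have orthogonal roots, so the two parts span orthogonal subspaces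
stable under the group, and each root lies in one of them. The labels split accordingly; neither
class is empty, since the labels generate the group, and orthogonal labels commute. -/
theorem hasCommutingPartition_labelSet (D : RootBasis M E) (hF : cs.IsFlipclass F) (htop : labelSubgroup F = ⊤)
    (hpart : HasCommutingPartition (Set.range cs.simple)) : HasCommutingPartition (labelSet F) := by
  obtain ⟨X₁, X₂, hX₁, hX₂, hdisj, hunion, hcomm⟩ := hpart
  let V : Set W → Submodule ℝ E := fun X => Submodule.span ℝ (D.root '' {i | cs.simple i ∈ X})
  have horth : ∀ {X Y : Set W}, (∀ a ∈ X, ∀ b ∈ Y, a * b = b * a) → Disjoint X Y →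
      ∀ y ∈ V X, ∀ z ∈ V Y, D.form y z = 0 := by
    intro X Y hXY hd y hy z hz
    induction hy using Submodule.span_induction with
    | mem y hy =>
      obtain ⟨i, hi, rfl⟩ := hy
      induction hz using Submodule.span_induction with
      | mem z hz =>
        obtain ⟨j, hj, rfl⟩ := hz
        refine D.form_eq_zero_of_commute (cs := cs) ?_ (hXY _ hi _ hj)
        rintro rfl
        exact Set.disjoint_left.mp hd hi hj
      | zero => simp
      | add y z _ _ hy hz => rw [map_add, hy, hz, add_zero]
      | smul c y _ hy => rw [map_smul, hy, smul_zero]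
    | zero => simp
    | add y z _ _ hy hz => rw [map_add, LinearMap.add_apply, hy, hz, add_zero]
    | smul c y _ hy => rw [map_smul, LinearMap.smul_apply, hy, smul_zero]
  have horth₁ := horth hcomm hdisj
  have horth₂ := horth (fun a ha b hb => (hcomm b hb a ha).symm) hdisj.symm
  have hstab : ∀ (w : W) {X : Set W}, (X = X₁ ∨ X = X₂) → ∀ y ∈ V X, D.action cs w y ∈ V X := by
    intro w X hX y hy
    induction w using cs.simple_induction_left with
    | one => simpa using hy
    | mul_simple_left w i hw =>
      rw [action_mul_apply, action_simple_apply]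
      have hi : cs.simple i ∈ X₁ ∪ X₂ := by rw [hunion]; exact ⟨i, rfl⟩
      by_cases hiX : cs.simple i ∈ X
      · exact sub_mem hw ((V X).smul_mem _ (Submodule.subset_span ⟨i, hiX, rfl⟩))
      · have h0 : D.form (D.root i) (D.action cs w y) = 0 := by
          rcases hX with rfl | rfl
          · exact horth₂ _ (Submodule.subset_span ⟨i, hi.resolve_left hiX, rfl⟩) _ hw
          · exact horth₁ _ (Submodule.subset_span ⟨i, hi.resolve_right hiX, rfl⟩) _ hw
        rw [h0, zero_smul, sub_zero]
        exact hw
  have hroot : ∀ t, cs.IsReflection t → D.rootOf cs t ∈ V X₁ ∨ D.rootOf cs t ∈ V X₂ := by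
    rintro t ⟨w, i, rfl⟩
    have hs := cs.isReflection_simple i
    have hi : cs.simple i ∈ X₁ ∪ X₂ := by rw [hunion]; exact ⟨i, rfl⟩
    have h1 : ∀ {X : Set W}, (X = X₁ ∨ X = X₂) → cs.simple i ∈ X →
        D.rootOf cs (w * cs.simple i * w⁻¹) ∈ V X := by
      intro X hX hiX
      have h2 := hstab w hX (D.root i) (Submodule.subset_span ⟨i, hiX, rfl⟩)
      rw [← D.rootOf_simple (cs := cs)] at h2
      rcases D.action_rootOf_eq_or w hs with h3 | h3
      · rwa [← h3]
      · rw [h3] at h2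
        simpa using h2
    exact hi.imp (h1 (Or.inl rfl)) (h1 (Or.inr rfl))
  have hnot : ∀ t, cs.IsReflection t → D.rootOf cs t ∈ V X₁ → D.rootOf cs t ∉ V X₂ := by
    intro t ht h1 h2
    have := horth₁ _ h1 _ h2
    rw [D.form_rootOf_self ht] at this
    norm_num at this
  have hne : ∀ {X Y : Set W}, Y.Nonempty → (∀ b ∈ Y, b ∈ Set.range cs.simple) →
      (∀ t, cs.IsReflection t → D.rootOf cs t ∈ V X → D.rootOf cs t ∉ V Y) →
      ∃ t ∈ labelSet F, D.rootOf cs t ∉ V X := by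
    rintro X Y ⟨b, hb⟩ hY hnot
    by_contra! hall
    obtain ⟨i, rfl⟩ := hY b hb
    have hs := cs.isReflection_simple i
    refine hnot _ hs ?_ (by rw [rootOf_simple]; exact Submodule.subset_span ⟨i, hb, rfl⟩)
    refine D.rootOf_mem_of_mem_closure (S := labelSet F)
      (fun t ht => ⟨hF.isReflection ht, hall t ht⟩) hs ?_
    change _ ∈ labelSubgroup F
    rw [htop]
    exact Subgroup.mem_top _
  refine ⟨{t | t ∈ labelSet F ∧ D.rootOf cs t ∈ V X₁}, {t | t ∈ labelSet F ∧ D.rootOf cs t ∈ V X₂},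
    ?_, ?_, ?_, ?_, ?_⟩
  · obtain ⟨t, ht, h1⟩ := hne hX₁ (fun b hb => by rw [← hunion]; exact Or.inl hb)
      (X := X₂) (fun t ht h2 h1 => hnot t ht h1 h2)
    exact ⟨t, ht, (hroot t (hF.isReflection ht)).resolve_right h1⟩
  · obtain ⟨t, ht, h1⟩ := hne hX₂ (fun b hb => by rw [← hunion]; exact Or.inr hb) hnot
    exact ⟨t, ht, (hroot t (hF.isReflection ht)).resolve_left h1⟩
  · rw [Set.disjoint_left]
    exact fun t h1 h2 => hnot t (hF.isReflection h1.1) h1.2 h2.2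
  · ext t
    refine ⟨fun h1 => h1.elim And.left And.left, fun h1 => ?_⟩
    exact (hroot t (hF.isReflection h1)).imp (fun h2 => ⟨h1, h2⟩) (fun h2 => ⟨h1, h2⟩)
  · rintro a ⟨ha, ha'⟩ b ⟨hb, hb'⟩
    have hra := hF.isReflection ha
    have hrb := hF.isReflection hb
    have h1 : D.action cs a (D.rootOf cs b) = D.rootOf cs b := by
      rw [D.action_reflection_apply hra, horth₁ _ ha' _ hb', zero_smul, sub_zero]
    have h2 := D.action_rootOf_of_mem_cone (w := a) hrb (by rw [h1]; exact D.rootOf_mem_cone hrb)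
    rw [h1] at h2
    have h3 := D.rootOf_injective hrb (hrb.conj a) h2
    exact (eq_mul_inv_iff_mul_eq.mp h3).symm

end RootBasis

namespace CoxeterSystem

variable {B : Type*} {M : CoxeterMatrix B} {W : Type*} [Group W] {cs : CoxeterSystem M W}
  {h : ℕ} {F : Set (Fin (h + 1) → W)}

/-- The standard root basis of the given system has linearly independent simple roots, and all of
them lie in the span of the h label roots of one path. For W(F) this basis is needed, since its
canonical roots inside the space of W may be dependent. -/
theorem IsFlipclass.finite_and_card_le (hF : cs.IsFlipclass F) (htop : labelSubgroup F = ⊤) :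
    Finite B ∧ Nat.card B ≤ h := by
  set D := M.standardRootBasis with hD
  obtain ⟨x, hx⟩ := hF.nonempty
  let β : Fin h → (B →₀ ℝ) × (B →₀ ℝ) := fun k => D.rootOf cs (pathLabel x k)
  have : Module.Finite ℝ (Submodule.span ℝ (Set.range β)) :=
    FiniteDimensional.span_of_finite ℝ (Set.finite_range β)
  have hmem : ∀ i, D.root i ∈ Submodule.span ℝ (Set.range β) := by
    intro i
    rw [← D.rootOf_simple (cs := cs)]
    refine D.rootOf_mem_of_flipclass (P := Submodule.span ℝ (Set.range β)) hF hx
      (fun k => Submodule.subset_span ⟨k, rfl⟩)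
      (cs.isReflection_simple i) (by rw [htop]; exact Subgroup.mem_top _)
  have hli : LinearIndependent ℝ
      (fun i => (⟨D.root i, hmem i⟩ : Submodule.span ℝ (Set.range β))) := by
    have := M.linearIndependent_standardRootBasis_root
    exact LinearIndependent.of_comp (Submodule.subtype _) this
  have hfin : Finite B := hli.finite
  have : Fintype B := Fintype.ofFinite B
  have h1 := hli.fintype_card_le_finrank.trans (finrank_range_le_card β)
  rw [Fintype.card_fin, ← Nat.card_eq_fintype_card] at h1
  exact ⟨hfin, h1⟩

theorem IsFlipclass.encard_range_simple_le (hF : cs.IsFlipclass F) (htop : labelSubgroup F = ⊤) :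
    (Set.range cs.simple).encard ≤ h := by
  obtain ⟨hfin, hcard⟩ := hF.finite_and_card_le htop
  have : Fintype B := Fintype.ofFinite B
  rw [Nat.card_eq_fintype_card] at hcard
  calc (Set.range cs.simple).encard ≤ (Set.univ : Set B).encard := by
        rw [← Set.image_univ]; exact Set.encard_image_le _ _
    _ = Fintype.card B := by simp
    _ ≤ h := by exact_mod_cast hcard

end CoxeterSystem

/-! ### Flipclasses in the reflection subgroup generated by their labels -/

namespace RootBasis

open CoxeterSystem

variable {B : Type*} {M : CoxeterMatrix B} {E : Type*} [AddCommGroup E] [Module ℝ E]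
  (D : RootBasis M E) {W : Type*} [Group W] {cs : CoxeterSystem M W}
  {h : ℕ} {F : Set (Fin (h + 1) → W)}

open Classical in
/-- The element `w` of `W`, as an element of `H` if it lies in `H`. -/
noncomputable def codRestrict (H : Subgroup W) (w : W) : H := if hw : w ∈ H then ⟨w, hw⟩ else 1

theorem coe_codRestrict {H : Subgroup W} {w : W} (hw : w ∈ H) : (codRestrict H w : W) = w := by
  rw [codRestrict, dif_pos hw]

theorem mul_inv_mem_labelSubgroup {x : Fin (h + 1) → W} (hx : x ∈ F) (i : Fin (h + 1)) :
    x i * (x 0)⁻¹ ∈ labelSubgroup F := by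
  induction i using Fin.induction with
  | zero => simp
  | succ i ih =>
    have h1 : pathLabel x i ∈ labelSubgroup F := Subgroup.subset_closure ⟨x, hx, i, rfl⟩
    have h2 := mul_mem h1 ih
    rwa [pathLabel, ← mul_assoc, inv_mul_cancel_right] at h2

/-- By the description of flips through edges, it suffices that a two-step path in H translates to
one in the coset. -/
theorem flipMiddle_subsystem {H : Subgroup W} (hH : cs.IsReflectionSubgroup H) {x₀ : W}
    (hx₀ : D.IsMinimalRep cs H x₀) {u v x y : H}
    (hux : cs.BruhatEdge (u * x₀) (x * x₀)) (hxv : cs.BruhatEdge (x * x₀) (v * x₀))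
    (hy : cs.flipMiddle (u * x₀) (v * x₀) (x * x₀) = y * x₀) :
    (D.subsystem hH).flipMiddle u v x = y := by
  have hedge := fun {p q : H} => D.subsystem_bruhatEdge_iff hH hx₀ (x := p) (y := q)
  rw [D.flipMiddle_eq_iff ⟨hux, hxv⟩] at hy
  rw [(D.restrict cs H).flipMiddle_eq_iff ⟨hedge.mpr hux, hedge.mpr hxv⟩]
  refine ⟨⟨hedge.mpr hy.1.1, hedge.mpr hy.1.2⟩, fun hc => hy.2.1 (by rw [hc]), ?_⟩
  rintro ⟨z, hz⟩
  refine hy.2.2 ⟨z * x₀, ?_⟩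
  rwa [hedge, hedge, hedge, hedge] at hz

theorem exists_flipclass_subsystem (hF : cs.IsFlipclass F) :
    ∃ F' : Set (Fin (h + 1) → labelSubgroup F),
      (D.subsystem hF.isReflectionSubgroup).IsFlipclass F' ∧
      labelSet F = (labelSubgroup F).subtype '' labelSet F' ∧
      FlipclassIso cs (D.subsystem hF.isReflectionSubgroup) F F' ∧
      ∀ r : W → W → Prop, {x | x ∈ F ∧ IsIncreasing r x}.encard =
        {x | x ∈ F' ∧ IsIncreasing (fun s t : labelSubgroup F => r s t) x}.encard := by
  set H := labelSubgroup F with hHdef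
  have hH : cs.IsReflectionSubgroup H := hF.isReflectionSubgroup
  set cs' := D.subsystem hH with hcs'
  obtain ⟨u, v, hsub⟩ := hF.exists_subset
  obtain ⟨g, hg, hx₀⟩ := D.exists_isMinimalRep cs H u
  set x₀ := g * u with hx₀def
  -- All vertices lie in the coset of x₀, so dividing by x₀ on the right lands in H and does not
  -- change the labels.
  let ε : W → H := fun w => codRestrict H (w * x₀⁻¹)
  let τ : W → H := codRestrict H
  have hε : ∀ x ∈ F, ∀ i, (ε (x i) : W) * x₀ = x i := by
    intro x hx i
    have h1 : x i * x₀⁻¹ ∈ H := by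
      have h2 := mul_mem (mul_inv_mem_labelSubgroup hx i) (inv_mem hg)
      rw [(hsub hx).1] at h2
      rwa [hx₀def, mul_inv_rev, ← mul_assoc]
    rw [coe_codRestrict h1, inv_mul_cancel_right]
  have hεv : ∀ w ∈ vertexSet F, (ε w : W) * x₀ = w := by
    rintro _ ⟨x, hx, i, rfl⟩
    exact hε x hx i
  have hεinj : Set.InjOn ε (vertexSet F) := fun w hw w' hw' heq => by
    rw [← hεv w hw, ← hεv w' hw', heq]
  have hτ : ∀ t ∈ labelSet F, (τ t : W) = t := fun t ht =>
    coe_codRestrict (Subgroup.subset_closure ht)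
  have hlab : ∀ x : Fin (h + 1) → W, (∀ i, x i ∈ vertexSet F) → ∀ i,
      ((pathLabel (ε ∘ x) i : H) : W) = pathLabel x i := by
    intro x hx i
    simp only [pathLabel, Function.comp_apply, Subgroup.coe_mul, Subgroup.coe_inv]
    rw [eq_mul_inv_of_mul_eq (hεv _ (hx i.succ)), eq_mul_inv_of_mul_eq (hεv _ (hx i.castSucc))]
    group
  have hvert : ∀ x ∈ F, ∀ i, x i ∈ vertexSet F := fun x hx i => ⟨x, hx, i, rfl⟩
  have hedge : ∀ x ∈ F, ∀ i : Fin h, cs'.BruhatEdge (ε (x i.castSucc)) (ε (x i.succ)) := by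
    intro x hx i
    rw [hcs', D.subsystem_bruhatEdge_iff hH hx₀, hε x hx, hε x hx]
    exact hF.bruhatEdge hx i
  have hflip : ∀ x ∈ F, ∀ (i : ℕ) (hi : i + 1 < h),
      ε ∘ cs.flip i hi x = cs'.flip i hi (ε ∘ x) := by
    intro x hx i hi
    have hy := hF.flip_mem hx i hi
    have h1 := hε _ hy ⟨i + 1, by omega⟩
    rw [CoxeterSystem.flip, Function.comp_update, CoxeterSystem.flip]
    congr 1
    rw [CoxeterSystem.flip, Function.update_self] at h1
    symm
    refine D.flipMiddle_subsystem hH hx₀ ?_ ?_ ?_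
    · rw [Function.comp_apply, Function.comp_apply, hε x hx, hε x hx]
      exact hF.bruhatEdge hx ⟨i, by omega⟩
    · rw [Function.comp_apply, Function.comp_apply, hε x hx, hε x hx]
      exact hF.bruhatEdge hx ⟨i + 1, by omega⟩
    · rw [Function.comp_apply, Function.comp_apply, Function.comp_apply, hε x hx, hε x hx, hε x hx,
        h1]
  have hεF : Set.InjOn (fun x : Fin (h + 1) → W => ε ∘ x) F := fun x hx y hy heq =>
    funext fun i => hεinj (hvert x hx i) (hvert y hy i) (congrFun heq i)
  refine ⟨(fun x => ε ∘ x) '' F, ⟨ε u, ε v, ⟨?_, ?_, ?_⟩, ?_⟩, ?_, ⟨ε, τ, ?_, ?_, ?_, hflip, ?_⟩, ?_⟩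
  · exact hF.nonempty.image _
  · rintro _ ⟨x, hx, rfl⟩
    have h1 := hsub hx
    exact ⟨congrArg ε h1.1, congrArg ε h1.2.1, hedge x hx⟩
  · rintro _ ⟨x, hx, rfl⟩ i hi
    exact ⟨_, hF.flip_mem hx i hi, hflip x hx i hi⟩
  · rintro G ⟨⟨y, hy⟩, hGsub, hGflip⟩ hle
    obtain ⟨x, hx, rfl⟩ := hle hy
    have h1 := hF.induction (p := fun x => ε ∘ x ∈ G) ⟨x, hx, hy⟩ fun z hz hzG i hi => by
      rw [hflip z hz]; exact hGflip _ hzG i hi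
    rintro _ ⟨z, hz, rfl⟩
    exact h1 z hz
  · ext t
    constructor
    · rintro ⟨x, hx, i, rfl⟩
      exact ⟨_, ⟨_, ⟨x, hx, rfl⟩, i, rfl⟩, hlab x (hvert x hx) i⟩
    · rintro ⟨_, ⟨_, ⟨x, hx, rfl⟩, i, rfl⟩, rfl⟩
      exact ⟨x, hx, i, (hlab x (hvert x hx) i).symm⟩
  · refine ⟨?_, hεinj, ?_⟩
    · rintro _ ⟨x, hx, i, rfl⟩
      exact ⟨_, ⟨x, hx, rfl⟩, i, rfl⟩
    · rintro _ ⟨_, ⟨x, hx, rfl⟩, i, rfl⟩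
      exact ⟨_, hvert x hx i, rfl⟩
  · refine ⟨?_, ?_, ?_⟩
    · rintro _ ⟨x, hx, i, rfl⟩
      refine ⟨_, ⟨x, hx, rfl⟩, i, Subtype.ext ?_⟩
      rw [hlab x (hvert x hx) i, hτ _ ⟨x, hx, i, rfl⟩]
    · intro s hs t ht heq
      rw [← hτ s hs, ← hτ t ht, heq]
    · rintro _ ⟨_, ⟨x, hx, rfl⟩, i, rfl⟩
      refine ⟨pathLabel x i, ⟨x, hx, i, rfl⟩, Subtype.ext ?_⟩
      rw [hlab x (hvert x hx) i, hτ _ ⟨x, hx, i, rfl⟩]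
  · intro x t hx ht
    have h1 : pathLabel (ε ∘ x) = τ ∘ t ↔ pathLabel x = t := by
      rw [funext_iff, funext_iff]
      refine forall_congr' fun i => ?_
      rw [Subtype.ext_iff, hlab x hx i, Function.comp_apply, hτ _ (ht i)]
    rw [h1, and_congr_left_iff]
    rintro -
    refine ⟨fun hxF => ⟨x, hxF, rfl⟩, ?_⟩
    rintro ⟨y, hy, heq⟩
    have : y = x := funext fun i => hεinj (hvert y hy i) (hx i) (congrFun heq i)
    rwa [← this]
  -- Any reflection ordering of W serves, together with its restriction to H.
  · obtain ⟨r, hr⟩ := cs.exists_isReflectionOrdering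
    refine ⟨r, fun s t => r s t, hr, isReflectionOrdering_subsystem hr hH, fun s hs t ht => ?_⟩
    change _ ↔ r (τ s) (τ t)
    rw [hτ s hs, hτ t ht]
  · intro r
    have hset : {x | x ∈ (fun x => ε ∘ x) '' F ∧ IsIncreasing (fun s t : H => r s t) x} =
        (fun x => ε ∘ x) '' {x | x ∈ F ∧ IsIncreasing r x} := by
      have hinc : ∀ x ∈ F, IsIncreasing (fun s t : H => r s t) (ε ∘ x) ↔ IsIncreasing r x := by
        intro x hx
        unfold IsIncreasing
        simp only [hlab x (hvert x hx)]
      ext y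
      constructor
      · rintro ⟨⟨x, hx, rfl⟩, hy⟩
        exact ⟨x, ⟨hx, (hinc x hx).mp hy⟩, rfl⟩
      · rintro ⟨x, ⟨hx, hy⟩, rfl⟩
        exact ⟨⟨x, hx, rfl⟩, (hinc x hx).mpr hy⟩
    rw [hset, (hεF.mono fun x hx => hx.1).encard_image]

end RootBasis

/-! ### Counts and generators for the transported flipclass -/

namespace CoxeterSystem

variable {B : Type*} {M : CoxeterMatrix B} {W : Type*} [Group W] {cs : CoxeterSystem M W}
  {h : ℕ} {F : Set (Fin (h + 1) → W)}

theorem exists_hasIncreasingCount [Finite W] (hF : cs.IsFlipclass F) :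
    ∃ c, cs.HasIncreasingCount F c := by
  obtain ⟨r, hr⟩ := cs.exists_isReflectionOrdering
  obtain ⟨u, v, hsub⟩ := hF.exists_subset
  have hfin : {x | x ∈ F ∧ IsIncreasing r x}.Finite := Set.toFinite _
  refine ⟨{x | x ∈ F ∧ IsIncreasing r x}.ncard, ⟨r, hr⟩, fun r' hr' => ?_⟩
  rw [encard_isIncreasing_eq hsub (fun x hx i hi => hF.flip_mem hx i hi) hr' hr,
    hfin.cast_ncard_eq]

theorem finite_labelSubgroup
    (h : IsFiniteType F ∨ cs.IsWeylType F ∨ cs.IsSymmetricType F) : Finite (labelSubgroup F) := by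
  rcases h with h | h | ⟨k, n, φ, -⟩
  · exact h
  · exact h.1
  · exact Finite.of_equiv _ φ.symm.toEquiv

theorem labelSubgroup_eq_top_of_image {F' : Set (Fin (h + 1) → labelSubgroup F)}
    (hF' : labelSet F = (labelSubgroup F).subtype '' labelSet F') : labelSubgroup F' = ⊤ := by
  have h1 : (labelSubgroup F').map (labelSubgroup F).subtype = labelSubgroup F := by
    change (Subgroup.closure (labelSet F')).map _ = _
    rw [MonoidHom.map_closure, ← hF']
    rfl
  rw [eq_top_iff]
  intro g _
  have h2 : (g : W) ∈ (labelSubgroup F').map (labelSubgroup F).subtype := by rw [h1]; exact g.2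
  obtain ⟨g', hg', hgg⟩ := h2
  rwa [← Subtype.ext hgg]

theorem range_subsystem_simple {E : Type*} [AddCommGroup E] [Module ℝ E] (D : RootBasis M E)
    {H : Subgroup W} (hH : cs.IsReflectionSubgroup H) :
    Set.range (D.subsystem hH).simple = cs.canonicalGenerators H := by
  ext t
  constructor
  · rintro ⟨a, rfl⟩
    rw [D.subsystem_simple]
    exact a.2
  · exact fun ht => ⟨⟨t, ht⟩, D.subsystem_simple hH ⟨t, ht⟩⟩

end CoxeterSystem

/-! ### Components of Coxeter systems -/

/-- The Coxeter matrix with indices pulled back along an injection. -/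
def CoxeterMatrix.restrict {B B' : Type*} (M : CoxeterMatrix B) (f : B' ↪ B) :
    CoxeterMatrix B' where
  M := Matrix.of fun i j => M (f i) (f j)
  isSymm := by ext i j; exact M.symmetric _ _
  diagonal i := M.diagonal _
  off_diagonal i j hij := M.off_diagonal _ _ fun h => hij (f.injective h)

/-- The set `J` of indices is a union of components of the Coxeter graph. -/
def CoxeterMatrix.IsIsolated {B : Type*} (M : CoxeterMatrix B) (J : Set B) : Prop :=
  ∀ i ∈ J, ∀ k ∉ J, M i k = 2

namespace CoxeterSystem

variable {B : Type*} {M : CoxeterMatrix B} {W : Type*} [Group W] (cs : CoxeterSystem M W)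
  {J : Set B}

open Classical in
/-- The simple reflection with index `i` if `i ∈ J`, and `1` otherwise. -/
noncomputable def simpleOrOne (J : Set B) (i : B) : W := if i ∈ J then cs.simple i else 1

/-- A relation between an index in J and one outside has exponent 2, so it survives when the second
generator is sent to 1. -/
theorem isLiftable_simpleOrOne (hJ : M.IsIsolated J) : M.IsLiftable (cs.simpleOrOne J) := by
  intro i k
  by_cases hi : i ∈ J <;> by_cases hk : k ∈ J <;>
    simp only [simpleOrOne, hi, hk, if_true, if_false]
  · exact cs.simple_mul_simple_pow i k
  · rw [mul_one, hJ i hi k hk, pow_two, cs.simple_mul_simple_self]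
  · rw [one_mul, M.symmetric, hJ k hk i hi, pow_two, cs.simple_mul_simple_self]
  · rw [mul_one, one_pow]

/-- The projection of a Coxeter group onto the factor that belongs to a union of components. -/
noncomputable def componentHom (hJ : M.IsIsolated J) : W →* W :=
  cs.lift ⟨cs.simpleOrOne J, cs.isLiftable_simpleOrOne hJ⟩

variable {cs} (hJ : M.IsIsolated J)

theorem componentHom_simple_of_mem {i : B} (hi : i ∈ J) :
    cs.componentHom hJ (cs.simple i) = cs.simple i := by
  rw [componentHom, lift_apply_simple, simpleOrOne, if_pos hi]

theorem componentHom_simple_of_not_mem {i : B} (hi : i ∉ J) :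
    cs.componentHom hJ (cs.simple i) = 1 := by
  rw [componentHom, lift_apply_simple, simpleOrOne, if_neg hi]

theorem componentHom_componentHom (w : W) :
    cs.componentHom hJ (cs.componentHom hJ w) = cs.componentHom hJ w := by
  induction w using cs.simple_induction_left with
  | one => simp
  | mul_simple_left w i hw =>
    rw [map_mul, map_mul, hw]
    by_cases hi : i ∈ J
    · rw [componentHom_simple_of_mem hJ hi, componentHom_simple_of_mem hJ hi]
    · rw [componentHom_simple_of_not_mem hJ hi, map_one]

theorem componentHom_mem_closure (w : W) :
    cs.componentHom hJ w ∈ Subgroup.closure (cs.simple '' J) := by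
  induction w using cs.simple_induction_left with
  | one => simp
  | mul_simple_left w i hw =>
    rw [map_mul]
    refine mul_mem ?_ hw
    by_cases hi : i ∈ J
    · rw [componentHom_simple_of_mem hJ hi]
      exact Subgroup.subset_closure ⟨i, hi, rfl⟩
    · rw [componentHom_simple_of_not_mem hJ hi]
      exact one_mem _

theorem componentHom_alternatingWord {i j : B} (hi : i ∈ J) (hj : j ∈ J) (m : ℕ) :
    cs.componentHom hJ (cs.wordProd (alternatingWord i j m)) =
      cs.wordProd (alternatingWord i j m) := by
  induction m with
  | zero => simp [alternatingWord]
  | succ m ih =>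
    rw [alternatingWord_succ', wordProd_cons, map_mul, ih]
    split_ifs
    · rw [componentHom_simple_of_mem hJ hj]
    · rw [componentHom_simple_of_mem hJ hi]

end CoxeterSystem

namespace RootBasis

open CoxeterSystem

variable {B : Type*} {M : CoxeterMatrix B} {E : Type*} [AddCommGroup E] [Module ℝ E]
  (D : RootBasis M E) {W : Type*} [Group W] {cs : CoxeterSystem M W}
  {J : Set B} (hJ : M.IsIsolated J)

/-- The root basis obtained by dropping some of the simple roots. -/
noncomputable def comap {B' : Type*} (f : B' ↪ B) : RootBasis (M.restrict f) E where
  form := D.form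
  form_comm := D.form_comm
  root := D.root ∘ f
  form_root_self _ := D.form_root_self _
  coeff_nonneg _ _ hij := D.coeff_nonneg _ _ fun h => hij (f.injective h)
  coeff_eq_zero _ _ hij := D.coeff_eq_zero _ _ fun h => hij (f.injective h)
  salient y hy hy' := D.salient y
    (Submodule.span_mono (Set.range_comp_subset_range f D.root) hy)
    (Submodule.span_mono (Set.range_comp_subset_range f D.root) hy')
  nondeg y hy := D.nondeg y (Submodule.span_mono (Set.range_comp_subset_range f D.root) hy)

/-- Followed by the action of W, this homomorphism is the faithful action of the root basis of the
chosen simple roots. -/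
theorem exists_injective_hom_restrict (D : RootBasis M E) (cs : CoxeterSystem M W) {B' : Type*} (f : B' ↪ B) :
    ∃ φ : (M.restrict f).Group →* W, Function.Injective φ ∧
      ∀ i, φ ((M.restrict f).simple i) = cs.simple (f i) := by
  set cs' := (M.restrict f).toCoxeterSystem with hcs'
  let φ : (M.restrict f).Group →* W :=
    cs'.lift ⟨fun i => cs.simple (f i), fun i j => cs.simple_mul_simple_pow _ _⟩
  have hφ : ∀ i, φ (cs'.simple i) = cs.simple (f i) := fun i => cs'.lift_apply_simple _ i
  refine ⟨φ, ?_, hφ⟩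
  have h1 : (D.comap f).action cs' = (D.action cs).comp φ := by
    apply cs'.ext_simple
    intro i
    rw [action_simple, MonoidHom.comp_apply, hφ, action_simple]
    rfl
  intro x y hxy
  apply (D.comap f).action_injective cs'
  rw [h1, MonoidHom.comp_apply, hxy, MonoidHom.comp_apply]

/-- The span of the simple roots with index in `J`. -/
def rootSpan (J : Set B) : Submodule ℝ E := Submodule.span ℝ (D.root '' J)

include hJ in
theorem form_root_root_eq_zero {i k : B} (hi : i ∈ J) (hk : k ∉ J) :
    D.form (D.root i) (D.root k) = 0 := by
  have h1 := D.coeff_eq_zero i k (fun h => hk (h ▸ hi))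
  rw [hJ i hi k hk, dihedralCoeff_add_two] at h1
  simpa using h1

include hJ in
theorem form_root_eq_zero {k : B} (hk : k ∉ J) {y : E} (hy : y ∈ D.rootSpan J) :
    D.form (D.root k) y = 0 := by
  induction hy using Submodule.span_induction with
  | mem y hy =>
    obtain ⟨i, hi, rfl⟩ := hy
    rw [D.form_comm, D.form_root_root_eq_zero hJ hi hk]
  | zero => simp
  | add y z _ _ hy hz => rw [map_add, hy, hz, add_zero]
  | smul c y _ hy => rw [map_smul, hy, smul_zero]

/-- Generators outside J are orthogonal to the span of the roots in J and fix it pointwise. -/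
theorem action_componentHom (w : W) {y : E} (hy : y ∈ D.rootSpan J) :
    D.action cs (cs.componentHom hJ w) y = D.action cs w y ∧ D.action cs w y ∈ D.rootSpan J := by
  induction w using cs.simple_induction_left with
  | one => simpa using hy
  | mul_simple_left w i hw =>
    rw [map_mul, action_mul_apply, action_mul_apply, hw.1]
    by_cases hi : i ∈ J
    · rw [componentHom_simple_of_mem hJ hi, action_simple_apply]
      exact ⟨rfl, sub_mem hw.2 (Submodule.smul_mem _ _ (Submodule.subset_span ⟨i, hi, rfl⟩))⟩
    · rw [componentHom_simple_of_not_mem hJ hi, action_one_apply, action_simple_apply,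
        D.form_root_eq_zero hJ hi hw.2, zero_smul, sub_zero]
      exact ⟨rfl, hw.2⟩

theorem action_componentHom_root_of_not_mem (w : W) {k : B} (hk : k ∉ J) :
    D.action cs (cs.componentHom hJ w) (D.root k) = D.root k := by
  induction w using cs.simple_induction_left with
  | one => simp
  | mul_simple_left w i hw =>
    rw [map_mul, action_mul_apply, hw]
    by_cases hi : i ∈ J
    · rw [componentHom_simple_of_mem hJ hi, action_simple_apply, D.form_root_root_eq_zero hJ hi hk,
        zero_smul, sub_zero]
    · rw [componentHom_simple_of_not_mem hJ hi, action_one_apply]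

/-- For a conjugate of a generator in J, the projection is the reflection along the same root; a
generator outside J projects to 1, and so do its conjugates. -/
theorem componentHom_reflection {t : W} (ht : cs.IsReflection t) :
    cs.componentHom hJ t = 1 ∨ (cs.componentHom hJ t = t ∧ D.rootOf cs t ∈ D.rootSpan J) := by
  obtain ⟨w, i, rfl⟩ := ht
  have hs := cs.isReflection_simple i
  by_cases hi : i ∈ J
  · right
    have hroot : D.rootOf cs (cs.simple i) ∈ D.rootSpan J := by
      rw [rootOf_simple]; exact Submodule.subset_span ⟨i, hi, rfl⟩
    have h1 := D.action_componentHom (cs := cs) hJ w hroot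
    constructor
    · apply D.action_injective cs
      have h2 := D.isReflectionAlong_conj w hs
      have h3 := D.isReflectionAlong_conj (cs.componentHom hJ w) hs
      rw [h1.1] at h3
      rw [map_mul (cs.componentHom hJ), map_mul (cs.componentHom hJ), map_inv (cs.componentHom hJ),
        componentHom_simple_of_mem hJ hi]
      exact h3.eq h2
    · rcases D.action_rootOf_eq_or w hs with h2 | h2
      · rw [← h2]; exact h1.2
      · rw [← neg_eq_iff_eq_neg] at h2
        rw [← h2]; exact neg_mem h1.2
  · left
    rw [map_mul, map_mul, componentHom_simple_of_not_mem hJ hi, mul_one, ← map_mul, mul_inv_cancel,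
      map_one]

theorem componentHom_eq_self {t : W} (ht : cs.IsReflection t)
    (h : D.rootOf cs t ∈ D.rootSpan J) : cs.componentHom hJ t = t := by
  rcases D.componentHom_reflection hJ ht with h1 | h1
  · exfalso
    have h2 := (D.action_componentHom (cs := cs) hJ t h).1
    rw [h1, action_one_apply, D.action_rootOf_self ht] at h2
    have h3 : (2 : ℝ) • D.rootOf cs t = 0 := by
      rw [two_smul]; nth_rewrite 1 [h2]; simp
    exact D.rootOf_ne_zero ht ((smul_eq_zero.mp h3).resolve_left two_ne_zero)
  · exact h1.1

theorem length_lt_componentHom_iff {t x : W} (ht : cs.IsReflection t)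
    (h : D.rootOf cs t ∈ D.rootSpan J) :
    cs.length (cs.componentHom hJ x) < cs.length (t * cs.componentHom hJ x) ↔
      cs.length x < cs.length (t * x) := by
  rw [D.length_lt_reflection_mul_iff ht, D.length_lt_reflection_mul_iff ht, ← map_inv,
    (D.action_componentHom hJ x⁻¹ h).1]

theorem mem_of_isRightDescent (D : RootBasis M E) {w : W} (hw : cs.componentHom hJ w = w) {k : B}
    (hk : cs.IsRightDescent w k) : k ∈ J := by
  by_contra hkJ
  rw [D.isRightDescent_iff cs, ← hw, D.action_componentHom_root_of_not_mem hJ w hkJ] at hk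
  exact D.root_ne_zero k (D.eq_zero_of_mem_cone (D.root_mem_cone k) hk)

/-! ### Dihedral components -/

variable {i j : B}

theorem eq_wordProd_alternatingWord (D : RootBasis M E) (hJ : M.IsIsolated {i, j}) {w : W}
    (hw : cs.componentHom hJ w = w) : w = cs.wordProd (alternatingWord i j (cs.length w)) ∨
      w = cs.wordProd (alternatingWord j i (cs.length w)) := by
  obtain ⟨v, k, hvi, hvj, hdec, hk⟩ := cs.exists_eq_mul_alternatingWord (i := i) (j := j) w
  have hi : i ∈ ({i, j} : Set B) := by simp
  have hj : j ∈ ({i, j} : Set B) := by simp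
  have hv : cs.componentHom hJ v = v := by
    rcases hdec with h | h
    · rw [h, map_mul, componentHom_alternatingWord hJ hi hj] at hw
      exact mul_right_cancel hw
    · rw [h, map_mul, componentHom_alternatingWord hJ hj hi] at hw
      exact mul_right_cancel hw
  have hv1 : v = 1 := by
    by_contra hne
    obtain ⟨l, hl⟩ := cs.exists_rightDescent_of_ne_one hne
    rcases D.mem_of_isRightDescent hJ hv hl with rfl | rfl
    exacts [hvi hl, hvj hl]
  rw [hv1, one_mul, one_mul] at hdec
  rw [hv1, length_one, zero_add] at hk
  rw [hk]
  exact hdec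

theorem isReflection_of_componentHom_eq_self (hJ : M.IsIsolated {i, j}) {w : W}
    (hw : cs.componentHom hJ w = w) (hodd : Odd (cs.length w)) : cs.IsReflection w := by
  refine isReflection_of_odd (cs.isReflection_simple i) (cs.isReflection_simple j) ?_ hodd
  have := componentHom_mem_closure (cs := cs) hJ w
  rwa [hw, Set.image_pair] at this

/-- The intermediate vertex is s y for a left descent s of the component of y. The label from x to s
y has odd length in the dihedral component, so it is a reflection, and comparing lengths of
components gives the directions of both edges. -/
theorem twoStepComparable_of_length_lt (D : RootBasis M E) (hJ : M.IsIsolated {i, j}) {x y : W}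
    (hxy : cs.componentHom hJ (y * x⁻¹) = y * x⁻¹) (heven : ¬ Odd (cs.length (y * x⁻¹)))
    (hlt : cs.length (cs.componentHom hJ x) < cs.length (cs.componentHom hJ y)) :
    cs.TwoStepComparable x y := by
  set π := cs.componentHom hJ with hπ
  have hyx : y * x⁻¹ = π y * (π x)⁻¹ := by rw [← hxy, map_mul, map_inv]
  have hne : (π y)⁻¹ ≠ 1 := by
    intro h1
    rw [inv_eq_one] at h1
    rw [h1, length_one] at hlt
    exact Nat.not_lt_zero _ hlt
  obtain ⟨k, hk⟩ := cs.exists_rightDescent_of_ne_one hne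
  have hkJ := D.mem_of_isRightDescent hJ (by rw [← map_inv]; exact componentHom_componentHom hJ _) hk
  rw [isRightDescent_inv_iff] at hk
  have hs := cs.isReflection_simple k
  have hsroot : D.rootOf cs (cs.simple k) ∈ D.rootSpan {i, j} := by
    rw [rootOf_simple]; exact Submodule.subset_span ⟨k, hkJ, rfl⟩
  have hks : π (cs.simple k) = cs.simple k := componentHom_simple_of_mem hJ hkJ
  set t := cs.simple k * (π y * (π x)⁻¹) with ht
  have htπ : π t = t := by
    rw [ht, map_mul, hks, ← hyx, hxy]
  have htodd : Odd (cs.length t) := by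
    rw [Nat.not_odd_iff_even, even_length_iff] at heven
    rw [← Nat.not_even_iff_odd, even_length_iff, ht, ← hyx, map_mul, heven, mul_one,
      ← even_length_iff, length_simple]
    decide
  have htrefl := isReflection_of_componentHom_eq_self hJ htπ htodd
  have htroot : D.rootOf cs t ∈ D.rootSpan {i, j} := by
    rcases D.componentHom_reflection hJ htrefl with h1 | h1
    · exact absurd (htπ.symm.trans h1) htrefl.ne_one
    · exact h1.2
  have htx : t * π x = cs.simple k * π y := by rw [ht]; group
  have htx' : cs.simple k * y = t * x := by rw [ht, ← hyx]; group
  have hsy : cs.simple k * (t * x) = y := by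
    rw [← htx', ← mul_assoc, cs.simple_mul_simple_self, one_mul]
  refine ⟨t * x, Or.inl ⟨⟨?_, by simpa using htrefl⟩, ?_, ?_⟩⟩
  · rw [← D.length_lt_componentHom_iff hJ htrefl htroot]
    change cs.length (π x) < cs.length (t * π x)
    have h1 : cs.length (π x) ≤ cs.length (t * π x) := by
      rw [htx]
      have := (cs.isLeftDescent_iff).mp hk
      omega
    exact lt_of_le_of_ne h1 (htrefl.length_mul_right_ne _).symm
  · have h1 := (D.length_lt_componentHom_iff hJ hs hsroot (x := t * x)).mp (by
      rw [← htx', map_mul, componentHom_simple_of_mem hJ hkJ, ← mul_assoc,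
        cs.simple_mul_simple_self, one_mul]
      exact hk)
    rwa [hsy] at h1
  · have h1 : y * (t * x)⁻¹ = cs.simple k := by
      nth_rewrite 1 [← hsy]
      group
    rw [h1]
    exact hs

variable {h : ℕ} {F : Set (Fin (h + 1) → W)}

/-- The lengths of the components of the vertices of a flipclass in a dihedral component occur
already on any one of its paths. -/
theorem exists_length_componentHom_eq (D : RootBasis M E) (hJ : M.IsIsolated {i, j})
    (hF : cs.IsFlipclass F) {x₁ : Fin (h + 1) → W} (hx₁ : x₁ ∈ F) :
    ∀ x ∈ F, ∀ k, ∃ l, cs.length (cs.componentHom hJ (x k)) =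
      cs.length (cs.componentHom hJ (x₁ l)) := by
  refine hF.induction ⟨x₁, hx₁, fun k => ⟨k, rfl⟩⟩ fun x hx hp m hm k => ?_
  obtain ⟨k, hkh⟩ := k
  by_cases hk : k = m + 1
  swap
  · rw [flip_apply_of_ne hm x hk]
    exact hp _
  subst hk
  have hy := hF.flip_mem hx m hm
  have ey0 : cs.flip m hm x ⟨m, by omega⟩ = x ⟨m, by omega⟩ := flip_apply_of_ne hm x (by simp)
  have ey2 : cs.flip m hm x ⟨m + 2, by omega⟩ = x ⟨m + 2, by omega⟩ :=
    flip_apply_of_ne hm x (by simp)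
  have hy1 := hF.bruhatEdge hy ⟨m, by omega⟩
  have hy2 := hF.bruhatEdge hy ⟨m + 1, hm⟩
  have hx1 := hF.bruhatEdge hx ⟨m, by omega⟩
  have hx2 := hF.bruhatEdge hx ⟨m + 1, hm⟩
  have hspan := D.rootOf_mem_span_of_mul_eq_mul hy2.2 hy1.2 hx2.2 hx1.2
    (pathLabel_mul_pathLabel_flip hm x) (pathLabel_succ_ne (hF.bruhatEdge hx) hm)
  have hmid : x ⟨m + 1, by omega⟩ ∈ cs.middles (x ⟨m, by omega⟩) (x ⟨m + 2, by omega⟩) := ⟨hx1, hx2⟩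
  have hflip := (D.flipMiddle_eq_iff hmid (y := cs.flip m hm x ⟨m + 1, by omega⟩)).mp
    (by rw [CoxeterSystem.flip, Function.update_self])
  simp only [Fin.succ_mk, Fin.castSucc_mk, ey0] at hy1 hy2 hx1 hx2 hspan
  have e : (⟨m + 1 + 1, by omega⟩ : Fin (h + 1)) = ⟨m + 2, by omega⟩ := rfl
  rw [e] at hy2 hx2 hspan
  rw [ey2] at hy2 hspan
  generalize cs.flip m hm x ⟨m + 1, by omega⟩ = y at *
  set p := x ⟨m, by omega⟩
  set q := x ⟨m + 2, by omega⟩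
  set z := x ⟨m + 1, by omega⟩ with hz
  set π := cs.componentHom hJ with hπ
  -- If one of the two labels at the new vertex projects to 1, its component equals that of a
  -- neighbour. Otherwise the flip happens inside the dihedral component and keeps the length there,
  -- as different lengths would make the two middle vertices two-step comparable.
  rcases D.componentHom_reflection hJ hy1.2 with h1 | ⟨h1, h1'⟩
  · rw [map_mul, map_inv, mul_inv_eq_one] at h1
    obtain ⟨l, hl⟩ := hp ⟨m, by omega⟩
    exact ⟨l, by rw [← hl]; exact congrArg _ h1⟩
  rcases D.componentHom_reflection hJ hy2.2 with h2 | ⟨h2, h2'⟩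
  · rw [map_mul, map_inv, mul_inv_eq_one] at h2
    obtain ⟨l, hl⟩ := hp ⟨m + 2, by omega⟩
    exact ⟨l, by rw [← hl]; exact congrArg _ h2.symm⟩
  have hle : Submodule.span ℝ {D.rootOf cs (q * y⁻¹), D.rootOf cs (y * p⁻¹)} ≤
      D.rootSpan {i, j} := by
    rw [Submodule.span_le]
    rintro _ (rfl | rfl)
    exacts [h2', h1']
  have h3 := D.componentHom_eq_self hJ hx1.2 (hle hspan.2)
  have hyz : y * z⁻¹ = (y * p⁻¹) * (z * p⁻¹)⁻¹ := by group
  have hzy : z * y⁻¹ = (z * p⁻¹) * (y * p⁻¹)⁻¹ := by group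
  have hodd : ∀ {s t : W}, cs.IsReflection s → cs.IsReflection t →
      ¬ Odd (cs.length (s * t⁻¹)) := by
    intro s t hs ht
    rw [Nat.not_odd_iff_even, even_length_iff, ht.inv, hs.lengthParity_mul ht]
  obtain ⟨l, hl⟩ := hp ⟨m + 1, by omega⟩
  refine ⟨l, ?_⟩
  rw [← hl]
  change cs.length (π y) = cs.length (π z)
  by_contra hne
  rcases lt_or_gt_of_ne hne with hlt | hlt
  · refine hflip.2.2 ?_
    obtain ⟨w, hw⟩ := D.twoStepComparable_of_length_lt hJ (x := y) (y := z)
      (by rw [hzy, map_mul, map_inv, h3, h1]) (by rw [hzy]; exact hodd hx1.2 hy1.2) hlt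
    exact ⟨w, hw.symm⟩
  · exact hflip.2.2 (D.twoStepComparable_of_length_lt hJ (x := z) (y := y)
      (by rw [hyz, map_mul, map_inv, h3, h1]) (by rw [hyz]; exact hodd hy1.2 hx1.2) hlt)

end RootBasis

/-! ### Finite Coxeter groups -/

namespace RootBasis

open CoxeterSystem

variable {B : Type*} {M : CoxeterMatrix B} {E : Type*} [AddCommGroup E] [Module ℝ E]
  (D : RootBasis M E) {W : Type*} [Group W] (cs : CoxeterSystem M W)

/-- Removing a right descent i from w changes the difference by a nonnegative multiple of the
positive root w s_i α_i. -/
theorem action_sub_mem_cone {v : E} (hv : ∀ i, D.form (D.root i) v ≤ 0) (w : W) :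
    D.action cs w v - v ∈ D.cone := by
  induction hn : cs.length w using Nat.strong_induction_on generalizing w with
  | _ n ih =>
    by_cases hw : w = 1
    · simp [hw]
    obtain ⟨i, hi⟩ := cs.exists_rightDescent_of_ne_one hw
    have h1 := ih _ (by rw [← hn]; exact hi) (w * cs.simple i) rfl
    have h2 : ¬ cs.IsRightDescent (w * cs.simple i) i := by
      rw [IsRightDescent, simple_mul_simple_cancel_right]
      exact not_lt.mpr hi.le
    have h3 := D.action_root_mem_cone cs h2
    have h4 : D.action cs w v - v = (D.action cs (w * cs.simple i) v - v) +
        (-D.form (D.root i) v) • D.action cs (w * cs.simple i) (D.root i) := by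
      rw [action_mul_apply, action_mul_apply, action_simple_root, action_simple_apply, map_sub,
        map_smul, map_neg]
      module
    rw [h4]
    exact add_mem h1 (D.smul_mem_cone (by linarith [hv i]) h3)

/-- The form of a finite Coxeter group has no nonzero antidominant vector in the cone of the simple
roots. -/
theorem eq_zero_of_antidominant (cs : CoxeterSystem M W) [Finite W] {v : E} (hc : v ∈ D.cone)
    (hv : ∀ i, D.form (D.root i) v ≤ 0) : v = 0 := by
  -- An element of maximal length makes every simple root negative, so -wv lies in the cone; adding
  -- wv - v shows that -v does too.
  obtain ⟨w, hw⟩ := Finite.exists_max cs.length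
  have hneg : ∀ y ∈ D.cone, -D.action cs w y ∈ D.cone := by
    intro y hy
    induction hy using Submodule.span_induction with
    | mem y hy =>
      obtain ⟨i, rfl⟩ := hy
      exact D.neg_action_root_mem_cone cs (lt_of_le_of_ne (hw _) (cs.length_mul_simple_ne w i))
    | zero => simp
    | add y z _ _ hy hz => rw [map_add, neg_add]; exact add_mem hy hz
    | smul c y _ hy =>
      rw [NNReal.smul_def, map_smul, ← smul_neg]
      exact D.smul_mem_cone c.2 hy
  refine D.eq_zero_of_mem_cone hc ?_
  have h1 := add_mem (D.action_sub_mem_cone cs hv w) (hneg v hc)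
  rwa [sub_add_eq_add_sub, add_neg_cancel, zero_sub] at h1

end RootBasis

namespace CoxeterSystem

variable {B : Type*} {M : CoxeterMatrix B} {W : Type*} [Group W] (cs : CoxeterSystem M W)

include cs in
-- The diagram would contain the affine diagram of type G₂, possibly with larger labels or an extra
-- edge, which makes the form only more negative.
theorem not_six_le_of_three_le [Finite W] {i j k : B} (hij : i ≠ j) (hik : i ≠ k) (hjk : j ≠ k)
    (h₁ : 6 ≤ M i j) : ¬ 3 ≤ M j k := by
  intro h₂
  set D := M.standardRootBasis
  have hform : ∀ i j, D.form (D.root i) (D.root j) = -(2 * Real.cos (Real.pi / M i j)) :=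
    M.standardForm_single
  have hcos : ∀ {m n : ℕ}, 0 < m → m ≤ n → Real.cos (Real.pi / m) ≤ Real.cos (Real.pi / n) := by
    intro m n hm hmn
    have hm' : (1 : ℝ) ≤ m := by exact_mod_cast hm
    have hmn' : (m : ℝ) ≤ n := by exact_mod_cast hmn
    refine Real.cos_le_cos_of_nonneg_of_le_pi (by positivity) ?_ ?_
    · exact div_le_self Real.pi_pos.le hm'
    · exact div_le_div_of_nonneg_left Real.pi_pos.le (by linarith) hmn'
  have e1 : D.form (D.root i) (D.root j) ≤ -√3 := by
    have h := hcos (by norm_num) h₁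
    rw [show ((6 : ℕ) : ℝ) = 6 by norm_num, Real.cos_pi_div_six] at h
    rw [hform]
    linarith
  have e2 : D.form (D.root j) (D.root k) ≤ -1 := by
    have h := hcos (by norm_num) h₂
    rw [show ((3 : ℕ) : ℝ) = 3 by norm_num, Real.cos_pi_div_three] at h
    rw [hform]
    linarith
  have e3 := D.form_root_root_nonpos hik
  have hs : √3 * √3 = 3 := Real.mul_self_sqrt (by norm_num)
  have hs0 : 0 ≤ √3 := Real.sqrt_nonneg 3
  -- For the labels 6 and 3 (and 2 between i and k) this vector is orthogonal to the three roots; it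
  -- spans the radical of the form of affine G₂.
  have hcone : √3 • D.root i + (2 : ℝ) • D.root j + D.root k ∈ D.cone :=
    add_mem (add_mem (D.smul_mem_cone hs0 (D.root_mem_cone i))
      (D.smul_mem_cone (by norm_num) (D.root_mem_cone j))) (D.root_mem_cone k)
  have hzero := D.eq_zero_of_antidominant cs hcone (by
    intro l
    have hexp : D.form (D.root l) (√3 • D.root i + (2 : ℝ) • D.root j + D.root k) =
        √3 * D.form (D.root l) (D.root i) + 2 * D.form (D.root l) (D.root j) +
          D.form (D.root l) (D.root k) := by simp
    rw [hexp]
    by_cases hli : l = i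
    · subst hli
      rw [D.form_root_self]
      linarith
    by_cases hlj : l = j
    · subst hlj
      rw [D.form_root_self, D.form_comm (D.root l) (D.root i)]
      nlinarith
    by_cases hlk : l = k
    · subst hlk
      rw [D.form_root_self, D.form_comm (D.root l) (D.root i), D.form_comm (D.root l) (D.root j)]
      nlinarith
    · have f1 := D.form_root_root_nonpos hli
      have f2 := D.form_root_root_nonpos hlj
      have f3 := D.form_root_root_nonpos hlk
      nlinarith)
  refine D.root_ne_zero k (D.eq_zero_of_mem_cone (D.root_mem_cone k) ?_)
  have h1 : -D.root k = √3 • D.root i + (2 : ℝ) • D.root j := by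
    rw [neg_eq_iff_add_eq_zero, add_comm]; exact hzero
  rw [h1]
  exact add_mem (D.smul_mem_cone hs0 (D.root_mem_cone i))
    (D.smul_mem_cone (by norm_num) (D.root_mem_cone j))

include cs in
theorem eq_two_of_six_le [Finite W] (hM : ∀ i j, M i j ≠ 0) {i j k : B} (hij : i ≠ j)
    (hik : i ≠ k) (hjk : j ≠ k) (h : 6 ≤ M i j) : M i k = 2 ∧ M j k = 2 := by
  have h1 := cs.not_six_le_of_three_le hij hik hjk h
  have h2 := cs.not_six_le_of_three_le hij.symm hjk hik (by rwa [M.symmetric])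
  have h3 := hM i k
  have h4 := hM j k
  have h5 := M.off_diagonal i k hik
  have h6 := M.off_diagonal j k hjk
  omega

include cs in
theorem isIsolated_pair [Finite W] (hM : ∀ i j, M i j ≠ 0) {i j : B} (h : 6 ≤ M i j) :
    M.IsIsolated {i, j} := by
  have hij : i ≠ j := by
    rintro rfl
    rw [M.diagonal] at h
    omega
  rintro l hl k hk
  simp only [Set.mem_insert_iff, Set.mem_singleton_iff, not_or] at hk
  have h1 := cs.eq_two_of_six_le hM hij (Ne.symm hk.1) (Ne.symm hk.2) h
  rcases hl with rfl | rfl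
  exacts [h1.1, h1.2]

include cs in
theorem isIsolated_small [Finite W] (hM : ∀ i j, M i j ≠ 0) :
    M.IsIsolated {i | ∀ j, M i j < 6} := by
  intro i hi k hk
  simp only [Set.mem_ofPred_eq, not_forall, not_lt] at hi hk
  obtain ⟨l, hl⟩ := hk
  have hkl : k ≠ l := by
    rintro rfl
    rw [M.diagonal] at hl
    omega
  have hki : k ≠ i := by
    rintro rfl
    have := hi l
    omega
  have hli : l ≠ i := by
    rintro rfl
    have := hi k
    rw [M.symmetric] at this
    omega
  have := (cs.eq_two_of_six_le hM hkl hki hli hl).1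
  rwa [M.symmetric]

/-- There are only finitely many such matrices. An infinite group has `Nat.card` equal to 0, so the
bound says something for finite groups only, and it is applied to those. -/
theorem exists_card_group_le (h : ℕ) : ∃ N : ℕ, ∀ r ≤ h, ∀ M : CoxeterMatrix (Fin r),
    (∀ i j, M i j < 6) → Nat.card M.Group ≤ N := by
  have hr : ∀ r : ℕ, ∃ N : ℕ, ∀ M : CoxeterMatrix (Fin r), (∀ i j, M i j < 6) →
      Nat.card M.Group ≤ N := by
    intro r
    have hfin : {M : CoxeterMatrix (Fin r) | ∀ i j, M i j < 6}.Finite := by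
      refine Set.Finite.of_injOn (f := fun M i j => (Fin.ofNat 6 (M i j))) (Set.mapsTo_univ _ _) ?_
        (Set.finite_univ (α := Fin r → Fin r → Fin 6))
      intro M hM M' hM' heq
      refine CoxeterMatrix.ext ?_
      ext i j
      have h1 := congrArg Fin.val (congrFun (congrFun heq i) j)
      simp only [Fin.val_ofNat] at h1
      rwa [Nat.mod_eq_of_lt (hM i j), Nat.mod_eq_of_lt (hM' i j)] at h1
    obtain ⟨N, hN⟩ := (hfin.image fun M => Nat.card M.Group).bddAbove
    exact ⟨N, fun M hM => hN ⟨M, hM, rfl⟩⟩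
  choose N hN using hr
  exact ⟨(Finset.range (h + 1)).sup N, fun r hr M hM => (hN r M hM).trans
    (Finset.le_sup (by simpa using Nat.lt_succ_of_le hr))⟩

/-! ### A uniform bound on the number of vertices -/

variable {cs} {h : ℕ} {F : Set (Fin (h + 1) → W)}

/-- The component of a vertex in the isolated pair is an alternating word. Its length occurs at one
of the h + 1 vertices of a fixed path, and one bit tells which of the two words it is. -/
theorem exists_code_pair [Finite W] (hM : ∀ i j, M i j ≠ 0) (hF : cs.IsFlipclass F) (i j : B) :
    ∃ c : W → Fin (h + 1) × Bool, 6 ≤ M i j → ∀ x ∈ vertexSet F, ∀ y ∈ vertexSet F, c x = c y →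
      M.standardRootBasis.action cs x (M.standardRootBasis.root i) =
        M.standardRootBasis.action cs y (M.standardRootBasis.root i) := by
  classical
  set D := M.standardRootBasis
  by_cases h6 : 6 ≤ M i j
  swap
  · exact ⟨fun _ => (0, true), fun h => absurd h h6⟩
  have hJ := cs.isIsolated_pair hM h6
  obtain ⟨x₁, hx₁⟩ := hF.nonempty
  have hlev : ∀ x ∈ vertexSet F, ∃ l, cs.length (cs.componentHom hJ x) =
      cs.length (cs.componentHom hJ (x₁ l)) := by
    rintro _ ⟨x, hx, k, rfl⟩
    exact D.exists_length_componentHom_eq hJ hF hx₁ x hx k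
  choose! l hl using hlev
  refine ⟨fun x => (l x, decide (cs.componentHom hJ x =
    cs.wordProd (alternatingWord i j (cs.length (cs.componentHom hJ x))))), fun _ => ?_⟩
  intro x hx y hy hxy
  rw [Prod.mk.injEq] at hxy
  have hlen : cs.length (cs.componentHom hJ x) = cs.length (cs.componentHom hJ y) := by
    rw [hl x hx, hl y hy, hxy.1]
  have heq : cs.componentHom hJ x = cs.componentHom hJ y := by
    have hx' := D.eq_wordProd_alternatingWord hJ (componentHom_componentHom (cs := cs) hJ x)
    have hy' := D.eq_wordProd_alternatingWord hJ (componentHom_componentHom (cs := cs) hJ y)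
    have hd := decide_eq_decide.mp hxy.2
    by_cases hc : cs.componentHom hJ x =
        cs.wordProd (alternatingWord i j (cs.length (cs.componentHom hJ x)))
    · rw [hc, hd.mp hc, hlen]
    · rw [hx'.resolve_left hc, hy'.resolve_left (fun h => hc (hd.mpr h)), hlen]
  have hroot : D.root i ∈ D.rootSpan {i, j} := Submodule.subset_span ⟨i, by simp, rfl⟩
  rw [← (D.action_componentHom hJ x hroot).1, ← (D.action_componentHom hJ y hroot).1, heq]

theorem exists_vertexSet_encard_le (h : ℕ) : ∃ N : ℕ, ∀ (B : Type u) (W : Type v) [Group W]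
    [Finite W] (M : CoxeterMatrix B) (cs : CoxeterSystem M W) (F : Set (Fin (h + 1) → W)),
    (∀ i j, M i j ≠ 0) → cs.IsFlipclass F → labelSubgroup F = ⊤ → (vertexSet F).encard ≤ N := by
  obtain ⟨N, hN⟩ := exists_card_group_le h
  -- N bounds the group of the components with entries below 6; each ordered pair of at most h
  -- indices contributes a code with (h + 1) * 2 values.
  refine ⟨N * ((((h + 1) * 2) ^ h) ^ h), ?_⟩
  intro B W _ _ M cs F hM hF htop
  set D := M.standardRootBasis
  obtain ⟨hfin, hcard⟩ := hF.finite_and_card_le htop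
  set J : Set B := {i | ∀ j, M i j < 6} with hJdef
  have hJ : M.IsIsolated J := cs.isIsolated_small hM
  let f : Fin (Nat.card J) ↪ B := (Finite.equivFin J).symm.toEmbedding.trans (Function.Embedding.subtype _)
  obtain ⟨φ, hφ, hφs⟩ := D.exists_injective_hom_restrict cs f
  have hfinG : Finite (M.restrict f).Group := Finite.of_injective φ hφ
  have hcardG : Nat.card (M.restrict f).Group ≤ N := by
    refine hN _ ((Nat.card_le_card_of_injective _ Subtype.val_injective).trans hcard) _ ?_
    intro a b
    exact ((Finite.equivFin J).symm a).2 _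
  have hrange : ∀ w, ∃ g, φ g = cs.componentHom hJ w := by
    intro w
    have h1 : cs.componentHom hJ w ∈ φ.range := by
      refine (Subgroup.closure_le _).mpr ?_ (componentHom_mem_closure hJ w)
      rintro _ ⟨i, hi, rfl⟩
      refine ⟨(M.restrict f).simple (Finite.equivFin J ⟨i, hi⟩), ?_⟩
      rw [hφs]
      change cs.simple ((Finite.equivFin J).symm (Finite.equivFin J ⟨i, hi⟩)) = cs.simple i
      rw [Equiv.symm_apply_apply]
    exact h1
  choose c₀ hc₀ using hrange
  choose c hc using exists_code_pair (cs := cs) (F := F) hM hF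
  have : Fintype B := Fintype.ofFinite B
  -- The codes determine the image of every simple root, hence the element: roots in J through the
  -- projection, the others through a pair with entry at least 6.
  have hinj : Set.InjOn (fun x => (c₀ x, fun i j => c i j x)) (vertexSet F) := by
    intro x hx y hy hxy
    rw [Prod.mk.injEq] at hxy
    have h1 : cs.componentHom hJ x = cs.componentHom hJ y := by rw [← hc₀, ← hc₀, hxy.1]
    have h2 : ∀ k, D.action cs x (D.root k) = D.action cs y (D.root k) := by
      intro k
      by_cases hk : k ∈ J
      · have hroot : D.root k ∈ D.rootSpan J := Submodule.subset_span ⟨k, hk, rfl⟩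
        rw [← (D.action_componentHom hJ x hroot).1, ← (D.action_componentHom hJ y hroot).1, h1]
      · simp only [hJdef, Set.mem_ofPred_eq, not_forall, not_lt] at hk
        obtain ⟨l, hl⟩ := hk
        exact hc k l hl x hx y hy (congrFun (congrFun hxy.2 k) l)
    have h3 : y⁻¹ * x = 1 := by
      refine D.eq_one_of_forall_action_root cs fun k => ?_
      rw [D.action_mul_apply, h2, D.action_inv_action]
    rw [inv_mul_eq_one] at h3
    exact h3.symm
  calc (vertexSet F).encard ≤ (Set.univ : Set ((M.restrict f).Group ×
        (B → B → Fin (h + 1) × Bool))).encard :=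
      Set.encard_le_encard_of_injOn (Set.mapsTo_univ _ _) hinj
    _ = Nat.card ((M.restrict f).Group × (B → B → Fin (h + 1) × Bool)) := by
      rw [Set.encard_univ, ENat.card_eq_coe_natCard]
    _ ≤ _ := by
      rw [Nat.card_prod, Nat.card_pi, Nat.card_pi]
      simp only [Nat.card_prod, Nat.card_eq_fintype_card (α := Fin (h + 1)), Fintype.card_fin,
        Nat.card_eq_fintype_card (α := Bool), Fintype.card_bool, Finset.prod_const, Finset.card_univ]
      rw [Nat.card_eq_fintype_card] at hcard
      norm_cast
      gcongr <;> first | omega | exact Nat.succ_le_of_lt (by positivity)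

end CoxeterSystem

/-! ### Isomorphism classes of flipclasses -/

theorem exists_bijOn_of_image_eq {α β γ : Type*} [Nonempty β] {A : Set α} {A' : Set β} {e : α → γ}
    {e' : β → γ} (he : Set.InjOn e A) (he' : Set.InjOn e' A') (h : e '' A = e' '' A') :
    ∃ f : α → β, Set.BijOn f A A' ∧ ∀ a ∈ A, e' (f a) = e a := by
  have h1 : ∀ a ∈ A, ∃ b ∈ A', e' b = e a := fun a ha => by
    have : e a ∈ e' '' A' := by rw [← h]; exact ⟨a, ha, rfl⟩
    exact this
  choose! f hf hfe using h1
  refine ⟨f, ⟨hf, fun a ha b hb hab => he ha hb ?_, fun b hb => ?_⟩, hfe⟩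
  · rw [← hfe a ha, ← hfe b hb, hab]
  · have h2 : e' b ∈ e '' A := by rw [h]; exact ⟨b, hb, rfl⟩
    obtain ⟨a, ha, hab⟩ := h2
    exact ⟨a, ha, he' (hf a ha) hb (by rw [hfe a ha, hab])⟩

theorem exists_injOn_fin {α : Type*} {A : Set α} {n : ℕ} (h : A.encard ≤ n) :
    ∃ e : α → Fin (n + 1), Set.InjOn e A := by
  classical
  have hfin : Finite A := Set.finite_of_encard_le_coe h
  have hcard : Nat.card A ≤ n + 1 := by
    rw [Nat.card_coe_set_eq]
    have := (Set.Finite.cast_ncard_eq (Set.toFinite A)).le.trans h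
    have : A.ncard ≤ n := by exact_mod_cast this
    omega
  refine ⟨fun a => if ha : a ∈ A then Fin.castLE hcard (Finite.equivFin A ⟨a, ha⟩) else 0, ?_⟩
  intro a ha b hb hab
  simp only [ha, hb, dif_pos] at hab
  have := (Finite.equivFin A).injective (Fin.castLE_injective hcard hab)
  exact congrArg Subtype.val this

namespace CoxeterSystem

variable {B : Type*} {M : CoxeterMatrix B} {W : Type*} [Group W] {cs : CoxeterSystem M W}
  {B' : Type*} {M' : CoxeterMatrix B'} {W' : Type*} [Group W'] {cs' : CoxeterSystem M' W'}
  {h : ℕ} {F : Set (Fin (h + 1) → W)} {F' : Set (Fin (h + 1) → W')}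

/-- The labelled paths of a flipclass, in terms of codes for vertices and labels. -/
def pathCode {V L : Type*} (e : W → V) (d : W → L) (F : Set (Fin (h + 1) → W)) :
    Set ((Fin (h + 1) → V) × (Fin h → L)) :=
  {p | ∃ x ∈ F, p = (e ∘ x, d ∘ pathLabel x)}

/-- The flips of a flipclass, in terms of codes for vertices. -/
def flipCode (cs : CoxeterSystem M W) {V : Type*} (e : W → V) (F : Set (Fin (h + 1) → W)) :
    Set (Fin h × (Fin (h + 1) → V) × (Fin (h + 1) → V)) :=
  {p | ∃ x ∈ F, ∃ (i : Fin h) (hi : (i : ℕ) + 1 < h), p = (i, e ∘ x, e ∘ cs.flip i hi x)}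

/-- The relation that `r` induces on the codes for the labels of a flipclass. -/
def relCode {L : Type*} (d : W → L) (F : Set (Fin (h + 1) → W)) (r : W → W → Prop) : Set (L × L) :=
  {p | ∃ s ∈ labelSet F, ∃ t ∈ labelSet F, r s t ∧ p = (d s, d t)}

/-- The orders of the labels of a flipclass that are induced by reflection orderings, in terms of
codes for the labels. -/
def orderCode (cs : CoxeterSystem M W) {L : Type*} (d : W → L) (F : Set (Fin (h + 1) → W)) :
    Set (Set (L × L)) :=
  relCode d F '' {r | cs.IsReflectionOrdering r}

theorem mem_relCode {L : Type*} {d : W → L} (hd : Set.InjOn d (labelSet F)) {r : W → W → Prop}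
    {s t : W} (hs : s ∈ labelSet F) (ht : t ∈ labelSet F) : (d s, d t) ∈ relCode d F r ↔ r s t := by
  refine ⟨?_, fun h => ⟨s, hs, t, ht, h, rfl⟩⟩
  rintro ⟨s', hs', t', ht', h, heq⟩
  rw [Prod.mk.injEq] at heq
  rwa [hd hs hs' heq.1, hd ht ht' heq.2]

theorem vertexSet_image {V L : Type*} (e : W → V) (d : W → L) :
    e '' vertexSet F = {a | ∃ p ∈ pathCode e d F, ∃ i, p.1 i = a} := by
  ext a
  constructor
  · rintro ⟨_, ⟨x, hx, i, rfl⟩, rfl⟩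
    exact ⟨_, ⟨x, hx, rfl⟩, i, rfl⟩
  · rintro ⟨_, ⟨x, hx, rfl⟩, i, rfl⟩
    exact ⟨_, ⟨x, hx, i, rfl⟩, rfl⟩

theorem labelSet_image {V L : Type*} (e : W → V) (d : W → L) :
    d '' labelSet F = {a | ∃ p ∈ pathCode e d F, ∃ i, p.2 i = a} := by
  ext a
  constructor
  · rintro ⟨_, ⟨x, hx, i, rfl⟩, rfl⟩
    exact ⟨_, ⟨x, hx, rfl⟩, i, rfl⟩
  · rintro ⟨_, ⟨x, hx, rfl⟩, i, rfl⟩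
    exact ⟨_, ⟨x, hx, i, rfl⟩, rfl⟩

/-- Flipclasses with equal codes are isomorphic to the same flipclasses. -/
theorem flipclassIso_of_code_eq {V L : Type*} {e : W → V} {d : W → L} {e' : W' → V} {d' : W' → L}
    (he : Set.InjOn e (vertexSet F)) (hd : Set.InjOn d (labelSet F))
    (he' : Set.InjOn e' (vertexSet F')) (hd' : Set.InjOn d' (labelSet F'))
    (hF : cs.IsFlipclass F) (hF' : cs'.IsFlipclass F')
    (hpath : pathCode e d F = pathCode e' d' F') (hflip : cs.flipCode e F = cs'.flipCode e' F')
    (horder : cs.orderCode d F = cs'.orderCode d' F') {B'' : Type*} {M'' : CoxeterMatrix B''}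
    {W'' : Type*} [Group W''] {cs'' : CoxeterSystem M'' W''} {F'' : Set (Fin (h + 1) → W'')}
    (hiso : FlipclassIso cs' cs'' F' F'') : FlipclassIso cs cs'' F F'' := by
  obtain ⟨ε, hε, hεe⟩ := exists_bijOn_of_image_eq he he'
    (by rw [vertexSet_image e d, hpath, ← vertexSet_image])
  obtain ⟨τ, hτ, hτd⟩ := exists_bijOn_of_image_eq hd hd'
    (by rw [labelSet_image e d, hpath, ← labelSet_image])
  have hcongr : ∀ {x : Fin (h + 1) → W} {x' : Fin (h + 1) → W'}, (∀ i, x i ∈ vertexSet F) →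
      (∀ i, x' i ∈ vertexSet F') → e ∘ x = e' ∘ x' → ε ∘ x = x' := fun hx hx' heq =>
    funext fun i => he' (hε.mapsTo (hx i)) (hx' i) (by rw [hεe _ (hx i)]; exact congrFun heq i)
  have hmem : ∀ {x : Fin (h + 1) → W}, x ∈ F → ∀ i, x i ∈ vertexSet F := fun hx i => ⟨_, hx, i, rfl⟩
  have hmem' : ∀ {x : Fin (h + 1) → W'}, x ∈ F' → ∀ i, x i ∈ vertexSet F' :=
    fun hx i => ⟨_, hx, i, rfl⟩
  have hpaths : ∀ (x : Fin (h + 1) → W) (t : Fin h → W), (∀ i, x i ∈ vertexSet F) →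
      (∀ i, t i ∈ labelSet F) →
      ((x ∈ F ∧ pathLabel x = t) ↔ (ε ∘ x ∈ F' ∧ pathLabel (ε ∘ x) = τ ∘ t)) := by
    intro x t hx ht
    have hτt : d' ∘ (τ ∘ t) = d ∘ t := funext fun i => hτd _ (ht i)
    constructor
    · rintro ⟨hxF, rfl⟩
      have h1 : (e ∘ x, d ∘ pathLabel x) ∈ pathCode e' d' F' := by
        rw [← hpath]; exact ⟨x, hxF, rfl⟩
      obtain ⟨x', hx', heq⟩ := h1
      rw [Prod.mk.injEq] at heq
      obtain rfl := hcongr hx (hmem' hx') heq.1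
      refine ⟨hx', funext fun i => ?_⟩
      refine hd' ⟨_, hx', i, rfl⟩ (hτ.mapsTo (ht i)) ?_
      rw [Function.comp_apply, hτd _ (ht i)]
      exact (congrFun heq.2 i).symm
    · rintro ⟨hxF, hlab⟩
      have h1 : (e' ∘ (ε ∘ x), d' ∘ pathLabel (ε ∘ x)) ∈ pathCode e d F := by
        rw [hpath]; exact ⟨_, hxF, rfl⟩
      obtain ⟨y, hy, heq⟩ := h1
      rw [Prod.mk.injEq] at heq
      have hyx : y = x := funext fun i => he (hmem hy i) (hx i) (by
        have := congrFun heq.1 i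
        simp only [Function.comp_apply] at this
        rw [← this, hεe _ (hx i)])
      subst hyx
      refine ⟨hy, funext fun i => hd ⟨_, hy, i, rfl⟩ (ht i) ?_⟩
      have := congrFun heq.2 i
      rw [hlab, hτt] at this
      exact this.symm
  have hflips : ∀ x ∈ F, ∀ (i : ℕ) (hi : i + 1 < h),
      ε ∘ cs.flip i hi x = cs'.flip i hi (ε ∘ x) := by
    intro x hx i hi
    have h1 : ((⟨i, by omega⟩ : Fin h), e ∘ x, e ∘ cs.flip i hi x) ∈ cs'.flipCode e' F' := by
      rw [← hflip]; exact ⟨x, hx, _, hi, rfl⟩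
    obtain ⟨x', hx', j, hj, heq⟩ := h1
    simp only [Prod.mk.injEq] at heq
    obtain ⟨rfl, h2, h3⟩ := heq
    obtain rfl := hcongr (hmem hx) (hmem' hx') h2
    exact hcongr (hmem (hF.flip_mem hx i hi)) (hmem' (hF'.flip_mem hx' i hi)) h3
  -- The ordering r' comes with the second isomorphism and cannot be prescribed. As the code records
  -- the orders induced by all reflection orderings, the first group has an ordering that induces
  -- the same order on labels.
  obtain ⟨ε₂, τ₂, i1, i2, i3, i4, r', r'', hr', hr'', i5⟩ := hiso
  have h1 : relCode d' F' r' ∈ cs.orderCode d F := by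
    rw [horder]; exact ⟨r', hr', rfl⟩
  obtain ⟨r, hr, hrr⟩ := h1
  refine ⟨ε₂ ∘ ε, τ₂ ∘ τ, i1.comp hε, i2.comp hτ, ?_, ?_, r, r'', hr, hr'', ?_⟩
  · intro x t hx ht
    rw [hpaths x t hx ht]
    exact i3 (ε ∘ x) (τ ∘ t) (fun i => hε.mapsTo (hx i)) (fun i => hτ.mapsTo (ht i))
  · intro x hx i hi
    rw [Function.comp_assoc, hflips x hx i hi, Function.comp_assoc]
    refine i4 _ ?_ i hi
    exact ((hpaths x _ (hmem hx) fun i => ⟨x, hx, i, rfl⟩).mp ⟨hx, rfl⟩).1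
  · intro s hs t ht
    refine Iff.trans ?_ (i5 _ (hτ.mapsTo hs) _ (hτ.mapsTo ht))
    rw [← mem_relCode (r := r) hd hs ht, hrr, ← hτd s hs, ← hτd t ht]
    exact mem_relCode (r := r') hd' (hτ.mapsTo hs) (hτ.mapsTo ht)

/-- A label is a quotient of two vertices, so codes of vertices also give codes of labels. -/
theorem exists_injOn_labelSet {V : Type*} {e : W → V} (he : Set.InjOn e (vertexSet F)) :
    ∃ d : W → V × V, Set.InjOn d (labelSet F) := by
  have h1 : ∀ t ∈ labelSet F, ∃ w x, w ∈ vertexSet F ∧ x ∈ vertexSet F ∧ t = x * w⁻¹ := by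
    rintro _ ⟨x, hx, i, rfl⟩
    exact ⟨_, _, ⟨x, hx, _, rfl⟩, ⟨x, hx, _, rfl⟩, rfl⟩
  choose! w x hw hx hwx using h1
  refine ⟨fun t => (e (w t), e (x t)), fun s hs t ht heq => ?_⟩
  rw [Prod.mk.injEq] at heq
  rw [hwx s hs, hwx t ht, he (hw s hs) (hw t ht) heq.1, he (hx s hs) (hx t ht) heq.2]

theorem canonicalMatrix_ne_zero (H : Subgroup W) [Finite H] (a b : cs.canonicalGenerators H) :
    cs.canonicalMatrix H a b ≠ 0 := by
  change orderOf ((a : H) * (b : H) : W) ≠ 0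
  rw [← Subgroup.coe_mul, Subgroup.orderOf_coe]
  exact (orderOf_pos _).ne'

end CoxeterSystem

/-! ### Finiteness of the set of isomorphism classes -/

namespace Flipclass

open CoxeterSystem

theorem exists_forall_vertexSet_encard_le (h : ℕ) :
    ∃ N : ℕ, ∀ X : Flipclass.{u, v} h, X.IsFiniteType → (vertexSet X.F).encard ≤ N := by
  obtain ⟨N, hN⟩ := exists_vertexSet_encard_le.{v, v} h
  refine ⟨N, fun X hX => ?_⟩
  have hfin : Finite (labelSubgroup X.F) := hX
  -- The copy of the flipclass in W(F) has equally many vertices, and its labels generate the whole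
  -- finite group.
  obtain ⟨F', hF', hlab, ⟨ε, τ, hε, -⟩, -⟩ :=
    X.M.standardRootBasis.exists_flipclass_subsystem X.isFlipclass
  have h1 := hN _ _ _ _ F' (canonicalMatrix_ne_zero (cs := X.cs) _) hF'
    (labelSubgroup_eq_top_of_image hlab)
  exact (Set.encard_le_encard_of_injOn hε.mapsTo hε.injOn).trans h1

/-- There are only finitely many isomorphism classes of flipclasses of finite type. -/
theorem finite_isoClass (h : ℕ) : {C : Set (Flipclass.{u, v} h) |
    ∃ X : Flipclass.{u, v} h, X.IsFiniteType ∧ C = X.isoClass}.Finite := by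
  obtain ⟨N, hN⟩ := exists_forall_vertexSet_encard_le h
  have hcode : ∀ X : Flipclass.{u, v} h, X.IsFiniteType →
      ∃ (e : X.W → Fin (N + 1)) (d : X.W → Fin (N + 1) × Fin (N + 1)),
        Set.InjOn e (vertexSet X.F) ∧ Set.InjOn d (labelSet X.F) := by
    intro X hX
    obtain ⟨e, he⟩ := exists_injOn_fin (hN X hX)
    obtain ⟨d, hd⟩ := exists_injOn_labelSet he
    exact ⟨e, d, he, hd⟩
  have : ∀ X : Flipclass.{u, v} h, Nonempty X.W := fun X => ⟨1⟩
  choose! e d he hd using hcode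
  have hrep : ∀ C ∈ {C : Set (Flipclass.{u, v} h) |
      ∃ X : Flipclass.{u, v} h, X.IsFiniteType ∧ C = X.isoClass},
      ∃ X : Flipclass.{u, v} h, X.IsFiniteType ∧ C = X.isoClass := fun C hC => hC
  by_cases hne : Nonempty (Flipclass.{u, v} h)
  swap
  · refine Set.Finite.subset Set.finite_empty ?_
    rintro C ⟨X, -⟩
    exact absurd ⟨X⟩ hne
  choose! X hX hXC using hrep
  -- A class is sent to the code of a chosen representative. The codes form a finite type, and equal
  -- codes give equal classes, with no appeal to transitivity of isomorphism.
  refine Set.Finite.of_injOn (t := Set.univ) (f := fun C => (pathCode (e (X C)) (d (X C)) (X C).F,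
    (X C).cs.flipCode (e (X C)) (X C).F, (X C).cs.orderCode (d (X C)) (X C).F))
    (Set.mapsTo_univ _ _) ?_ Set.finite_univ
  intro C hC C' hC' heq
  simp only [Prod.mk.injEq] at heq
  obtain ⟨h1, h2, h3⟩ := heq
  rw [hXC C hC, hXC C' hC']
  have hx := hX C hC
  have hx' := hX C' hC'
  ext Y
  constructor
  · exact flipclassIso_of_code_eq (he _ hx') (hd _ hx') (he _ hx) (hd _ hx) (X C').isFlipclass
      (X C).isFlipclass h1.symm h2.symm h3.symm
  · exact flipclassIso_of_code_eq (he _ hx) (hd _ hx) (he _ hx') (hd _ hx') (X C).isFlipclass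
      (X C').isFlipclass h1 h2 h3

end Flipclass

/-! ### The theorem -/

theorem mainTheorem5 (h : ℕ) :
    (∀ (B : Type u) (W : Type v) [Group W] (M : CoxeterMatrix B) (cs : CoxeterSystem M W)
      (F : Set (Fin (h + 1) → W)), cs.IsFlipclass F →
      (CoxeterSystem.IsFiniteType F ∨ cs.IsWeylType F ∨ cs.IsSymmetricType F) →
      ∃ (B' : Type v) (M' : CoxeterMatrix B')
        (cs' : CoxeterSystem M' (CoxeterSystem.labelSubgroup F))
        (F' : Set (Fin (h + 1) → CoxeterSystem.labelSubgroup F)),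
        Set.range cs'.simple = cs.canonicalGenerators (CoxeterSystem.labelSubgroup F) ∧
        cs'.IsFlipclass F' ∧
        CoxeterSystem.FlipclassIso cs cs' F F' ∧
        (∃ c : ℕ, cs.HasIncreasingCount F c ∧ cs'.HasIncreasingCount F' c) ∧
        Finite (CoxeterSystem.labelSubgroup F) ∧
        (cs.IsWeylType F → IsWeylGroup (Set.range cs'.simple)) ∧
        (cs.IsSymmetricType F → IsProductOfTypeA (Set.range cs'.simple)) ∧
        (Set.range cs'.simple).encard ≤ h ∧
        (CoxeterSystem.IsIrreducibleFlipclass F →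
          ¬ HasCommutingPartition (Set.range cs'.simple))) ∧
    {C : Set (Flipclass.{u, v} h) |
      ∃ X : Flipclass.{u, v} h, X.IsFiniteType ∧ C = X.isoClass}.Finite := by
  refine ⟨?_, Flipclass.finite_isoClass h⟩
  intro B W _ M cs F hF htype
  have hfin := CoxeterSystem.finite_labelSubgroup htype
  set D := M.standardRootBasis
  have hH := hF.isReflectionSubgroup
  obtain ⟨F', hF', hlab, hiso, hcount⟩ := D.exists_flipclass_subsystem hF
  have htop := CoxeterSystem.labelSubgroup_eq_top_of_image hlab
  have hrange := CoxeterSystem.range_subsystem_simple D hH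
  obtain ⟨c, hc⟩ := CoxeterSystem.exists_hasIncreasingCount hF'
  refine ⟨_, _, D.subsystem hH, F', hrange, hF', hiso, ⟨c, ⟨cs.exists_isReflectionOrdering, ?_⟩, hc⟩,
    hfin, ?_, ?_, hF'.encard_range_simple_le htop, ?_⟩
  -- W may be infinite here: r is restricted to the finite group W(F), where the count does not
  -- depend on the ordering.
  · intro r hr
    rw [hcount r]
    exact hc.2 _ (RootBasis.isReflectionOrdering_subsystem hr hH)
  · rw [hrange]; exact id
  · rw [hrange]; exact id
  · intro hirr hpart
    exact hirr (CoxeterSystem.labelSet_map (CoxeterSystem.labelSubgroup F).subtype hlab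
      ((D.restrict cs _).hasCommutingPartition_labelSet hF' htop hpart)
      (Subgroup.subtype_injective _))
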